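/- **Maximum principle.** Let $\mathfrak g=V_1\oplus\cdots\oplus V_s$ be a stratified real Lie algebra of step $s\ge 1$ of finite dimension, that is, $[V_1,V_l]=V_{l+1}$ for $1\le l<s$, $[V_1,V_s]=\{0\}$ and $V_s\neq\{0\}$, and let $G$ be the corresponding Carnot group in exponential coordinates: bases of the layers identify $\mathfrak g$ with $\mathbb R^{N}$, $N=\sum_l \dim V_l$, and $G=\mathbb R^{N}$ carries the group law given by the Baker–Campbell–Hausdorff formula. Let $Q=\sum_{l=1}^s l\,\dim V_l$ be the homogeneous dimension, let $|\cdot|$ of a set denote a fixed bi-invariant Haar measure of $G$, let $X_1,\dots,X_m$ be the chosen basis of $V_1$, regarded as left-invariant vector fields $(X_iu)(\xi)=\frac{d}{dt}\big|_{t=0}u(\xi\exp(tX_i))$, and let $L=\sum_{i=1}^m X_i^2$ be the sub-Laplacian. Then there is a constant $C>0$, depending only on $G$, the basis and the Haar measure, such that the following holds. Let $\Omega\subset G$ be an open set with $|\Omega|<\infty$, let $f\in L^\infty(\Omega)$, and let $u\in C^2(\Omega)\cap C(\overline\Omega)$ be bounded on $\Omega$ (which is automatic if $\Omega$ is bounded),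 with $Lu=f$ almost everywhere in $\Omega$ and $u=g$ on $\partial\Omega$. Then $$\sup_\Omega|u|\;\le\;\sup_{\partial\Omega}|g|+C\,\|f\|_{L^\infty(\Omega)}\,|\Omega|^{2/Q}\,2^{(Q+2)/4}.$$ -/

import Mathlib

open MeasureTheory
open scoped ENNReal NNReal

noncomputable section

/-- The right-nested iterated commutator `[a₁, [a₂, [..., [aₙ₋₁, aₙ]]]]` of a word. -/
def iteratedBracket {𝔤 : Type*} [LieRing 𝔤] : List 𝔤 → 𝔤
  | [] => 0
  | [a] => a
  | a :: b :: w => ⁅a, iteratedBracket (b :: w)⁆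

/-- The Baker-Campbell-Hausdorff series of `x` and `y` in Dynkin's form,
`∑ₙ (-1)ⁿ⁻¹/n ∑ [x^{p₁} y^{q₁} ⋯ x^{pₙ} y^{qₙ}] / ((∑ᵢ (pᵢ + qᵢ)) ∏ᵢ pᵢ! qᵢ!)`, the inner sum being over
all `p, q` with `pᵢ + qᵢ > 0`. The sums stop at `n = s` and `pᵢ, qᵢ = s`: in a Lie algebra that is
nilpotent of step `s`, all the omitted terms vanish, since they are commutators of length `> s`. -/
def bchProduct {𝔤 : Type*} [LieRing 𝔤] [LieAlgebra ℝ 𝔤] (s : ℕ) (x y : 𝔤) : 𝔤 :=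
  ∑ n ∈ Finset.Icc 1 s, ((-1 : ℝ) ^ (n - 1) / (n : ℝ)) •
    ∑ p : Fin n → Fin (s + 1), ∑ q : Fin n → Fin (s + 1),
      if ∀ i, 0 < (p i : ℕ) + (q i : ℕ) then
        (((∑ i, ((p i : ℕ) + (q i : ℕ)) : ℕ) : ℝ) *
            ((∏ i, ((p i : ℕ).factorial * (q i : ℕ).factorial) : ℕ) : ℝ))⁻¹ •
          iteratedBracket (List.ofFn fun i =>
            List.replicate (p i : ℕ) x ++ List.replicate (q i : ℕ) y).flatten
      else 0

/-- A Carnot group of step `s` in exponential coordinates: a real Lie algebra `𝔤` with a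
stratification `𝔤 = V₁ ⊕ ⋯ ⊕ V_s`, `[V₁, V_l] = V_{l+1}` for `1 ≤ l < s`, `[V₁, V_s] = 0`, `V_s ≠ 0`,
and with a basis of every layer (`V_{l+1}` has dimension `m l`, for `l = 0, …, s - 1`).
The group is the simply connected group of `𝔤`: the coordinate space, with the
Baker-Campbell-Hausdorff product, see `CarnotGroup.mul`. -/
structure CarnotGroup (𝔤 : Type*) [LieRing 𝔤] [LieAlgebra ℝ 𝔤] (s : ℕ) (m : Fin s → ℕ) where
  /-- `layer l` is `V_l`, for `1 ≤ l ≤ s`; the values at other `l` play no role. -/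
  layer : ℕ → Submodule ℝ 𝔤
  one_le_step : 1 ≤ s
  isInternal : DirectSum.IsInternal fun l : Fin s => layer (l + 1)
  bracket_layer : ∀ l : ℕ, 1 ≤ l → l < s →
    Submodule.span ℝ {z : 𝔤 | ∃ x ∈ layer 1, ∃ y ∈ layer l, ⁅x, y⁆ = z} = layer (l + 1)
  bracket_top : ∀ x ∈ layer 1, ∀ y ∈ layer s, ⁅x, y⁆ = 0
  top_ne_bot : layer s ≠ ⊥
  /-- the basis of each layer that defines the coordinates -/
  basis : ∀ l : Fin s, Module.Basis (Fin (m l)) ℝ (layer (l + 1))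

namespace CarnotGroup

/-- The coordinates `ξ = (z₁, …, z_s)`, with `z_l` a vector of `dim V_l` reals. -/
abbrev Coord {s : ℕ} (m : Fin s → ℕ) : Type := (Σ l : Fin s, Fin (m l)) → ℝ

variable {𝔤 : Type*} [LieRing 𝔤] [LieAlgebra ℝ 𝔤] {s : ℕ} {m : Fin s → ℕ}

/-- The linear identification of the coordinate space with the Lie algebra. -/
def toLie (G : CarnotGroup 𝔤 s m) : Coord m ≃ₗ[ℝ] 𝔤 :=
  (G.isInternal.collectedBasis G.basis).equivFun.symm

/-- The group law in exponential coordinates. -/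
def mul (G : CarnotGroup 𝔤 s m) (ξ η : Coord m) : Coord m :=
  G.toLie.symm (bchProduct s (G.toLie ξ) (G.toLie η))

/-- The homogeneous dimension `Q = ∑ l · dim V_l`. -/
def homDim (_G : CarnotGroup 𝔤 s m) : ℕ := ∑ l : Fin s, ((l : ℕ) + 1) * m l

/-- The dimension of the first layer. -/
def rank (G : CarnotGroup 𝔤 s m) : ℕ := m ⟨0, G.one_le_step⟩

/-- The point `exp (t Xᵢ)`, where `X₁, X₂, …` is the chosen basis of the first layer. -/
def expX (G : CarnotGroup 𝔤 s m) (i : Fin G.rank) (t : ℝ) : Coord m :=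
  Pi.single ⟨⟨0, G.one_le_step⟩, i⟩ t

/-- The derivative along the left-invariant vector field `Xᵢ`:
`(Xᵢ u)(ξ) = d/dt u(ξ exp(t Xᵢ))` at `t = 0`. -/
def X (G : CarnotGroup 𝔤 s m) (i : Fin G.rank) (u : Coord m → ℝ) (ξ : Coord m) : ℝ :=
  deriv (fun t : ℝ => u (G.mul ξ (G.expX i t))) 0

/-- The sub-Laplacian `L = ∑ Xᵢ²`. -/
def subLaplacian (G : CarnotGroup 𝔤 s m) (u : Coord m → ℝ) (ξ : Coord m) : ℝ :=
  ∑ i : Fin G.rank, G.X i (G.X i u) ξ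

/-- `μ` is a bi-invariant Haar measure of the group. -/
structure IsHaar (G : CarnotGroup 𝔤 s m) (μ : Measure (Coord m)) : Prop where
  ne_zero : μ ≠ 0
  finite_of_isCompact : ∀ K : Set (Coord m), IsCompact K → μ K < ∞
  left_invariant : ∀ ξ : Coord m, MeasurePreserving (fun η => G.mul ξ η) μ μ
  right_invariant : ∀ ξ : Coord m, MeasurePreserving (fun η => G.mul η ξ) μ μ

end CarnotGroup

end

open Finset.HasAntidiagonal (antidiagonal)

noncomputable section

/-! ### Logarithms of unipotent elements -/

/-! The bound comes from the level-set method of De Giorgi and Stampacchia, run with a Faber-Krahn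
inequality whose exponent 2/Q is dictated by the dilations.

Faber-Krahn (`IsHaar.exists_faberKrahn`). Since V₁ generates 𝔤, every point of the group is a finite
product of horizontal exponentials exp(tXᵢ), so some compact set A of products of n factors with |t|
≤ r₀ has positive measure. Right translation by such a product changes v in L² by at most a constant
times r₀ ‖∇v‖, where ∇ is the horizontal gradient. If v ≥ 0 lives on a set of measure at most S,
averaging over a dilate of A of measure 4S gives ∫v² ≤ C S^(2/Q) ∫|∇v|², because a dilation by r
multiplies measure by r^Q.

Energy. Let k exceed u on the boundary, let |Lu| ≤ F, and put w = (u - k)⁺. The powers w² and w⁴ are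
C¹ and C², so classical calculus suffices: L(w⁴) = 3|∇w²|² + 4w³Lu, and integration gives 3∫|∇w²|² ≤
4F∫w³. As Ω may be unbounded, this uses dilated cutoffs. Faber-Krahn for w², Young and Chebyshev
bound the measure of {u > h} by that of {u > k} (`IsHaar.exists_superlevel_decay`). Iterating over
levels that increase to k + K, with K a multiple of F|Ω|^(2/Q), shows that {u > k + K} is null,
hence empty. The same holds for -u. The remaining factor 2^((Q+2)/4) is at least 1 and only weakens
the bound.

Group structure. The product is given only as Dynkin's truncated series, so it has to be shown to be
a group law. In a faithful representation by nilpotent operators the series equals log(e^x e^y)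
(`map_bchProduct_eq_log`), and associativity and conjugation are inherited from operators
(`exp_rep_injective`). The grading makes dilations automorphisms. Left translations then have
Jacobian 1, so a Haar measure is a multiple of Lebesgue measure and scales by r^Q. -/

theorem sum_antidiagonal_eq_sum_range_product {M : Type*} [AddCommMonoid M] (a : ℕ → ℕ → M)
    {s K L : ℕ} (hL : s + K ≤ L) (h₁ : ∀ k j, s ≤ k → a k j = 0) (h₂ : ∀ k j, K ≤ j → a k j = 0) :
    ∑ n ∈ Finset.range L, ∑ p ∈ antidiagonal n, a p.1 p.2 =
      ∑ k ∈ Finset.range s, ∑ j ∈ Finset.range K, a k j := by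
  rw [← Finset.sum_product', ← Finset.sum_fiberwise_of_maps_to
    (s := Finset.range s ×ˢ Finset.range K) (t := Finset.range L) (g := fun p : ℕ × ℕ => p.1 + p.2)]
  · refine Finset.sum_congr rfl fun n _ => (Finset.sum_subset ?_ ?_).symm
    · intro p hp
      simp only [Finset.mem_filter] at hp
      simpa using hp.2
    · intro p hp hp'
      simp only [Finset.HasAntidiagonal.mem_antidiagonal, Finset.mem_filter, Finset.mem_product,
        Finset.mem_range] at hp hp'
      by_cases h : s ≤ p.1
      · exact h₁ _ _ h
      · exact h₂ _ _ (by by_contra hK; exact hp' ⟨⟨by omega, by omega⟩, hp⟩)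
  · intro p hp
    simp only [Finset.mem_product, Finset.mem_range] at hp ⊢
    omega

/-- The binomial series of `(1 + N)⁻¹ ^ (k + 1)` for nilpotent `N`. -/
theorem one_add_pow_mul_sum_choose {A : Type*} [Ring A] {N : A} {K : ℕ} (hN : N ^ K = 0) (k : ℕ) :
    (1 + N) ^ (k + 1) *
      ∑ j ∈ Finset.range K, ((-1 : ℤ) ^ j * ((k + j).choose k : ℤ)) • N ^ j = 1 := by
  have geom : (1 + N) * ∑ j ∈ Finset.range K, ((-1 : ℤ) ^ j) • N ^ j = 1 := by
    have h := mul_neg_geom_sum (-N) K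
    rw [neg_pow N K, hN, mul_zero, sub_zero, sub_neg_eq_add] at h
    refine Eq.trans (congrArg _ (Finset.sum_congr rfl fun j _ => ?_)) h
    rw [neg_pow N j, zsmul_eq_mul]
    push_cast
    rfl
  induction k with
  | zero => simpa using geom
  | succ k ih =>
    rw [pow_succ, mul_assoc]
    convert ih using 2
    rw [add_mul, one_mul]
    rcases K with _ | K
    · simp
    rw [Finset.mul_sum, Finset.sum_range_succ' _ K, Finset.sum_range_succ _ K,
      Finset.sum_range_succ' (fun j => ((-1 : ℤ) ^ j * ((k + j).choose k : ℤ)) • N ^ j) K]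
    have hz : N * (((-1 : ℤ) ^ K * ((k + 1 + K).choose (k + 1) : ℤ)) • N ^ K) = 0 := by
      rw [mul_smul_comm, ← pow_succ', hN, smul_zero]
    rw [hz, add_right_comm, add_zero, ← Finset.sum_add_distrib]
    congr 1
    · refine Finset.sum_congr rfl fun j _ => ?_
      rw [mul_smul_comm, ← pow_succ', ← add_smul]
      congr 1
      have hc : (k + 1 + (j + 1)).choose (k + 1) =
          (k + (j + 1)).choose k + (k + 1 + j).choose (k + 1) := by
        rw [show k + 1 + (j + 1) = (k + 1 + j) + 1 by ring, Nat.choose_succ_succ]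
        congr 2
        ring
      rw [hc]
      push_cast
      ring
    · simp

/-- If `N' = c₀ (1 + N)` and `N cₖ - cₖ N = cₖ₊₁ (1 + N)`, the derivative of a power of `N`. -/
theorem hasDerivAt_pow_succ_of_commutator {A : Type*} [NormedRing A] [NormedAlgebra ℝ A] {N : ℝ → A}
    {t : ℝ} {c : ℕ → A} (h₀ : HasDerivAt N (c 0 * (1 + N t)) t)
    (hc : ∀ k, N t * c k = c (k + 1) * (1 + N t) + c k * N t) (n : ℕ) :
    HasDerivAt (fun τ => N τ ^ (n + 1)) (∑ p ∈ antidiagonal n,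
      (n + 1).choose (p.1 + 1) • (c p.1 * (1 + N t) ^ (p.1 + 1) * N t ^ p.2)) t := by
  have hcomm : Commute (1 + N t) (N t) := (Commute.one_left _).add_left (Commute.refl _)
  induction n with
  | zero => simpa using h₀
  | succ n ih =>
    have h := h₀.mul ih
    have hfun : (N * fun τ => N τ ^ (n + 1)) = fun τ => N τ ^ (n + 1 + 1) := by
      ext τ
      simp [pow_succ' (N τ) (n + 1)]
    rw [hfun] at h
    convert h using 1
    set g : ℕ → ℕ → A := fun k j => c k * (1 + N t) ^ (k + 1) * N t ^ j with hg
    -- Moving N t past c k either raises the index of c or adds a power of N t on the right, so the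
    -- coefficients obey Pascal's rule.
    have hNg : ∀ k j, N t * g k j = g (k + 1) j + g k (j + 1) := by
      intro k j
      simp only [hg]
      rw [mul_assoc, ← mul_assoc, hc, add_mul]
      congr 1
      · rw [pow_succ' _ (k + 1)]
        simp only [mul_assoc]
      · rw [pow_succ' (N t) j]
        simp only [mul_assoc]
        rw [← mul_assoc (N t), ← mul_assoc ((1 + N t) ^ (k + 1)), (hcomm.pow_left (k + 1)).eq]
    have h1 : ∑ p ∈ antidiagonal (n + 1), (n + 1).choose p.1 • g p.1 p.2 =
        g 0 (n + 1) + ∑ p ∈ antidiagonal n, (n + 1).choose (p.1 + 1) • g (p.1 + 1) p.2 := by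
      rw [Finset.Nat.sum_antidiagonal_succ]
      simp
    have h2 : ∑ p ∈ antidiagonal (n + 1), (n + 1).choose (p.1 + 1) • g p.1 p.2 =
        ∑ p ∈ antidiagonal n, (n + 1).choose (p.1 + 1) • g p.1 (p.2 + 1) := by
      rw [Finset.Nat.sum_antidiagonal_succ']
      simp
    have h3 : ∑ p ∈ antidiagonal (n + 1), (n + 1 + 1).choose (p.1 + 1) • g p.1 p.2 =
        ∑ p ∈ antidiagonal (n + 1), (n + 1).choose p.1 • g p.1 p.2 +
        ∑ p ∈ antidiagonal (n + 1), (n + 1).choose (p.1 + 1) • g p.1 p.2 := by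
      rw [← Finset.sum_add_distrib]
      refine Finset.sum_congr rfl fun p _ => ?_
      rw [← add_smul, Nat.choose_succ_succ]
    rw [h3, h1, h2, Finset.mul_sum, add_assoc, ← Finset.sum_add_distrib]
    congr 1
    · simp [hg]
    · refine Finset.sum_congr rfl fun p _ => ?_
      rw [mul_smul_comm, ← smul_add, ← hNg]

/-- The truncated logarithm series `∑_{n < L} (-1)ⁿ / (n + 1) Nⁿ⁺¹` of `1 + N`. -/
def logOneAdd {A : Type*} [Ring A] [Algebra ℝ A] (L : ℕ) (N : A) : A :=
  ∑ n ∈ Finset.range L, ((-1 : ℝ) ^ n / (n + 1 : ℝ)) • N ^ (n + 1)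

/-- With E = 1 + N, the hypotheses say c 0 = E′E⁻¹ and c (k + 1) = E (c k) E⁻¹ - c k. The derivative
of log E is therefore the power series log(Ad E)/(Ad E - 1) applied to E′E⁻¹. In the proof, the
terms with a fixed c k sum over j to the binomial series of (1 + N)^(-(k+1)), which cancels the
factor (1 + N)^(k+1). The bound s + K ≤ L ensures that the truncation drops only zero terms. -/
theorem hasDerivAt_logOneAdd_of_commutator {A : Type*} [NormedRing A] [NormedAlgebra ℝ A]
    {N : ℝ → A} {t : ℝ} {c : ℕ → A} (h₀ : HasDerivAt N (c 0 * (1 + N t)) t)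
    (hc : ∀ k, N t * c k = c (k + 1) * (1 + N t) + c k * N t) {s K L : ℕ} (hN : N t ^ K = 0)
    (hcs : ∀ k, s ≤ k → c k = 0) (hL : s + K ≤ L) :
    HasDerivAt (fun τ => logOneAdd L (N τ))
      (∑ k ∈ Finset.range s, ((-1 : ℝ) ^ k / (k + 1 : ℝ)) • c k) t := by
  have h := HasDerivAt.fun_sum (u := Finset.range L) fun n _ =>
    (hasDerivAt_pow_succ_of_commutator h₀ hc n).const_smul ((-1 : ℝ) ^ n / (n + 1 : ℝ))
  refine h.congr_deriv ?_
  set a : ℕ → ℕ → A := fun k j => ((-1 : ℝ) ^ (k + j) * ((k + j).choose k : ℝ) / (k + 1 : ℝ)) •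
    (c k * (1 + N t) ^ (k + 1) * N t ^ j) with ha
  have e1 : ∀ n ∈ Finset.range L, ((-1 : ℝ) ^ n / (n + 1 : ℝ)) • ∑ p ∈ antidiagonal n,
      (n + 1).choose (p.1 + 1) • (c p.1 * (1 + N t) ^ (p.1 + 1) * N t ^ p.2) =
      ∑ p ∈ antidiagonal n, a p.1 p.2 := by
    intro n _
    rw [Finset.smul_sum]
    refine Finset.sum_congr rfl fun p hp => ?_
    rw [Finset.HasAntidiagonal.mem_antidiagonal] at hp
    rw [ha, ← Nat.cast_smul_eq_nsmul ℝ, smul_smul]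
    dsimp only
    rw [hp]
    congr 1
    have hch : ((n + 1 : ℝ)) * (n.choose p.1 : ℝ) =
        ((n + 1).choose (p.1 + 1) : ℝ) * (p.1 + 1 : ℝ) := by
      exact_mod_cast Nat.add_one_mul_choose_eq n p.1
    have h1 : (n + 1 : ℝ) ≠ 0 := by positivity
    have h2 : (p.1 + 1 : ℝ) ≠ 0 := by positivity
    rw [div_mul_eq_mul_div, div_eq_div_iff h1 h2]
    linear_combination (-(-1 : ℝ) ^ n) * hch
  rw [Finset.sum_congr rfl e1, sum_antidiagonal_eq_sum_range_product a hL]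
  · refine Finset.sum_congr rfl fun k _ => ?_
    have hb := one_add_pow_mul_sum_choose hN k
    calc ∑ j ∈ Finset.range K, a k j
        = ((-1 : ℝ) ^ k / (k + 1 : ℝ)) • (c k * ((1 + N t) ^ (k + 1) *
          ∑ j ∈ Finset.range K, ((-1 : ℤ) ^ j * ((k + j).choose k : ℤ)) • N t ^ j)) := by
          rw [Finset.mul_sum, Finset.mul_sum, Finset.smul_sum]
          refine Finset.sum_congr rfl fun j _ => ?_
          rw [mul_smul_comm, mul_smul_comm, ← Int.cast_smul_eq_zsmul ℝ, smul_smul, ha]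
          dsimp only
          rw [mul_assoc (c k)]
          congr 1
          push_cast
          ring
      _ = _ := by rw [hb, mul_one]
  · intro k j hk
    simp [ha, hcs k hk]
  · intro k j hj
    simp [ha, pow_eq_zero_of_le hj hN]

/-- Along F τ = log(1 + τN) one has F′(1 + τN) = N, so e^(-F τ)(1 + τN) has zero derivative and
keeps its value 1 at τ = 0. -/
theorem exp_logOneAdd {A : Type*} [NormedRing A] [NormedAlgebra ℝ A] [CompleteSpace A] {N : A}
    {L : ℕ} (hN : N ^ (L + 1) = 0) : NormedSpace.exp (logOneAdd L N) = 1 + N := by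
  let _ : NormedAlgebra ℚ A := .restrictScalars ℚ ℝ A
  set F : ℝ → A := fun τ => logOneAdd L (τ • N) with hF
  have hcomm : ∀ τ τ', Commute (F τ) (F τ') := by
    intro τ τ'
    simp only [hF, logOneAdd]
    refine Commute.sum_left _ _ _ fun i _ => Commute.sum_right _ _ _ fun j _ => ?_
    refine Commute.smul_left (Commute.smul_right ?_ _) _
    exact ((Commute.refl N).smul_left _ |>.smul_right _).pow_pow _ _
  have hcommN : ∀ τ, Commute N (F τ) := by
    intro τ
    simp only [hF, logOneAdd]
    refine Commute.sum_right _ _ _ fun j _ => Commute.smul_right ?_ _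
    exact ((Commute.refl N).smul_right _).pow_right _
  set F' : ℝ → A := fun τ => ∑ n ∈ Finset.range L, ((-1 : ℝ) ^ n * τ ^ n) • N ^ (n + 1) with hF'
  have hderiv : ∀ τ, HasDerivAt F (F' τ) τ := by
    intro τ
    simp only [hF, hF', logOneAdd]
    refine HasDerivAt.fun_sum fun n _ => ?_
    have h1 : HasDerivAt (fun x : ℝ => ((-1 : ℝ) ^ n / (n + 1 : ℝ)) * x ^ (n + 1))
        ((-1 : ℝ) ^ n * τ ^ n) τ := by
      refine ((hasDerivAt_pow (n + 1) τ).const_mul ((-1 : ℝ) ^ n / (n + 1 : ℝ))).congr_deriv ?_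
      have : (n + 1 : ℝ) ≠ 0 := by positivity
      push_cast
      field_simp
    refine (h1.smul_const (N ^ (n + 1))).congr_of_eventuallyEq ?_
    filter_upwards with x
    rw [smul_pow, smul_smul]
  have hF'N : ∀ τ, F' τ * (1 + τ • N) = N := by
    intro τ
    have h := mul_neg_geom_sum (-(τ • N)) L
    have hz : N * (-(τ • N)) ^ L = 0 := by
      rw [neg_pow, smul_pow, ← mul_assoc, ((Commute.neg_one_right N).pow_right L).eq, mul_assoc,
        mul_smul_comm, ← pow_succ', hN, smul_zero, mul_zero]
    have hFe : F' τ = N * ∑ i ∈ Finset.range L, (-(τ • N)) ^ i := by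
      simp only [hF']
      rw [Finset.mul_sum]
      refine Finset.sum_congr rfl fun i _ => ?_
      rw [← neg_smul, smul_pow, mul_smul_comm, ← pow_succ', ← mul_pow, neg_one_mul]
    have hc2 : Commute (∑ i ∈ Finset.range L, (-(τ • N)) ^ i) (1 + τ • N) := by
      refine Commute.sum_left _ _ _ fun i _ => Commute.pow_left ?_ _
      exact (Commute.one_right _).add_right (Commute.neg_left (Commute.refl _))
    rw [hFe, mul_assoc, hc2.eq, ← sub_neg_eq_add, h, mul_sub, mul_one, hz, sub_zero]
  set g : ℝ → A := fun τ => NormedSpace.exp (-F τ) * (1 + τ • N) with hg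
  have hgd : ∀ τ, HasDerivAt g 0 τ := by
    intro τ
    -- All values of F commute, so e^(-F x) = e^(-F τ) e^(F τ - F x), and only the derivative of exp
    -- at 0 is needed.
    have h1 : HasDerivAt (fun x => NormedSpace.exp (F τ - F x)) (-F' τ) τ := by
      have h0 : HasFDerivAt (NormedSpace.exp : A → A) (1 : A →L[ℝ] A) (F τ - F τ) := by
        rw [sub_self]
        exact hasFDerivAt_exp_zero
      have := h0.comp_hasDerivAt τ ((hderiv τ).const_sub (F τ))
      simpa [Function.comp_def] using this
    have h2 : HasDerivAt (fun x => NormedSpace.exp (-F x)) (NormedSpace.exp (-F τ) * (-F' τ)) τ := by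
      refine (h1.const_mul (NormedSpace.exp (-F τ))).congr_of_eventuallyEq ?_
      filter_upwards with x
      rw [← NormedSpace.exp_add_of_commute]
      · congr 1
        abel
      · exact ((Commute.refl _).sub_right (hcomm _ _)).neg_left
    have h3 : HasDerivAt (fun x : ℝ => 1 + x • N) N τ := by
      simpa using ((hasDerivAt_id τ).smul_const N).const_add 1
    refine (h2.mul h3).congr_deriv ?_
    rw [mul_assoc, ← mul_add, neg_mul, hF'N]
    simp
  have hconst := is_const_of_deriv_eq_zero (fun τ => (hgd τ).differentiableAt)
    (fun τ => (hgd τ).deriv) 1 0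
  have hF0 : F 0 = 0 := by simp [hF, logOneAdd]
  have hF1 : F 1 = logOneAdd L N := by simp [hF]
  simp only [hg, hF0, hF1, neg_zero, NormedSpace.exp_zero, zero_smul, one_smul, add_zero,
    mul_one] at hconst
  have : NormedSpace.exp (logOneAdd L N) * (NormedSpace.exp (-logOneAdd L N) * (1 + N)) =
      NormedSpace.exp (logOneAdd L N) := by rw [hconst, mul_one]
  rw [← this, ← mul_assoc, ← NormedSpace.exp_add_of_commute (Commute.refl _ |>.neg_right),
    add_neg_cancel, NormedSpace.exp_zero, one_mul]

end

noncomputable section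

/-! ### Iterated brackets and the Baker-Campbell-Hausdorff product -/

section Words

variable {α : Type*}

/-- The word `x^{p₁} y^{q₁} ⋯ x^{pₙ} y^{qₙ}`. -/
def dynkinWord {s n : ℕ} (x y : α) (p q : Fin n → Fin (s + 1)) : List α :=
  (List.ofFn fun i => List.replicate (p i : ℕ) x ++ List.replicate (q i : ℕ) y).flatten

theorem length_dynkinWord {s n : ℕ} (x y : α) (p q : Fin n → Fin (s + 1)) :
    (dynkinWord x y p q).length = ∑ i, ((p i : ℕ) + (q i : ℕ)) := by
  simp [dynkinWord, List.length_flatten, List.map_ofFn, List.sum_ofFn]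

theorem dynkinWord_map {s n : ℕ} {β : Type*} (f : α → β) (x y : α)
    (p q : Fin n → Fin (s + 1)) :
    (dynkinWord x y p q).map f = dynkinWord (f x) (f y) p q := by
  simp [dynkinWord, List.map_flatten, List.map_ofFn, Function.comp_def]

theorem mem_dynkinWord {s n : ℕ} {x y : α} {p q : Fin n → Fin (s + 1)} {a : α}
    (h : a ∈ dynkinWord x y p q) : a = x ∨ a = y := by
  simp only [dynkinWord, List.mem_flatten, List.mem_ofFn] at h
  obtain ⟨l, ⟨i, rfl⟩, hl⟩ := h
  simp only [List.mem_append, List.mem_replicate] at hl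
  tauto

theorem dynkinWord_cons {s n : ℕ} (x y : α) (a b : Fin (s + 1)) (p q : Fin n → Fin (s + 1)) :
    dynkinWord x y (Fin.cons a p : Fin (n + 1) → Fin (s + 1)) (Fin.cons b q) =
      List.replicate (a : ℕ) x ++ (List.replicate (b : ℕ) y ++ dynkinWord x y p q) := by
  simp [dynkinWord, List.ofFn_succ]

end Words

section IteratedBracket

variable {𝔤 : Type*} [LieRing 𝔤]

theorem iteratedBracket_cons (a : 𝔤) {w : List 𝔤} (hw : w ≠ []) :
    iteratedBracket (a :: w) = ⁅a, iteratedBracket w⁆ := by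
  cases w with
  | nil => exact absurd rfl hw
  | cons b w => rfl

variable [LieAlgebra ℝ 𝔤]

theorem iteratedBracket_replicate_append (p : ℕ) (x : 𝔤) {w : List 𝔤} (hw : w ≠ []) :
    iteratedBracket (List.replicate p x ++ w) = ((LieAlgebra.ad ℝ 𝔤 x) ^ p) (iteratedBracket w) := by
  induction p with
  | zero => simp
  | succ p ih =>
    rw [List.replicate_succ, List.cons_append, iteratedBracket_cons _ (by simp [hw]), ih, pow_succ']
    simp

theorem iteratedBracket_map_smul (t : ℝ) (w : List 𝔤) :
    iteratedBracket (w.map (t • ·)) = t ^ w.length • iteratedBracket w := by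
  induction w with
  | nil => simp [iteratedBracket]
  | cons a w ih =>
    by_cases hw : w = []
    · subst hw
      simp [iteratedBracket]
    · rw [List.map_cons, iteratedBracket_cons _ (by simpa using hw), ih, iteratedBracket_cons _ hw,
        List.length_cons, pow_succ', smul_lie, lie_smul, smul_smul]

theorem map_iteratedBracket {𝔥 : Type*} [LieRing 𝔥] [LieAlgebra ℝ 𝔥] (φ : 𝔤 →ₗ⁅ℝ⁆ 𝔥)
    (w : List 𝔤) : φ (iteratedBracket w) = iteratedBracket (w.map φ) := by
  induction w with
  | nil => simp [iteratedBracket]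
  | cons a w ih =>
    by_cases hw : w = []
    · subst hw
      simp [iteratedBracket]
    · rw [List.map_cons, iteratedBracket_cons a hw, LieHom.map_lie, ih,
        iteratedBracket_cons _ (by simpa using hw)]

/-- A bracket of length at least two in the letters `x` and `y` is in every ideal that contains
`⁅x, y⁆`. -/
theorem iteratedBracket_mem_of_lie_mem {I : Submodule ℝ 𝔤} (hI : ∀ z : 𝔤, ∀ a ∈ I, ⁅z, a⁆ ∈ I)
    {x y : 𝔤} (hxy : ⁅x, y⁆ ∈ I) (w : List 𝔤) (hw : ∀ a ∈ w, a = x ∨ a = y) (h2 : 2 ≤ w.length) :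
    iteratedBracket w ∈ I := by
  induction w with
  | nil => simp at h2
  | cons a w ih =>
    have hw0 : w ≠ [] := by
      rintro rfl
      simp at h2
    rw [iteratedBracket_cons _ hw0]
    by_cases h : 2 ≤ w.length
    · exact hI _ _ (ih (fun b hb => hw b (List.mem_cons_of_mem _ hb)) h)
    · obtain ⟨b, rfl⟩ : ∃ b, w = [b] := by
        rw [← List.length_eq_one_iff]
        have := List.length_pos_iff.2 hw0
        omega
      have ha := hw a (by simp)
      have hb := hw b (by simp)
      have hyx : ⁅y, x⁆ ∈ I := by
        rw [← lie_skew]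
        exact I.neg_mem hxy
      simp only [iteratedBracket]
      rcases ha with rfl | rfl <;> rcases hb with rfl | rfl <;> simp [hxy, hyx]

theorem succ_le_sum_of_forall_pos {n : ℕ} {a : Fin n → ℕ} (h : ∀ i, 0 < a i) : n ≤ ∑ i, a i := by
  calc n = ∑ _i : Fin n, 1 := by simp
    _ ≤ _ := Finset.sum_le_sum fun i _ => h i

theorem bchProduct_eq (s : ℕ) (x y : 𝔤) :
    bchProduct s x y = ∑ n ∈ Finset.range s, ((-1 : ℝ) ^ n / (n + 1 : ℝ)) •
      ∑ p : Fin (n + 1) → Fin (s + 1), ∑ q : Fin (n + 1) → Fin (s + 1),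
        if ∀ i, 0 < (p i : ℕ) + (q i : ℕ) then
          (((∑ i, ((p i : ℕ) + (q i : ℕ)) : ℕ) : ℝ) *
            ((∏ i, ((p i : ℕ).factorial * (q i : ℕ).factorial) : ℕ) : ℝ))⁻¹ •
          iteratedBracket (dynkinWord x y p q)
        else 0 := by
  unfold bchProduct
  rw [Finset.range_eq_Ico, Finset.sum_Ico_eq_sum_range, ← Finset.Ico_succ_right_eq_Icc,
    Finset.sum_Ico_eq_sum_range]
  simp only [Nat.succ_eq_succ, Nat.succ_eq_add_one, Nat.add_sub_cancel, Nat.sub_zero]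
  refine Finset.sum_congr rfl fun n _ => ?_
  rw [Nat.zero_add, Nat.add_comm 1 n]
  simp [dynkinWord]

theorem map_bchProduct {𝔥 : Type*} [LieRing 𝔥] [LieAlgebra ℝ 𝔥] (φ : 𝔤 →ₗ⁅ℝ⁆ 𝔥) (s : ℕ) (x y : 𝔤) :
    φ (bchProduct s x y) = bchProduct s (φ x) (φ y) := by
  have hφ : ∀ (c : ℝ) (z : 𝔤), φ (c • z) = c • φ z := fun c z => φ.map_smul c z
  simp only [bchProduct_eq, map_sum, hφ]
  refine Finset.sum_congr rfl fun n _ => congrArg _ (Finset.sum_congr rfl fun p _ =>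
    Finset.sum_congr rfl fun q _ => ?_)
  split_ifs
  · rw [hφ, map_iteratedBracket, dynkinWord_map]
  · simp

/-- Modulo an ideal that contains `⁅x, y⁆`, the Baker-Campbell-Hausdorff product is the sum. -/
theorem bchProduct_sub_add_mem {s : ℕ} (hs : 1 ≤ s) {I : Submodule ℝ 𝔤}
    (hI : ∀ z : 𝔤, ∀ a ∈ I, ⁅z, a⁆ ∈ I) {x y : 𝔤} (hxy : ⁅x, y⁆ ∈ I) :
    bchProduct s x y - (x + y) ∈ I := by
  obtain ⟨r, rfl⟩ : ∃ r, s = r + 1 := ⟨s - 1, by omega⟩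
  rw [bchProduct_eq, Finset.sum_range_succ', add_sub_assoc]
  refine I.add_mem ?_ ?_
  · refine I.sum_mem fun n _ => I.smul_mem _ (I.sum_mem fun p _ => I.sum_mem fun q _ => ?_)
    split_ifs with h
    · refine I.smul_mem _ (iteratedBracket_mem_of_lie_mem hI hxy _ (fun a => mem_dynkinWord) ?_)
      rw [length_dynkinWord]
      have := succ_le_sum_of_forall_pos h
      omega
    · exact I.zero_mem
  · set T : (Fin 1 → Fin (r + 1 + 1)) → (Fin 1 → Fin (r + 1 + 1)) → 𝔤 := fun p q =>
      if ∀ i, 0 < (p i : ℕ) + (q i : ℕ) then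
          (((∑ i, ((p i : ℕ) + (q i : ℕ)) : ℕ) : ℝ) *
            ((∏ i, ((p i : ℕ).factorial * (q i : ℕ).factorial) : ℕ) : ℝ))⁻¹ •
          iteratedBracket (dynkinWord x y p q)
        else 0 with hT
    -- Among the one-block words, exactly x and y have length one, both with coefficient 1. Once
    -- they are subtracted, only words of length at least two remain.
    have key : ∑ p : Fin 1 → Fin (r + 1 + 1), ∑ q : Fin 1 → Fin (r + 1 + 1), T p q - (x + y) =
        ∑ p : Fin 1 → Fin (r + 1 + 1), ∑ q : Fin 1 → Fin (r + 1 + 1),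
          (T p q - ((if p = (fun _ => 1) ∧ q = (fun _ => 0) then x else 0) +
            (if p = (fun _ => 0) ∧ q = (fun _ => 1) then y else 0))) := by
      simp only [Finset.sum_sub_distrib, Finset.sum_add_distrib]
      congr 2
      · rw [Finset.sum_eq_single (fun _ => 1) (by intro p _ hp; simp [hp]) (by simp),
          Finset.sum_eq_single (fun _ => 0) (by intro p _ hp; simp [hp]) (by simp)]
        simp
      · rw [Finset.sum_eq_single (fun _ => 0) (by intro p _ hp; simp [hp]) (by simp),
          Finset.sum_eq_single (fun _ => 1) (by intro p _ hp; simp [hp]) (by simp)]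
        simp
    have hgoal : ((-1 : ℝ) ^ 0 / ((0 : ℕ) + 1 : ℝ)) • (∑ p : Fin 1 → Fin (r + 1 + 1),
        ∑ q : Fin 1 → Fin (r + 1 + 1), T p q) - (x + y) ∈ I := by
      rw [show ((-1 : ℝ) ^ 0 / ((0 : ℕ) + 1 : ℝ)) = 1 by norm_num, one_smul, key]
      refine I.sum_mem fun p _ => I.sum_mem fun q _ => ?_
      have hval0 : ((0 : Fin (r + 1 + 1)) : ℕ) = 0 := rfl
      have hval1 : ((1 : Fin (r + 1 + 1)) : ℕ) = 1 := by simp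
      have hfun : ∀ (f : Fin 1 → Fin (r + 1 + 1)) (c : Fin (r + 1 + 1)),
          f = (fun _ => c) ↔ (f 0 : ℕ) = (c : ℕ) := by
        intro f c
        rw [← Fin.ext_iff]
        constructor
        · rintro rfl
          rfl
        · intro h
          ext i
          rw [Subsingleton.elim i 0, h]
      simp only [hT, hfun, hval0, hval1]
      by_cases h1 : (p 0 : ℕ) = 1 ∧ (q 0 : ℕ) = 0
      · have hc : ∀ i : Fin 1, 0 < (p i : ℕ) + (q i : ℕ) := by
          intro i
          rw [Subsingleton.elim i 0]
          omega
        rw [if_pos hc]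
        simp [h1, dynkinWord, iteratedBracket]
      by_cases h2 : (p 0 : ℕ) = 0 ∧ (q 0 : ℕ) = 1
      · have hc : ∀ i : Fin 1, 0 < (p i : ℕ) + (q i : ℕ) := by
          intro i
          rw [Subsingleton.elim i 0]
          omega
        rw [if_pos hc]
        simp [h2, dynkinWord, iteratedBracket]
      rw [if_neg h1, if_neg h2, add_zero, sub_zero]
      split_ifs with h
      · refine I.smul_mem _ (iteratedBracket_mem_of_lie_mem hI hxy _ (fun a => mem_dynkinWord) ?_)
        rw [length_dynkinWord]
        have := h 0
        simp
        omega
      · exact I.zero_mem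
    exact hgoal

theorem bchProduct_of_lie_eq_zero {s : ℕ} (hs : 1 ≤ s) {x y : 𝔤} (hxy : ⁅x, y⁆ = 0) :
    bchProduct s x y = x + y := by
  have := bchProduct_sub_add_mem hs (I := ⊥) (by simp) (x := x) (y := y) (by simp [hxy])
  simpa [sub_eq_zero] using this

end IteratedBracket

end

noncomputable section

/-! ### Dynkin's formula -/

theorem hasDerivAt_sum_pow_div_factorial {A : Type*} [NormedAddCommGroup A] [NormedSpace ℝ A]
    (z : ℕ → A) (n : ℕ) (t : ℝ) :
    HasDerivAt (fun τ : ℝ => ∑ k ∈ Finset.range (n + 1), (τ ^ k * (k.factorial : ℝ)⁻¹) • z k)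
      (∑ k ∈ Finset.range n, (t ^ k * (k.factorial : ℝ)⁻¹) • z (k + 1)) t := by
  simp only [Finset.sum_range_succ' _ n, pow_zero]
  apply HasDerivAt.add_const
  apply HasDerivAt.fun_sum
  intro k _
  have h := ((hasDerivAt_pow (k + 1) t).mul_const (((k + 1).factorial : ℝ)⁻¹)).smul_const (z (k + 1))
  refine h.congr_deriv ?_
  congr 1
  have : (k.factorial : ℝ) ≠ 0 := by positivity
  rw [Nat.factorial_succ]
  push_cast
  field_simp

/-- `e^{ad a} z = e^a z e^{-a}`, in a form for truncated series. -/
theorem sum_pow_div_factorial_mul_exp {A : Type*} [NormedRing A] [NormedAlgebra ℝ A]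
    [CompleteSpace A] {a : A} {z : ℕ → A} (hz : ∀ k, a * z k - z k * a = z (k + 1)) {n : ℕ}
    (hn : z (n + 1) = 0) (t : ℝ) :
    (∑ k ∈ Finset.range (n + 1), (t ^ k * (k.factorial : ℝ)⁻¹) • z k) * NormedSpace.exp (t • a) =
      NormedSpace.exp (t • a) * z 0 := by
  let _ : NormedAlgebra ℚ A := .restrictScalars ℚ ℝ A
  set S : ℝ → A := fun τ => ∑ k ∈ Finset.range (n + 1), (τ ^ k * (k.factorial : ℝ)⁻¹) • z k with hS
  have hS' : ∀ τ, HasDerivAt S (a * S τ - S τ * a) τ := by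
    intro τ
    refine (hasDerivAt_sum_pow_div_factorial z n τ).congr_deriv ?_
    -- Differentiating the truncated sum loses its last term, which vanishes by z (n + 1) = 0. Thus
    -- S′ = aS - Sa exactly, and e^(-τa) S e^(τa) is constant.
    have h1 : ∑ k ∈ Finset.range n, (τ ^ k * (k.factorial : ℝ)⁻¹) • z (k + 1) =
        ∑ k ∈ Finset.range (n + 1), (τ ^ k * (k.factorial : ℝ)⁻¹) • z (k + 1) := by
      rw [Finset.sum_range_succ, hn, smul_zero, add_zero]
    rw [h1, hS]
    simp only [Finset.mul_sum, Finset.sum_mul, ← Finset.sum_sub_distrib, mul_smul_comm,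
      smul_mul_assoc, ← smul_sub, hz]
  have hinv : ∀ τ : ℝ, NormedSpace.exp (τ • a) * NormedSpace.exp (-τ • a) = 1 := by
    intro τ
    rw [neg_smul, ← NormedSpace.exp_add_of_commute (Commute.refl _).neg_right, add_neg_cancel,
      NormedSpace.exp_zero]
  set g : ℝ → A := fun τ => NormedSpace.exp (-τ • a) * (S τ * NormedSpace.exp (τ • a)) with hg
  have hgd : ∀ τ, HasDerivAt g 0 τ := by
    intro τ
    have h1 : HasDerivAt (fun τ : ℝ => NormedSpace.exp (-τ • a))
        (NormedSpace.exp (-τ • a) * (-a)) τ := by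
      have := hasDerivAt_exp_smul_const (𝕂 := ℝ) (-a) τ
      simpa only [smul_neg, neg_smul] using this
    have h2 := hasDerivAt_exp_smul_const' (𝕂 := ℝ) a τ
    refine (h1.mul ((hS' τ).fun_mul h2)).congr_deriv ?_
    noncomm_ring
  have hconst := is_const_of_deriv_eq_zero (fun τ => (hgd τ).differentiableAt)
    (fun τ => (hgd τ).deriv) t 0
  have hS0 : S 0 = z 0 := by
    simp only [hS]
    rw [Finset.sum_range_succ']
    simp
  simp only [hg, hS0, neg_zero, zero_smul, NormedSpace.exp_zero, mul_one, one_mul] at hconst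
  rw [← hconst, ← mul_assoc, hinv, one_mul]

section Dynkin

variable {𝔤 : Type*} [LieRing 𝔤] [LieAlgebra ℝ 𝔤]

/-- The truncated series of `e^{t ad x}`. -/
def expAd (s : ℕ) (t : ℝ) (x : 𝔤) : 𝔤 →ₗ[ℝ] 𝔤 :=
  ∑ k ∈ Finset.range (s + 1), (t ^ k * (k.factorial : ℝ)⁻¹) • (LieAlgebra.ad ℝ 𝔤 x) ^ k

theorem expAd_apply (s : ℕ) (t : ℝ) (x z : 𝔤) : expAd s t x z =
    ∑ k ∈ Finset.range (s + 1), (t ^ k * (k.factorial : ℝ)⁻¹) • ((LieAlgebra.ad ℝ 𝔤 x) ^ k) z := by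
  simp [expAd, LinearMap.sum_apply]

theorem ad_pow_eq_zero_of_iteratedBracket {s : ℕ}
    (hs : ∀ w : List 𝔤, s < w.length → iteratedBracket w = 0) (x z : 𝔤) {k : ℕ} (hk : s ≤ k) :
    ((LieAlgebra.ad ℝ 𝔤 x) ^ k) z = 0 := by
  have h := iteratedBracket_replicate_append k x (w := [z]) (by simp)
  rw [hs _ (by simp; omega)] at h
  simpa [iteratedBracket] using h.symm

variable {A : Type*} [NormedRing A] [NormedAlgebra ℝ A]

theorem map_ad_pow_succ (ρ : 𝔤 →ₗ[ℝ] A)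
    (hρ : ∀ x y, ρ ⁅x, y⁆ = ρ x * ρ y - ρ y * ρ x) (x z : 𝔤) (k : ℕ) :
    ρ x * ρ (((LieAlgebra.ad ℝ 𝔤 x) ^ k) z) - ρ (((LieAlgebra.ad ℝ 𝔤 x) ^ k) z) * ρ x =
      ρ (((LieAlgebra.ad ℝ 𝔤 x) ^ (k + 1)) z) := by
  rw [pow_succ', Module.End.mul_apply, LieAlgebra.ad_apply, hρ]

theorem map_expAd_mul_exp [CompleteSpace A] (ρ : 𝔤 →ₗ[ℝ] A)
    (hρ : ∀ x y, ρ ⁅x, y⁆ = ρ x * ρ y - ρ y * ρ x) {s : ℕ}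
    (hs : ∀ w : List 𝔤, s < w.length → iteratedBracket w = 0) (t : ℝ) (x z : 𝔤) :
    ρ (expAd s t x z) * NormedSpace.exp (t • ρ x) = NormedSpace.exp (t • ρ x) * ρ z := by
  have h := sum_pow_div_factorial_mul_exp (a := ρ x)
    (z := fun k => ρ (((LieAlgebra.ad ℝ 𝔤 x) ^ k) z)) (map_ad_pow_succ ρ hρ x z) (n := s)
    (by rw [ad_pow_eq_zero_of_iteratedBracket hs x z (by omega), map_zero]) t
  simpa [expAd_apply, map_sum, map_smul] using h

/-- The operator `e^{t ad x} e^{t ad y} - 1`, written as the sum of its nonconstant terms. -/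
def dynkinStep (s : ℕ) (t : ℝ) (x y : 𝔤) : 𝔤 →ₗ[ℝ] 𝔤 :=
  ∑ a : Fin (s + 1), ∑ b : Fin (s + 1), if 0 < (a : ℕ) + (b : ℕ) then
    (t ^ ((a : ℕ) + (b : ℕ)) * (((a : ℕ).factorial * (b : ℕ).factorial : ℕ) : ℝ)⁻¹) •
      ((LieAlgebra.ad ℝ 𝔤 x) ^ (a : ℕ) * (LieAlgebra.ad ℝ 𝔤 y) ^ (b : ℕ)) else 0

theorem dynkinStep_eq (s : ℕ) (t : ℝ) (x y : 𝔤) :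
    dynkinStep s t x y = expAd s t x * expAd s t y - 1 := by
  have h : expAd s t x * expAd s t y = ∑ a : Fin (s + 1), ∑ b : Fin (s + 1),
      (t ^ ((a : ℕ) + (b : ℕ)) * (((a : ℕ).factorial * (b : ℕ).factorial : ℕ) : ℝ)⁻¹) •
      ((LieAlgebra.ad ℝ 𝔤 x) ^ (a : ℕ) * (LieAlgebra.ad ℝ 𝔤 y) ^ (b : ℕ)) := by
    simp only [expAd]
    rw [Finset.sum_mul_sum, Finset.sum_range]
    refine Finset.sum_congr rfl fun a _ => ?_
    rw [Finset.sum_range]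
    refine Finset.sum_congr rfl fun b _ => ?_
    rw [smul_mul_smul_comm]
    congr 1
    push_cast
    rw [mul_inv, pow_add]
    ring
  have h1 : (1 : Module.End ℝ 𝔤) = ∑ a : Fin (s + 1), ∑ b : Fin (s + 1),
      if 0 < (a : ℕ) + (b : ℕ) then 0 else
      (t ^ ((a : ℕ) + (b : ℕ)) * (((a : ℕ).factorial * (b : ℕ).factorial : ℕ) : ℝ)⁻¹) •
      ((LieAlgebra.ad ℝ 𝔤 x) ^ (a : ℕ) * (LieAlgebra.ad ℝ 𝔤 y) ^ (b : ℕ)) := by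
    rw [Finset.sum_eq_single 0, Finset.sum_eq_single 0]
    · simp
    · intro b _ hb
      rw [if_pos]
      have : (b : ℕ) ≠ 0 := fun h => hb (Fin.ext h)
      omega
    · simp
    · intro a _ ha
      refine Finset.sum_eq_zero fun b _ => if_pos ?_
      have : (a : ℕ) ≠ 0 := fun h => ha (Fin.ext h)
      omega
    · simp
  rw [h, h1, ← Finset.sum_sub_distrib, dynkinStep]
  refine Finset.sum_congr rfl fun a _ => ?_
  rw [← Finset.sum_sub_distrib]
  refine Finset.sum_congr rfl fun b _ => ?_
  split_ifs <;> simp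

/-- The sum of the terms of Dynkin's series with `n + 1` blocks, differentiated in `t`. -/
def dynkinSum (s n : ℕ) (t : ℝ) (x y : 𝔤) : 𝔤 :=
  ∑ p : Fin (n + 1) → Fin (s + 1), ∑ q : Fin (n + 1) → Fin (s + 1),
    if ∀ i, 0 < (p i : ℕ) + (q i : ℕ) then
      (t ^ (∑ i, ((p i : ℕ) + (q i : ℕ)) - 1) *
        ((∏ i, ((p i : ℕ).factorial * (q i : ℕ).factorial) : ℕ) : ℝ)⁻¹) •
        iteratedBracket (dynkinWord x y p q)
    else 0

/-- Splitting off the first block x^a y^b of a right-nested bracket applies (ad x)^a (ad y)^b to the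
bracket of the other blocks. Those blocks form a nonempty word, so the truncated subtraction in the
exponent of t is harmless. -/
theorem dynkinSum_succ (s n : ℕ) (t : ℝ) (x y : 𝔤) :
    dynkinSum s (n + 1) t x y = dynkinStep s t x y (dynkinSum s n t x y) := by
  unfold dynkinSum
  rw [← (Fin.consEquiv fun _ : Fin (n + 1 + 1) => Fin (s + 1)).sum_comp, Fintype.sum_prod_type]
  simp only [← (Fin.consEquiv fun _ : Fin (n + 1 + 1) => Fin (s + 1)).sum_comp,
    Fintype.sum_prod_type, dynkinStep, LinearMap.sum_apply]
  refine Finset.sum_congr rfl fun a _ => ?_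
  rw [Finset.sum_comm]
  refine Finset.sum_congr rfl fun b _ => ?_
  rw [map_sum]
  refine Finset.sum_congr rfl fun p _ => ?_
  rw [map_sum]
  refine Finset.sum_congr rfl fun q _ => ?_
  simp only [Fin.consEquiv, Equiv.coe_fn_mk, Fin.forall_fin_succ (n := n + 1), Fin.cons_zero,
    Fin.cons_succ, Fin.sum_univ_succ (n := n + 1), Fin.prod_univ_succ (n := n + 1)]
  by_cases hab : 0 < (a : ℕ) + (b : ℕ)
  swap
  · simp [hab]
  by_cases hpq : ∀ i, 0 < (p i : ℕ) + (q i : ℕ)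
  swap
  · rw [if_neg (fun h => hpq h.2), if_neg hpq, map_zero]
  have hlen := succ_le_sum_of_forall_pos hpq
  have hne : dynkinWord x y p q ≠ [] := by
    intro h
    have := length_dynkinWord x y p q
    rw [h] at this
    simp only [List.length_nil] at this
    omega
  rw [if_pos ⟨hab, hpq⟩, if_pos hab, if_pos hpq, dynkinWord_cons,
    iteratedBracket_replicate_append _ _ (by simp [hne]), iteratedBracket_replicate_append _ _ hne,
    LinearMap.smul_apply, map_smul, smul_smul, Module.End.mul_apply]
  congr 1
  rw [Nat.add_sub_assoc (by omega), pow_add]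
  push_cast
  rw [mul_inv ((_ : ℝ) * _)]
  ring

/-- The bracket of x^p y^q vanishes if its two innermost letters agree. This leaves the word x and
the words x^p y, which make up the series of e^(t ad x) y. -/
theorem dynkinSum_zero {s : ℕ} (hs : 1 ≤ s) (t : ℝ) (x y : 𝔤) :
    dynkinSum s 0 t x y = x + expAd s t x y := by
  unfold dynkinSum
  rw [← (Equiv.funUnique (Fin 1) (Fin (s + 1))).symm.sum_comp]
  simp only [← (Equiv.funUnique (Fin 1) (Fin (s + 1))).symm.sum_comp]
  set F : ℕ → ℕ → 𝔤 := fun p q => if 0 < p + q then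
    (t ^ (p + q - 1) * ((p.factorial * q.factorial : ℕ) : ℝ)⁻¹) •
      iteratedBracket (List.replicate p x ++ List.replicate q y) else 0 with hF
  have h1 : ∑ p : Fin (s + 1), ∑ q : Fin (s + 1), F p q =
      ∑ p ∈ Finset.range (s + 1), ∑ q ∈ Finset.range (s + 1), F p q := by
    rw [Finset.sum_range]
    refine Finset.sum_congr rfl fun a _ => ?_
    rw [Finset.sum_range]
  have hq2 : ∀ p q, 2 ≤ q → F p q = 0 := by
    intro p q hq
    obtain ⟨q, rfl⟩ : ∃ r, q = r + 1 + 1 := ⟨q - 2, by omega⟩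
    have hz : iteratedBracket (List.replicate p x ++ List.replicate (q + 1 + 1) y) = 0 := by
      rw [iteratedBracket_replicate_append _ _ (by simp),
        show List.replicate (q + 1 + 1) y = List.replicate (q + 1) y ++ [y] by
          simp [List.replicate_succ'],
        iteratedBracket_replicate_append _ _ (by simp), pow_succ]
      simp [iteratedBracket]
    simp [hF, hz]
  have hF1 : ∀ p, F p 1 = (t ^ p * (p.factorial : ℝ)⁻¹) • ((LieAlgebra.ad ℝ 𝔤 x) ^ p) y := by
    intro p
    simp only [hF]
    rw [if_pos (by omega), iteratedBracket_replicate_append _ _ (by simp)]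
    simp [iteratedBracket]
  have hF0 : ∀ p, F p 0 = if p = 1 then x else 0 := by
    intro p
    rcases p with _ | _ | p
    · simp [hF]
    · simp [hF, iteratedBracket]
    · have hz : iteratedBracket (List.replicate (p + 1 + 1) x) = 0 := by
        rw [show List.replicate (p + 1 + 1) x = List.replicate (p + 1) x ++ [x] by
          simp [List.replicate_succ'],
          iteratedBracket_replicate_append _ _ (by simp), pow_succ]
        simp [iteratedBracket]
      simp [hF, hz]
  have h2 : ∀ p, ∑ q ∈ Finset.range (s + 1), F p q = F p 0 + F p 1 := by
    intro p
    rw [← Finset.sum_subset (s₁ := Finset.range 2)]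
    · simp [Finset.sum_range_succ]
    · intro i hi
      simp only [Finset.mem_range] at hi ⊢
      omega
    · intro q _ hq
      refine hq2 p q ?_
      simp only [Finset.mem_range] at hq
      omega
  calc _ = ∑ p : Fin (s + 1), ∑ q : Fin (s + 1), F p q := by
        refine Finset.sum_congr rfl fun p _ => Finset.sum_congr rfl fun q _ => ?_
        simp [hF, dynkinWord]
    _ = _ := by
        rw [h1]
        simp only [h2, Finset.sum_add_distrib, hF0, hF1, expAd_apply]
        simp
        omega

theorem dynkinSum_eq_zero {s : ℕ} (hs : ∀ w : List 𝔤, s < w.length → iteratedBracket w = 0)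
    {n : ℕ} (hn : s ≤ n) (t : ℝ) (x y : 𝔤) : dynkinSum s n t x y = 0 := by
  refine Finset.sum_eq_zero fun p _ => Finset.sum_eq_zero fun q _ => ?_
  split_ifs with h
  · rw [hs, smul_zero]
    rw [length_dynkinWord]
    have := succ_le_sum_of_forall_pos h
    omega
  · rfl

/-- A word of length d scales by τ^d, and differentiation cancels the factor 1/d of Dynkin's series.
-/
theorem hasDerivAt_map_bchProduct (ρ : 𝔤 →ₗ[ℝ] A) (s : ℕ) (t : ℝ) (x y : 𝔤) :
    HasDerivAt (fun τ : ℝ => ρ (bchProduct s (τ • x) (τ • y)))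
      (∑ n ∈ Finset.range s, ((-1 : ℝ) ^ n / (n + 1 : ℝ)) • ρ (dynkinSum s n t x y)) t := by
  simp only [bchProduct_eq, map_sum, map_smul, dynkinSum]
  refine HasDerivAt.fun_sum fun n _ => HasDerivAt.fun_const_smul _ <| HasDerivAt.fun_sum fun p _ =>
    HasDerivAt.fun_sum fun q _ => ?_
  split_ifs with h
  · have hlen := succ_le_sum_of_forall_pos h
    have hw : ∀ τ : ℝ, iteratedBracket (dynkinWord (τ • x) (τ • y) p q) =
        τ ^ (∑ i, ((p i : ℕ) + (q i : ℕ))) • iteratedBracket (dynkinWord x y p q) := by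
      intro τ
      rw [← dynkinWord_map (τ • ·) x y, iteratedBracket_map_smul, length_dynkinWord]
    simp only [hw, map_smul]
    set d := ∑ i, ((p i : ℕ) + (q i : ℕ)) with hd
    refine HasDerivAt.congr_deriv (HasDerivAt.fun_const_smul (𝕜 := ℝ) _
      ((hasDerivAt_pow d t).smul_const (ρ (iteratedBracket (dynkinWord x y p q))))) ?_
    rw [smul_smul]
    congr 1
    have hd0 : (d : ℝ) ≠ 0 := by
      have : 0 < d := by omega
      positivity
    rw [mul_inv]
    field_simp
  · simpa using hasDerivAt_const t (0 : A)

/-- **Dynkin's formula**: the Baker-Campbell-Hausdorff product is `log (e^x e^y)`. -/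
theorem map_bchProduct_eq_log [CompleteSpace A] (ρ : 𝔤 →ₗ[ℝ] A)
    (hρ : ∀ x y, ρ ⁅x, y⁆ = ρ x * ρ y - ρ y * ρ x) {s : ℕ} (h1s : 1 ≤ s)
    (hs : ∀ w : List 𝔤, s < w.length → iteratedBracket w = 0) {x y : 𝔤} {K L : ℕ}
    (hK : ∀ t : ℝ, (NormedSpace.exp (t • ρ x) * NormedSpace.exp (t • ρ y) - 1) ^ K = 0)
    (hL : s + K ≤ L) :
    ρ (bchProduct s x y) = logOneAdd L (NormedSpace.exp (ρ x) * NormedSpace.exp (ρ y) - 1) := by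
  set N : ℝ → A := fun t => NormedSpace.exp (t • ρ x) * NormedSpace.exp (t • ρ y) - 1 with hN
  have hNE : ∀ t, 1 + N t = NormedSpace.exp (t • ρ x) * NormedSpace.exp (t • ρ y) := by
    intro t
    simp [hN]
  -- With E = e^(t ρ x) e^(t ρ y), the n-th Dynkin sum plays the role of c n. The one-block sum is
  -- E′E⁻¹, and adding a block applies e^(t ad x) e^(t ad y) - 1, which ρ turns into Ad E - 1. So
  -- the logarithm and the series have equal derivatives, and both vanish at t = 0.
  have hW : ∀ t, HasDerivAt (fun τ => logOneAdd L (N τ))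
      (∑ n ∈ Finset.range s, ((-1 : ℝ) ^ n / (n + 1 : ℝ)) • ρ (dynkinSum s n t x y)) t := by
    intro t
    refine hasDerivAt_logOneAdd_of_commutator (c := fun n => ρ (dynkinSum s n t x y)) ?_ ?_ (hK t)
      (fun k hk => by rw [dynkinSum_eq_zero hs hk, map_zero]) hL
    · have h := ((hasDerivAt_exp_smul_const' (𝕂 := ℝ) (ρ x) t).mul
        (hasDerivAt_exp_smul_const' (𝕂 := ℝ) (ρ y) t)).sub_const 1
      refine h.congr_deriv ?_
      rw [hNE, dynkinSum_zero h1s, map_add, add_mul, ← mul_assoc (ρ (expAd s t x y)),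
        map_expAd_mul_exp ρ hρ hs]
      noncomm_ring
    · intro k
      have key : ρ (dynkinStep s t x y (dynkinSum s k t x y) + dynkinSum s k t x y) * (1 + N t) =
          (1 + N t) * ρ (dynkinSum s k t x y) := by
        have e : dynkinStep s t x y (dynkinSum s k t x y) + dynkinSum s k t x y =
            expAd s t x (expAd s t y (dynkinSum s k t x y)) := by
          rw [dynkinStep_eq]
          simp
        rw [e, hNE, ← mul_assoc, map_expAd_mul_exp ρ hρ hs, mul_assoc, map_expAd_mul_exp ρ hρ hs,
          mul_assoc]
      rw [dynkinSum_succ]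
      rw [map_add, add_mul] at key
      have e2 : N t * ρ (dynkinSum s k t x y) =
          (1 + N t) * ρ (dynkinSum s k t x y) - ρ (dynkinSum s k t x y) := by noncomm_ring
      rw [e2, ← key]
      noncomm_ring
  have hd : ∀ t, HasDerivAt (fun τ => logOneAdd L (N τ) - ρ (bchProduct s (τ • x) (τ • y))) 0 t :=
    fun t => ((hW t).sub (hasDerivAt_map_bchProduct ρ s t x y)).congr_deriv (sub_self _)
  have hconst := is_const_of_deriv_eq_zero (fun τ => (hd τ).differentiableAt)
    (fun τ => (hd τ).deriv) 1 0
  have hN0 : N 0 = 0 := by simp [hN]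
  have hN1 : N 1 = NormedSpace.exp (ρ x) * NormedSpace.exp (ρ y) - 1 := by simp [hN]
  have hb0 : bchProduct s (0 : 𝔤) 0 = 0 := by
    rw [bchProduct_of_lie_eq_zero h1s (by simp), add_zero]
  simp only [hN0, hN1, one_smul, zero_smul, hb0, map_zero, sub_zero] at hconst
  rw [← sub_eq_zero, ← neg_sub, hconst]
  simp [logOneAdd]

theorem exp_map_bchProduct [CompleteSpace A] (ρ : 𝔤 →ₗ[ℝ] A)
    (hρ : ∀ x y, ρ ⁅x, y⁆ = ρ x * ρ y - ρ y * ρ x) {s : ℕ} (h1s : 1 ≤ s)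
    (hs : ∀ w : List 𝔤, s < w.length → iteratedBracket w = 0) {x y : 𝔤} {K : ℕ}
    (hK : ∀ t : ℝ, (NormedSpace.exp (t • ρ x) * NormedSpace.exp (t • ρ y) - 1) ^ K = 0) :
    NormedSpace.exp (ρ (bchProduct s x y)) = NormedSpace.exp (ρ x) * NormedSpace.exp (ρ y) := by
  rw [map_bchProduct_eq_log ρ hρ h1s hs hK le_rfl, exp_logOneAdd]
  · abel
  · refine pow_eq_zero_of_le (show K ≤ s + K + 1 by omega) ?_
    simpa using hK 1

end Dynkin

end

noncomputable section

/-! ### The grading of the Lie algebra -/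

namespace CarnotGroup

variable {𝔤 : Type*} [LieRing 𝔤] [LieAlgebra ℝ 𝔤] {s : ℕ} {m : Fin s → ℕ}
  (G : CarnotGroup 𝔤 s m)

/-- The elements of degree `k`: this is `V_k` for `1 ≤ k ≤ s` and zero for other `k`. -/
def homogeneous (k : ℕ) : Submodule ℝ 𝔤 where
  carrier := {z | ∀ j : Σ l : Fin s, Fin (m l), (j.1 : ℕ) + 1 ≠ k → G.toLie.symm z j = 0}
  add_mem' hx hy j hj := by simp [hx j hj, hy j hj]
  zero_mem' j _ := by simp
  smul_mem' c x hx j hj := by simp [hx j hj]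

/-- The sum of the layers `V_l` with `l ≥ k`. -/
def filtration (k : ℕ) : Submodule ℝ 𝔤 where
  carrier := {z | ∀ j : Σ l : Fin s, Fin (m l), (j.1 : ℕ) + 1 < k → G.toLie.symm z j = 0}
  add_mem' hx hy j hj := by simp [hx j hj, hy j hj]
  zero_mem' j _ := by simp
  smul_mem' c x hx j hj := by simp [hx j hj]

theorem homogeneous_succ (l : Fin s) : G.homogeneous (l + 1) = G.layer (l + 1) := by
  ext z
  constructor
  · intro hz
    have h : z = ∑ j, G.toLie.symm z j • G.isInternal.collectedBasis G.basis j := by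
      conv_lhs => rw [← G.toLie.apply_symm_apply z]
      rw [toLie, Module.Basis.equivFun_symm_apply]
    rw [h]
    refine Submodule.sum_mem _ fun j _ => ?_
    by_cases hj : j.1 = l
    · obtain ⟨l', i⟩ := j
      simp only at hj
      subst hj
      exact Submodule.smul_mem _ _ (G.isInternal.collectedBasis_mem G.basis ⟨l', i⟩)
    · rw [hz j (fun h => hj (Fin.ext (by omega))), zero_smul]
      exact Submodule.zero_mem _
  · intro hz j hj
    have hne : l ≠ j.1 := fun h => hj (by rw [h])
    exact G.isInternal.collectedBasis_repr_of_mem_ne G.basis hne (a := j.2) hz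

theorem homogeneous_eq_layer {k : ℕ} (h1 : 1 ≤ k) (hs : k ≤ s) : G.homogeneous k = G.layer k := by
  have := G.homogeneous_succ ⟨k - 1, by omega⟩
  simpa [Nat.sub_add_cancel h1] using this

theorem eq_zero_of_mem_homogeneous {k : ℕ} (hk : k = 0 ∨ s < k) {z : 𝔤}
    (hz : z ∈ G.homogeneous k) : z = 0 := by
  rw [← G.toLie.symm.map_eq_zero_iff]
  ext j
  exact hz j (by have := j.1.2; omega)

theorem lie_mem_homogeneous_succ {x y : 𝔤} {k : ℕ} (hx : x ∈ G.homogeneous 1)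
    (hy : y ∈ G.homogeneous k) : ⁅x, y⁆ ∈ G.homogeneous (k + 1) := by
  have h1s := G.one_le_step
  by_cases hk : k = 0 ∨ s < k
  · rw [G.eq_zero_of_mem_homogeneous hk hy, lie_zero]
    exact Submodule.zero_mem _
  · have hk1 : 1 ≤ k := by omega
    rw [G.homogeneous_eq_layer le_rfl h1s] at hx
    rw [G.homogeneous_eq_layer hk1 (by omega)] at hy
    by_cases hks : k = s
    · subst hks
      rw [G.bracket_top x hx y hy]
      exact Submodule.zero_mem _
    · rw [G.homogeneous_eq_layer (by omega) (by omega), ← G.bracket_layer k hk1 (by omega)]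
      exact Submodule.subset_span ⟨x, hx, y, hy, rfl⟩

/-- An induction principle for the elements of degree `k + 1`, which are sums of brackets. -/
theorem homogeneous_succ_induction {k : ℕ} (hk : 1 ≤ k) {p : 𝔤 → Prop}
    (lie : ∀ x ∈ G.homogeneous 1, ∀ y ∈ G.homogeneous k, p ⁅x, y⁆)
    (zero : p 0) (add : ∀ x y, p x → p y → p (x + y)) {z : 𝔤}
    (hz : z ∈ G.homogeneous (k + 1)) : p z := by
  by_cases hks : s < k + 1
  · rw [G.eq_zero_of_mem_homogeneous (Or.inr hks) hz]
    exact zero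
  · rw [G.homogeneous_eq_layer (by omega) (by omega), ← G.bracket_layer k hk (by omega)] at hz
    -- The property is not assumed stable under scalars, so the induction carries all multiples of
    -- z; a scalar is absorbed into the left factor of a bracket.
    have h : ∀ c : ℝ, p (c • z) := by
      induction hz using Submodule.span_induction with
      | mem z hz =>
        obtain ⟨x, hx, y, hy, rfl⟩ := hz
        intro c
        rw [← smul_lie]
        rw [← G.homogeneous_eq_layer le_rfl G.one_le_step] at hx
        rw [← G.homogeneous_eq_layer hk (by omega)] at hy
        exact lie _ (Submodule.smul_mem _ _ hx) _ hy
      | zero => simpa using zero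
      | add x y _ _ hx hy => intro c; rw [smul_add]; exact add _ _ (hx c) (hy c)
      | smul a x _ hx => intro c; rw [smul_smul]; exact hx _
    simpa using h 1

/-- The stratification only controls brackets with V₁. Elements of higher degree are sums of
brackets ⁅a, b⁆ with a in V₁, and the Jacobi identity ⁅⁅a, b⁆, y⁆ = ⁅a, ⁅b, y⁆⁆ - ⁅b, ⁅a, y⁆⁆
reduces the degree. -/
theorem lie_mem_homogeneous {i j : ℕ} {x y : 𝔤} (hx : x ∈ G.homogeneous i)
    (hy : y ∈ G.homogeneous j) : ⁅x, y⁆ ∈ G.homogeneous (i + j) := by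
  induction i generalizing x y j with
  | zero =>
    rw [G.eq_zero_of_mem_homogeneous (Or.inl rfl) hx, zero_lie]
    exact Submodule.zero_mem _
  | succ i ih =>
    rcases i with _ | i
    · rw [show 0 + 1 + j = j + 1 by omega]
      exact G.lie_mem_homogeneous_succ hx hy
    · refine G.homogeneous_succ_induction (k := i + 1) (by omega)
        (p := fun x => ⁅x, y⁆ ∈ G.homogeneous (i + 1 + 1 + j)) ?_ ?_ ?_ hx
      · intro a ha b hb
        rw [lie_lie]
        refine Submodule.sub_mem _ ?_ ?_
        · have := G.lie_mem_homogeneous_succ ha (ih hb hy)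
          rwa [show i + 1 + 1 + j = i + 1 + j + 1 by omega]
        · have := ih hb (G.lie_mem_homogeneous_succ ha hy)
          rwa [show i + 1 + 1 + j = i + 1 + (j + 1) by omega]
      · simp
      · intro a b ha hb
        rw [add_lie]
        exact Submodule.add_mem _ ha hb

/-- The linear map that acts on `V_k` as multiplication by `w k`. -/
def weightMap (w : ℕ → ℝ) : 𝔤 →ₗ[ℝ] 𝔤 :=
  G.toLie.toLinearMap ∘ₗ
    LinearMap.pi (fun j => w ((j.1 : ℕ) + 1) • LinearMap.proj (R := ℝ) (φ := fun _ => ℝ) j) ∘ₗ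
      G.toLie.symm.toLinearMap

theorem toLie_symm_weightMap (w : ℕ → ℝ) (z : 𝔤) (j : Σ l : Fin s, Fin (m l)) :
    G.toLie.symm (G.weightMap w z) j = w ((j.1 : ℕ) + 1) * G.toLie.symm z j := by
  simp [weightMap]

theorem weightMap_of_mem (w : ℕ → ℝ) {k : ℕ} {z : 𝔤} (hz : z ∈ G.homogeneous k) :
    G.weightMap w z = w k • z := by
  apply G.toLie.symm.injective
  ext j
  rw [toLie_symm_weightMap, map_smul, Pi.smul_apply, smul_eq_mul]
  by_cases h : (j.1 : ℕ) + 1 = k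
  · rw [h]
  · rw [hz j h, mul_zero, mul_zero]

/-- The component of degree `k`. -/
def component (k : ℕ) : 𝔤 →ₗ[ℝ] 𝔤 := G.weightMap (Pi.single k 1)

theorem toLie_symm_component (k : ℕ) (z : 𝔤) (j : Σ l : Fin s, Fin (m l)) :
    G.toLie.symm (G.component k z) j = if (j.1 : ℕ) + 1 = k then G.toLie.symm z j else 0 := by
  rw [component, toLie_symm_weightMap, Pi.single_apply]
  split_ifs <;> simp

theorem component_mem (k : ℕ) (z : 𝔤) : G.component k z ∈ G.homogeneous k := by
  intro j hj
  rw [toLie_symm_component, if_neg hj]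

theorem sum_component (z : 𝔤) : ∑ k ∈ Finset.range (s + 1), G.component k z = z := by
  apply G.toLie.symm.injective
  ext j
  rw [map_sum, Finset.sum_apply]
  simp only [toLie_symm_component]
  rw [Finset.sum_ite_eq, if_pos]
  have := j.1.2
  simp

theorem component_eq_zero {k n : ℕ} (hkn : k < n) {z : 𝔤} (hz : z ∈ G.filtration n) :
    G.component k z = 0 := by
  apply G.toLie.symm.injective
  ext j
  rw [toLie_symm_component]
  split_ifs with h
  · rw [hz j (by omega)]
    simp
  · simp

theorem homogeneous_induction {p : 𝔤 → Prop} (hom : ∀ k, ∀ z ∈ G.homogeneous k, p z)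
    (add : ∀ x y, p x → p y → p (x + y)) (z : 𝔤) : p z := by
  rw [← G.sum_component z]
  refine Finset.sum_induction _ p add (hom 0 _ (Submodule.zero_mem _)) fun k _ =>
    hom k _ (G.component_mem k z)

theorem homogeneous_le_filtration {k n : ℕ} (h : n ≤ k) : G.homogeneous k ≤ G.filtration n :=
  fun _ hz j hj => hz j (by omega)

theorem filtration_anti {k n : ℕ} (h : n ≤ k) : G.filtration k ≤ G.filtration n :=
  fun _ hz j hj => hz j (by omega)

theorem mem_filtration_one (z : 𝔤) : z ∈ G.filtration 1 := fun j hj => by omega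

theorem eq_zero_of_mem_filtration {k : ℕ} (hk : s < k) {z : 𝔤} (hz : z ∈ G.filtration k) :
    z = 0 := by
  rw [← G.toLie.symm.map_eq_zero_iff]
  ext j
  exact hz j (by have := j.1.2; omega)

theorem lie_mem_filtration {i j : ℕ} {x y : 𝔤} (hx : x ∈ G.filtration i)
    (hy : y ∈ G.filtration j) : ⁅x, y⁆ ∈ G.filtration (i + j) := by
  rw [← G.sum_component x, ← G.sum_component y, sum_lie_sum]
  refine Submodule.sum_mem _ fun a _ => Submodule.sum_mem _ fun b _ => ?_
  by_cases ha : a < i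
  · rw [G.component_eq_zero ha hx, zero_lie]
    exact Submodule.zero_mem _
  by_cases hb : b < j
  · rw [G.component_eq_zero hb hy, lie_zero]
    exact Submodule.zero_mem _
  exact G.homogeneous_le_filtration (by omega)
    (G.lie_mem_homogeneous (G.component_mem a x) (G.component_mem b y))

theorem lie_mem_filtration_right {j : ℕ} (x : 𝔤) {y : 𝔤} (hy : y ∈ G.filtration j) :
    ⁅x, y⁆ ∈ G.filtration (j + 1) := by
  rw [add_comm]
  exact G.lie_mem_filtration (G.mem_filtration_one x) hy

theorem lie_mem_filtration_self {j : ℕ} (x : 𝔤) {y : 𝔤} (hy : y ∈ G.filtration j) :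
    ⁅x, y⁆ ∈ G.filtration j :=
  G.filtration_anti (Nat.le_succ j) (G.lie_mem_filtration_right x hy)

theorem iteratedBracket_mem_filtration (w : List 𝔤) :
    iteratedBracket w ∈ G.filtration w.length := by
  induction w with
  | nil => simp [iteratedBracket]
  | cons a w ih =>
    by_cases hw : w = []
    · subst hw
      simpa [iteratedBracket] using G.mem_filtration_one a
    · rw [iteratedBracket_cons _ hw]
      exact G.lie_mem_filtration_right a ih

theorem iteratedBracket_eq_zero (G : CarnotGroup 𝔤 s m) (w : List 𝔤) (hw : s < w.length) :
    iteratedBracket w = 0 :=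
  G.eq_zero_of_mem_filtration hw (G.iteratedBracket_mem_filtration w)

/-- The derivation that acts on `V_k` as multiplication by `k`. -/
def degreeDerivation : 𝔤 →ₗ[ℝ] 𝔤 := G.weightMap fun k => (k : ℝ)

theorem degreeDerivation_lie (x y : 𝔤) : G.degreeDerivation ⁅x, y⁆ =
    ⁅G.degreeDerivation x, y⁆ + ⁅x, G.degreeDerivation y⁆ := by
  induction x using G.homogeneous_induction with
  | add x x' hx hx' => simp only [add_lie, map_add, hx, hx']; abel
  | hom i x hx =>
    induction y using G.homogeneous_induction with
    | add y y' hy hy' => simp only [lie_add, map_add, hy, hy']; abel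
    | hom j y hy =>
      rw [degreeDerivation, G.weightMap_of_mem _ hx, G.weightMap_of_mem _ hy,
        G.weightMap_of_mem _ (G.lie_mem_homogeneous hx hy), smul_lie, lie_smul, ← add_smul]
      push_cast
      rfl

theorem degreeDerivation_injective : Function.Injective G.degreeDerivation := by
  rw [injective_iff_map_eq_zero]
  intro z hz
  rw [← G.toLie.symm.map_eq_zero_iff]
  ext j
  have h := G.toLie_symm_weightMap (fun k => (k : ℝ)) z j
  rw [show G.weightMap (fun k => (k : ℝ)) z = 0 from hz] at h
  have h0 : (((j.1 : ℕ) + 1 : ℕ) : ℝ) ≠ 0 := by positivity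
  rw [map_zero] at h
  simpa using (mul_eq_zero.1 h.symm).resolve_left h0

/-- The dilation by `r` as an endomorphism of the Lie algebra: multiplication by `r ^ k` on `V_k`. -/
def dilationLie (r : ℝ) : 𝔤 →ₗ⁅ℝ⁆ 𝔤 where
  toLinearMap := G.weightMap fun k => r ^ k
  map_lie' := by
    intro x y
    change G.weightMap (fun k => r ^ k) ⁅x, y⁆ =
      ⁅G.weightMap (fun k => r ^ k) x, G.weightMap (fun k => r ^ k) y⁆
    induction x using G.homogeneous_induction with
    | add x x' hx hx' => simp only [add_lie, map_add, hx, hx']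
    | hom i x hx =>
      induction y using G.homogeneous_induction with
      | add y y' hy hy' => simp only [lie_add, map_add, hy, hy']
      | hom j y hy =>
        rw [G.weightMap_of_mem _ hx, G.weightMap_of_mem _ hy,
          G.weightMap_of_mem _ (G.lie_mem_homogeneous hx hy), smul_lie, lie_smul, smul_smul,
          ← pow_add]

theorem toLie_symm_dilationLie (r : ℝ) (z : 𝔤) (j : Σ l : Fin s, Fin (m l)) :
    G.toLie.symm (G.dilationLie r z) j = r ^ ((j.1 : ℕ) + 1) * G.toLie.symm z j :=
  G.toLie_symm_weightMap _ z j

end CarnotGroup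

end

noncomputable section

/-! ### A faithful representation and the group law -/

theorem exp_mul_mul_of_mul_eq_one {A : Type*} [NormedRing A] [NormedAlgebra ℝ A] [CompleteSpace A]
    {a b : A} (hab : a * b = 1) (hba : b * a = 1) (x : A) :
    NormedSpace.exp (a * x * b) = a * NormedSpace.exp x * b := by
  let _ : NormedAlgebra ℚ A := .restrictScalars ℚ ℝ A
  exact NormedSpace.exp_units_conj ⟨a, b, hab, hba⟩ x

namespace CarnotGroup

variable {𝔤 : Type*} [LieRing 𝔤] [LieAlgebra ℝ 𝔤] {s : ℕ} {m : Fin s → ℕ}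
  (G : CarnotGroup 𝔤 s m)

/-- The adjoint representation of the extension of `𝔤` by the degree derivation, restricted
to `𝔤`. It is faithful. -/
def rep : 𝔤 →ₗ[ℝ] (Coord m × ℝ →L[ℝ] Coord m × ℝ) :=
  LinearMap.toContinuousLinearMap.toLinearMap ∘ₗ
    LinearMap.mk₂ ℝ (fun x (v : Coord m × ℝ) =>
      ((G.toLie.symm (⁅x, G.toLie v.1⁆ - v.2 • G.degreeDerivation x), 0) : Coord m × ℝ))
      (by intro x y v; ext1 <;> simp [add_lie]; abel)
      (by intro c x v; ext1 <;> simp [smul_sub, smul_comm c])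
      (by intro x v w; ext1 <;> simp [add_smul]; abel)
      (by intro c x v; ext1 <;> simp [smul_sub, mul_smul])

theorem rep_apply (x : 𝔤) (v : Coord m × ℝ) :
    G.rep x v = (G.toLie.symm (⁅x, G.toLie v.1⁆ - v.2 • G.degreeDerivation x), 0) := rfl

theorem rep_lie (x y : 𝔤) : G.rep ⁅x, y⁆ = G.rep x * G.rep y - G.rep y * G.rep x := by
  refine ContinuousLinearMap.ext fun v => ?_
  simp only [sub_apply, mul_apply_eq_comp, rep_apply]
  ext1
  · apply G.toLie.injective
    simp only [LinearEquiv.apply_symm_apply, Prod.fst_sub, map_sub, zero_smul, sub_zero, lie_sub,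
      lie_smul, lie_lie, degreeDerivation_lie, smul_add]
    rw [← lie_skew (G.degreeDerivation x) y, smul_neg]
    abel
  · simp

/-- The operator of x sends the adjoined derivation to minus the degree derivation of x, which
determines x because all degrees are positive. The adjoint representation of 𝔤 alone would lose the
centre. -/
theorem rep_injective : Function.Injective G.rep := by
  rw [injective_iff_map_eq_zero]
  intro x hx
  have h := G.rep_apply x (0, 1)
  rw [hx] at h
  have h1 := congrArg Prod.fst h
  simp only [zero_apply, Prod.fst_zero, map_zero, lie_zero, one_smul,
    zero_sub, map_neg] at h1
  rw [eq_comm, neg_eq_zero, LinearEquiv.map_eq_zero_iff] at h1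
  exact G.degreeDerivation_injective (by rw [h1, map_zero])

/-- The flag of subspaces that the representation shifts. -/
def flag (k : ℕ) : Submodule ℝ (Coord m × ℝ) where
  carrier := {v | (1 ≤ k → v.2 = 0) ∧ G.toLie v.1 ∈ G.filtration k}
  add_mem' hv hw := ⟨fun h => by simp [hv.1 h, hw.1 h], by
    simpa using Submodule.add_mem _ hv.2 hw.2⟩
  zero_mem' := ⟨fun _ => rfl, by simp⟩
  smul_mem' c v hv := ⟨fun h => by simp [hv.1 h], by simpa using Submodule.smul_mem _ c hv.2⟩

theorem mem_flag_zero (v : Coord m × ℝ) : v ∈ G.flag 0 :=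
  ⟨fun h => by omega, fun j hj => by omega⟩

theorem eq_zero_of_mem_flag {k : ℕ} (hk : s < k) {v : Coord m × ℝ} (hv : v ∈ G.flag k) : v = 0 := by
  ext1
  · have := G.eq_zero_of_mem_filtration hk hv.2
    rwa [LinearEquiv.map_eq_zero_iff] at this
  · exact hv.1 (by omega)

/-- The operators that shift the flag. -/
def shifts : Submodule ℝ (Coord m × ℝ →L[ℝ] Coord m × ℝ) where
  carrier := {T | ∀ k, ∀ v ∈ G.flag k, T v ∈ G.flag (k + 1)}
  add_mem' hS hT k v hv := Submodule.add_mem _ (hS k v hv) (hT k v hv)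
  zero_mem' _ _ _ := Submodule.zero_mem _
  smul_mem' c _ hT k v hv := Submodule.smul_mem _ c (hT k v hv)

variable {G} in
theorem mul_mem_shifts {S T : Coord m × ℝ →L[ℝ] Coord m × ℝ} (hS : S ∈ G.shifts)
    (hT : T ∈ G.shifts) : S * T ∈ G.shifts := by
  intro k v hv
  have h := hS _ _ (hT k v hv)
  exact ⟨fun _ => h.1 (by omega), G.filtration_anti (by omega) h.2⟩

theorem rep_mem_shifts (x : 𝔤) : G.rep x ∈ G.shifts := by
  intro k v hv
  rw [rep_apply]
  refine ⟨fun _ => rfl, ?_⟩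
  rw [LinearEquiv.apply_symm_apply]
  rcases k with _ | k
  · exact G.mem_filtration_one _
  · rw [hv.1 (by omega), zero_smul, sub_zero]
    exact G.lie_mem_filtration_right x hv.2

variable {G} in
theorem pow_eq_zero_of_mem_shifts {T : Coord m × ℝ →L[ℝ] Coord m × ℝ} (hT : T ∈ G.shifts) :
    T ^ (s + 1) = 0 := by
  have h : ∀ k v, (T ^ k) v ∈ G.flag k := by
    intro k
    induction k with
    | zero => exact fun v => G.mem_flag_zero _
    | succ k ih =>
      intro v
      rw [pow_succ']
      exact hT k _ (ih v)
  refine ContinuousLinearMap.ext fun v => ?_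
  exact G.eq_zero_of_mem_flag (Nat.lt_succ_self s) (h _ v)

variable {G} in
theorem exp_sub_one_mem_shifts {T : Coord m × ℝ →L[ℝ] Coord m × ℝ} (hT : T ∈ G.shifts) :
    NormedSpace.exp T - 1 ∈ G.shifts := by
  have h : NormedSpace.exp T = ∑ n ∈ Finset.range (s + 1), ((n.factorial : ℝ)⁻¹) • T ^ n := by
    rw [NormedSpace.exp_eq_tsum ℝ]
    refine tsum_eq_sum fun n hn => ?_
    rw [pow_eq_zero_of_le (by simpa using hn) (pow_eq_zero_of_mem_shifts hT), smul_zero]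
  rw [h, Finset.sum_range_succ']
  simp only [pow_zero, Nat.factorial_zero, Nat.cast_one, inv_one, one_smul, add_sub_cancel_right]
  have hpow : ∀ n, T ^ (n + 1) ∈ G.shifts := by
    intro n
    induction n with
    | zero => simpa using hT
    | succ n ih =>
      rw [pow_succ]
      exact mul_mem_shifts ih hT
  exact Submodule.sum_mem _ fun n _ => Submodule.smul_mem _ _ (hpow n)

/-- Operators that shift the flag are closed under sums and products and contain e^T - 1 along with
T. The resulting nilpotency order is uniform in t, as `map_bchProduct_eq_log` requires. -/
theorem exp_rep_mul_exp_rep_pow (x y : 𝔤) (t : ℝ) :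
    (NormedSpace.exp (t • G.rep x) * NormedSpace.exp (t • G.rep y) - 1) ^ (s + 1) = 0 := by
  refine pow_eq_zero_of_mem_shifts (G := G) ?_
  have hx := exp_sub_one_mem_shifts (G := G) (Submodule.smul_mem _ t (G.rep_mem_shifts x))
  have hy := exp_sub_one_mem_shifts (G := G) (Submodule.smul_mem _ t (G.rep_mem_shifts y))
  have e : NormedSpace.exp (t • G.rep x) * NormedSpace.exp (t • G.rep y) - 1 =
      (NormedSpace.exp (t • G.rep x) - 1) * (NormedSpace.exp (t • G.rep y) - 1) +
      (NormedSpace.exp (t • G.rep x) - 1) + (NormedSpace.exp (t • G.rep y) - 1) := by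
    simp only [mul_sub, sub_mul, mul_one, one_mul]
    abel
  rw [e]
  exact Submodule.add_mem _ (Submodule.add_mem _ (mul_mem_shifts hx hy) hx) hy

theorem exp_rep_bchProduct (x y : 𝔤) : NormedSpace.exp (G.rep (bchProduct s x y)) =
    NormedSpace.exp (G.rep x) * NormedSpace.exp (G.rep y) :=
  exp_map_bchProduct G.rep G.rep_lie G.one_le_step G.iteratedBracket_eq_zero
    (G.exp_rep_mul_exp_rep_pow x y)

/-- Dynkin's formula with second argument 0 exhibits a logarithm that recovers the operator of z
from its exponential. Identities for the product can hence be checked on exponentials of operators.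
-/
theorem exp_rep_injective : Function.Injective fun x => NormedSpace.exp (G.rep x) := by
  intro x y hxy
  have h : ∀ z : 𝔤, G.rep z = logOneAdd (s + (s + 1))
      (NormedSpace.exp (G.rep z) * NormedSpace.exp (G.rep (0 : 𝔤)) - 1) := by
    intro z
    rw [← map_bchProduct_eq_log G.rep G.rep_lie G.one_le_step G.iteratedBracket_eq_zero
      (G.exp_rep_mul_exp_rep_pow z 0) le_rfl, bchProduct_of_lie_eq_zero G.one_le_step (by simp),
      add_zero]
  apply G.rep_injective
  rw [h x, h y]
  simp only at hxy
  rw [hxy]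

theorem bchProduct_assoc (G : CarnotGroup 𝔤 s m) (x y z : 𝔤) :
    bchProduct s (bchProduct s x y) z = bchProduct s x (bchProduct s y z) := by
  apply G.exp_rep_injective
  simp only [exp_rep_bchProduct, mul_assoc]

theorem bchProduct_conj (G : CarnotGroup 𝔤 s m) (x y : 𝔤) :
    bchProduct s (bchProduct s x y) (-x) = expAd s 1 x y := by
  apply G.exp_rep_injective
  simp only [exp_rep_bchProduct]
  have h := map_expAd_mul_exp G.rep G.rep_lie G.iteratedBracket_eq_zero 1 x y
  rw [one_smul] at h
  have hinv : ∀ z, NormedSpace.exp (G.rep z) * NormedSpace.exp (G.rep (-z)) = 1 := by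
    intro z
    rw [← exp_rep_bchProduct, bchProduct_of_lie_eq_zero G.one_le_step (by simp), add_neg_cancel,
      map_zero, NormedSpace.exp_zero]
  have hinv' := hinv (-x)
  rw [neg_neg] at hinv'
  have h2 : G.rep (expAd s 1 x y) = NormedSpace.exp (G.rep x) * G.rep y *
      NormedSpace.exp (G.rep (-x)) := by
    rw [← h, mul_assoc, hinv, mul_one]
  rw [h2]
  exact (exp_mul_mul_of_mul_eq_one (hinv x) hinv' _).symm

theorem toLie_mul (ξ η : Coord m) : G.toLie (G.mul ξ η) = bchProduct s (G.toLie ξ) (G.toLie η) := by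
  simp [mul]

theorem mul_assoc' (ξ η ζ : Coord m) : G.mul (G.mul ξ η) ζ = G.mul ξ (G.mul η ζ) := by
  apply G.toLie.injective
  simp only [toLie_mul, G.bchProduct_assoc]

theorem mul_of_lie_eq_zero {ξ η : Coord m} (h : ⁅G.toLie ξ, G.toLie η⁆ = 0) :
    G.mul ξ η = ξ + η := by
  apply G.toLie.injective
  rw [toLie_mul, bchProduct_of_lie_eq_zero G.one_le_step h, map_add]

theorem mul_zero' (ξ : Coord m) : G.mul ξ 0 = ξ := by
  rw [G.mul_of_lie_eq_zero (by simp), add_zero]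

theorem zero_mul' (ξ : Coord m) : G.mul 0 ξ = ξ := by
  rw [G.mul_of_lie_eq_zero (by simp), zero_add]

theorem mul_neg_self (ξ : Coord m) : G.mul ξ (-ξ) = 0 := by
  rw [G.mul_of_lie_eq_zero (by simp), add_neg_cancel]

theorem neg_mul_self (ξ : Coord m) : G.mul (-ξ) ξ = 0 := by
  rw [G.mul_of_lie_eq_zero (by simp), neg_add_cancel]

theorem expX_add (i : Fin G.rank) (a b : ℝ) : G.expX i (a + b) = G.mul (G.expX i a) (G.expX i b) := by
  have h : ∀ t, G.expX i t = t • G.expX i 1 := by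
    intro t
    ext j
    simp [expX, Pi.single_apply]
  rw [G.mul_of_lie_eq_zero, expX, Pi.single_add]
  · rfl
  · rw [h a, h b, map_smul, map_smul, smul_lie, lie_smul, lie_self, smul_zero, smul_zero]

theorem expX_zero (i : Fin G.rank) : G.expX i 0 = 0 := by
  simp [expX]

theorem mul_expX_add (ξ : Coord m) (i : Fin G.rank) (a b : ℝ) :
    G.mul ξ (G.expX i (a + b)) = G.mul (G.mul ξ (G.expX i a)) (G.expX i b) := by
  rw [expX_add, mul_assoc']

end CarnotGroup

end

noncomputable section

/-! ### The group is generated by the exponentials of the first layer -/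

namespace CarnotGroup

variable {𝔤 : Type*} [LieRing 𝔤] [LieAlgebra ℝ 𝔤] {s : ℕ} {m : Fin s → ℕ}
  (G : CarnotGroup 𝔤 s m)

/-- The products of `n` factors `exp (t Xᵢ)` with `|t| ≤ r`. -/
def horizontalProducts : ℕ → ℝ → Set (Coord m)
  | 0, _ => {0}
  | n + 1, r => {ζ | ∃ ξ ∈ horizontalProducts n r, ∃ i : Fin G.rank, ∃ t : ℝ, |t| ≤ r ∧
      G.mul ξ (G.expX i t) = ζ}

theorem horizontalProducts_mono {r r' : ℝ} (h : r ≤ r') (n : ℕ) :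
    G.horizontalProducts n r ⊆ G.horizontalProducts n r' := by
  induction n with
  | zero => exact subset_rfl
  | succ n ih =>
    rintro _ ⟨ξ, hξ, i, t, ht, rfl⟩
    exact ⟨ξ, ih hξ, i, t, ht.trans h, rfl⟩

theorem mul_mem_horizontalProducts {n k : ℕ} {r : ℝ} {ξ η : Coord m}
    (hξ : ξ ∈ G.horizontalProducts n r) (hη : η ∈ G.horizontalProducts k r) :
    G.mul ξ η ∈ G.horizontalProducts (n + k) r := by
  induction k generalizing η with
  | zero =>
    rw [show η = 0 from hη, mul_zero']
    exact hξ
  | succ k ih =>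
    obtain ⟨η, hη, i, t, ht, rfl⟩ := hη
    exact ⟨_, ih hη, i, t, ht, G.mul_assoc' _ _ _⟩

theorem expX_mem_horizontalProducts (i : Fin G.rank) {t r : ℝ} (h : |t| ≤ r) :
    G.expX i t ∈ G.horizontalProducts 1 r :=
  ⟨0, rfl, i, t, h, G.zero_mul' _⟩

theorem expX_neg (i : Fin G.rank) (t : ℝ) : G.expX i (-t) = -G.expX i t := by
  simp [expX, Pi.single_neg]

theorem neg_eq_of_mul_eq_zero {ξ η : Coord m} (h : G.mul ξ η = 0) : η = -ξ := by
  rw [← G.zero_mul' η, ← G.neg_mul_self ξ, mul_assoc', h, mul_zero']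

theorem neg_mul_rev (ξ η : Coord m) : -G.mul ξ η = G.mul (-η) (-ξ) := by
  symm
  apply G.neg_eq_of_mul_eq_zero
  rw [mul_assoc', ← G.mul_assoc' η, mul_neg_self, zero_mul', mul_neg_self]

theorem neg_mem_horizontalProducts {n : ℕ} {r : ℝ} {ξ : Coord m}
    (hξ : ξ ∈ G.horizontalProducts n r) : -ξ ∈ G.horizontalProducts n r := by
  induction n generalizing ξ with
  | zero =>
    rw [show ξ = 0 from hξ, neg_zero]
    rfl
  | succ n ih =>
    obtain ⟨ξ, hξ, i, t, ht, rfl⟩ := hξ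
    rw [neg_mul_rev, ← expX_neg, add_comm]
    exact G.mul_mem_horizontalProducts (G.expX_mem_horizontalProducts i (by simpa using ht)) (ih hξ)

/-- The logarithms of the elements of the subgroup generated by the horizontal exponentials. -/
def horizontallyGenerated : Set 𝔤 := {z | ∃ n r, G.toLie.symm z ∈ G.horizontalProducts n r}

variable {G}

theorem bchProduct_mem_horizontallyGenerated {x y : 𝔤} (hx : x ∈ G.horizontallyGenerated)
    (hy : y ∈ G.horizontallyGenerated) : bchProduct s x y ∈ G.horizontallyGenerated := by
  obtain ⟨n, r, hx⟩ := hx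
  obtain ⟨k, r', hy⟩ := hy
  refine ⟨n + k, max r r', ?_⟩
  have := G.mul_mem_horizontalProducts (G.horizontalProducts_mono (le_max_left r r') n hx)
    (G.horizontalProducts_mono (le_max_right r r') k hy)
  simpa [mul] using this

theorem neg_mem_horizontallyGenerated {x : 𝔤} (hx : x ∈ G.horizontallyGenerated) :
    -x ∈ G.horizontallyGenerated := by
  obtain ⟨n, r, hx⟩ := hx
  exact ⟨n, r, by simpa using G.neg_mem_horizontalProducts hx⟩

variable (G)

theorem zero_mem_horizontallyGenerated : (0 : 𝔤) ∈ G.horizontallyGenerated :=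
  ⟨0, 0, by rw [map_zero]; rfl⟩

theorem ad_pow_mem_filtration (x : 𝔤) {k : ℕ} {z : 𝔤} (hz : z ∈ G.filtration k) (j : ℕ) :
    ((LieAlgebra.ad ℝ 𝔤 x) ^ j) z ∈ G.filtration (k + j) := by
  induction j with
  | zero => simpa using hz
  | succ j ih =>
    rw [pow_succ', Module.End.mul_apply, LieAlgebra.ad_apply, ← add_assoc]
    exact G.lie_mem_filtration_right x ih

theorem expAd_sub_mem_filtration (x : 𝔤) {k : ℕ} {z : 𝔤} (hz : z ∈ G.filtration k) :
    expAd s 1 x z - (z + ⁅x, z⁆) ∈ G.filtration (k + 2) := by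
  obtain ⟨r, hr⟩ : ∃ r, s = r + 1 := ⟨s - 1, by have := G.one_le_step; omega⟩
  have hr' : Finset.range (s + 1) = Finset.range (r + 1 + 1) := by rw [hr]
  rw [expAd_apply, hr', Finset.sum_range_succ', Finset.sum_range_succ']
  have e : ∀ a : 𝔤, a + ((1 : ℝ) ^ (0 + 1) * ((0 + 1).factorial : ℝ)⁻¹) •
      ((LieAlgebra.ad ℝ 𝔤 x) ^ (0 + 1)) z +
      ((1 : ℝ) ^ 0 * ((Nat.factorial 0 : ℕ) : ℝ)⁻¹) • ((LieAlgebra.ad ℝ 𝔤 x) ^ 0) z -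
      (z + ⁅x, z⁆) = a := by
    intro a
    simp
    abel
  rw [e]
  refine Submodule.sum_mem _ fun j _ => Submodule.smul_mem _ _ ?_
  exact G.filtration_anti (by omega) (G.ad_pow_mem_filtration x hz (j + 1 + 1))

/-- Modulo higher degrees, every homogeneous element is horizontally generated. -/
theorem exists_horizontallyGenerated_sub_mem {k : ℕ} (hk : 1 ≤ k) {z : 𝔤}
    (hz : z ∈ G.homogeneous k) : ∃ h ∈ G.horizontallyGenerated, h - z ∈ G.filtration (k + 1) := by
  have hfil : ∀ {k : ℕ} {h z : 𝔤}, z ∈ G.filtration k → h - z ∈ G.filtration (k + 1) →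
      h ∈ G.filtration k := by
    intro k h z hz hh
    rw [← sub_add_cancel h z]
    exact Submodule.add_mem _ (G.filtration_anti (Nat.le_succ k) hh) hz
  -- Approximants can be added by multiplying them in the group: the bracket of two elements of
  -- filtration degree k has degree at least 2k ≥ k + 1, so the product is the sum up to degree k +
  -- 1.
  have hadd : ∀ {k : ℕ}, 1 ≤ k → ∀ z z' : 𝔤,
      (z ∈ G.filtration k ∧ ∃ h ∈ G.horizontallyGenerated, h - z ∈ G.filtration (k + 1)) →
      (z' ∈ G.filtration k ∧ ∃ h ∈ G.horizontallyGenerated, h - z' ∈ G.filtration (k + 1)) →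
      (z + z' ∈ G.filtration k ∧
        ∃ h ∈ G.horizontallyGenerated, h - (z + z') ∈ G.filtration (k + 1)) := by
    rintro k hk z z' ⟨hz, h, hh, hd⟩ ⟨hz', h', hh', hd'⟩
    refine ⟨Submodule.add_mem _ hz hz', _, bchProduct_mem_horizontallyGenerated hh hh', ?_⟩
    have hb := bchProduct_sub_add_mem G.one_le_step (I := G.filtration (k + 1))
      (fun z a ha => G.lie_mem_filtration_self z ha) (x := h) (y := h')
      (G.filtration_anti (by omega) (G.lie_mem_filtration (hfil hz hd) (hfil hz' hd')))
    have e : bchProduct s h h' - (z + z') =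
        (bchProduct s h h' - (h + h')) + ((h - z) + (h' - z')) := by abel
    rw [e]
    exact Submodule.add_mem _ hb (Submodule.add_mem _ hd hd')
  have hone : ∀ {z : 𝔤}, z ∈ G.homogeneous 1 →
      ∃ h ∈ G.horizontallyGenerated, h - z ∈ G.filtration 2 := by
    intro z hz
    have hsum : z = ∑ j, G.toLie (Pi.single j (G.toLie.symm z j)) := by
      rw [← map_sum, Finset.univ_sum_single, LinearEquiv.apply_symm_apply]
    rw [hsum]
    refine (Finset.sum_induction _ (fun z => z ∈ G.filtration 1 ∧
      ∃ h ∈ G.horizontallyGenerated, h - z ∈ G.filtration 2) (hadd le_rfl)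
      ⟨Submodule.zero_mem _, 0, G.zero_mem_horizontallyGenerated, by simp⟩ fun j _ =>
      ⟨G.mem_filtration_one _, ?_⟩).2
    by_cases hj : (j.1 : ℕ) = 0
    · refine ⟨G.toLie (Pi.single j (G.toLie.symm z j)), ?_, by simp⟩
      obtain ⟨⟨l, hl⟩, i⟩ := j
      simp only at hj
      subst hj
      refine ⟨1, |G.toLie.symm z ⟨⟨0, hl⟩, i⟩|, ?_⟩
      rw [LinearEquiv.symm_apply_apply]
      exact G.expX_mem_horizontalProducts i le_rfl
    · refine ⟨0, G.zero_mem_horizontallyGenerated, ?_⟩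
      rw [hz j (by omega)]
      simp
  suffices H : z ∈ G.filtration k ∧
      ∃ h ∈ G.horizontallyGenerated, h - z ∈ G.filtration (k + 1) from H.2
  induction k generalizing z with
  | zero => omega
  | succ k ih =>
    rcases k with _ | k
    · exact ⟨G.mem_filtration_one _, hone hz⟩
    · refine G.homogeneous_succ_induction (k := k + 1) (by omega)
        (p := fun z => z ∈ G.filtration (k + 1 + 1) ∧
          ∃ h ∈ G.horizontallyGenerated, h - z ∈ G.filtration (k + 1 + 1 + 1)) ?_
        ⟨Submodule.zero_mem _, 0, G.zero_mem_horizontallyGenerated, by simp⟩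
        (hadd (by omega)) hz
      intro x hx y hy
      refine ⟨G.homogeneous_le_filtration (by omega) (G.lie_mem_homogeneous hx hy), ?_⟩
      obtain ⟨hy', b, hb, hbd⟩ := ih (by omega) hy
      obtain ⟨a, ha, had⟩ := hone hx
      have hbf := hfil hy' hbd
      -- The group commutator of a and b is e^(ad a) b multiplied by -b, which is ⁅a, b⁆ up to
      -- higher degree; replacing a, b by x, y costs only higher degree too.
      refine ⟨bchProduct s (bchProduct s (bchProduct s a b) (-a)) (-b),
        bchProduct_mem_horizontallyGenerated (bchProduct_mem_horizontallyGenerated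
          (bchProduct_mem_horizontallyGenerated ha hb) (neg_mem_horizontallyGenerated ha))
          (neg_mem_horizontallyGenerated hb), ?_⟩
      rw [G.bchProduct_conj]
      set e := expAd s 1 a b with he
      have h1 := G.expAd_sub_mem_filtration a hbf
      rw [← he] at h1
      have hab : ⁅a, b⁆ ∈ G.filtration (k + 1 + 1) := G.lie_mem_filtration_right a hbf
      have h2 : e - b ∈ G.filtration (k + 1 + 1) := by
        have : e - b = (e - (b + ⁅a, b⁆)) + ⁅a, b⁆ := by abel
        rw [this]
        exact Submodule.add_mem _ (G.filtration_anti (by omega) h1) hab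
      have h3 := bchProduct_sub_add_mem G.one_le_step (I := G.filtration (k + 1 + 1 + 1))
        (fun z a ha => G.lie_mem_filtration_self z ha) (x := e) (y := -b) (by
          have : ⁅e, -b⁆ = -⁅e - b, b⁆ := by simp
          rw [this]
          exact Submodule.neg_mem _ (G.filtration_anti (by omega) (G.lie_mem_filtration h2 hbf)))
      have e1 : bchProduct s e (-b) - ⁅x, y⁆ = (bchProduct s e (-b) - (e + -b)) +
          (e - (b + ⁅a, b⁆)) + (⁅a - x, b⁆ + ⁅x, b - y⁆) := by
        simp only [sub_lie, lie_sub]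
        abel
      rw [e1]
      refine Submodule.add_mem _ (Submodule.add_mem _ h3 h1) (Submodule.add_mem _ ?_ ?_)
      · exact G.filtration_anti (by omega) (G.lie_mem_filtration had hbf)
      · exact G.lie_mem_filtration_right x hbd

/-- Left multiplication by the inverse of a generated element that agrees with z in its lowest
degree moves z one step down the filtration. After at most s steps nothing is left. -/
theorem mem_horizontallyGenerated (z : 𝔤) : z ∈ G.horizontallyGenerated := by
  have H : ∀ d k, 1 ≤ k → s + 1 ≤ k + d → ∀ z ∈ G.filtration k, z ∈ G.horizontallyGenerated := by
    intro d
    induction d with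
    | zero =>
      intro k _ hk z hz
      rw [G.eq_zero_of_mem_filtration (by omega) hz]
      exact G.zero_mem_horizontallyGenerated
    | succ d ih =>
      intro k h1 hk z hz
      have hcz : z - G.component k z ∈ G.filtration (k + 1) := by
        intro j hj
        rw [map_sub, Pi.sub_apply, toLie_symm_component]
        split_ifs with h
        · rw [sub_self]
        · rw [hz j (by omega), sub_zero]
      obtain ⟨h, hh, hd⟩ := G.exists_horizontallyGenerated_sub_mem h1 (G.component_mem k z)
      have hzh : z - h ∈ G.filtration (k + 1) := by
        have : z - h = (z - G.component k z) - (h - G.component k z) := by abel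
        rw [this]
        exact Submodule.sub_mem _ hcz hd
      have hhk : h ∈ G.filtration k := by
        have : h = z - (z - h) := by abel
        rw [this]
        exact Submodule.sub_mem _ hz (G.filtration_anti (by omega) hzh)
      have hb := bchProduct_sub_add_mem G.one_le_step (I := G.filtration (k + 1))
        (fun z a ha => G.lie_mem_filtration_self z ha) (x := -h) (y := z)
        (G.filtration_anti (by omega) (G.lie_mem_filtration (Submodule.neg_mem _ hhk) hz))
      have hw : bchProduct s (-h) z ∈ G.horizontallyGenerated := by
        refine ih (k + 1) (by omega) (by omega) _ ?_
        have : bchProduct s (-h) z = (bchProduct s (-h) z - (-h + z)) + (z - h) := by abel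
        rw [this]
        exact Submodule.add_mem _ hb hzh
      have hfin := bchProduct_mem_horizontallyGenerated hh hw
      rwa [← G.bchProduct_assoc, bchProduct_of_lie_eq_zero G.one_le_step (x := h) (by simp),
        add_neg_cancel, bchProduct_of_lie_eq_zero G.one_le_step (by simp), zero_add] at hfin
  exact H s 1 le_rfl (by omega) z (G.mem_filtration_one z)

theorem iUnion_horizontalProducts :
    ⋃ p : ℕ × ℕ, G.horizontalProducts p.1 (p.2 : ℝ) = Set.univ := by
  refine Set.eq_univ_of_forall fun ξ => Set.mem_iUnion.2 ?_
  obtain ⟨n, r, h⟩ := G.mem_horizontallyGenerated (G.toLie ξ)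
  rw [LinearEquiv.symm_apply_apply] at h
  obtain ⟨k, hk⟩ := exists_nat_ge r
  exact ⟨(n, k), G.horizontalProducts_mono hk n h⟩

end CarnotGroup

end

noncomputable section

/-! ### Smoothness, dilations and Haar measure -/

namespace CarnotGroup

variable {𝔤 : Type*} [LieRing 𝔤] [LieAlgebra ℝ 𝔤] {s : ℕ} {m : Fin s → ℕ}
  (G : CarnotGroup 𝔤 s m)

section Smooth

variable {E : Type*} [NormedAddCommGroup E] [NormedSpace ℝ E] {n : WithTop ℕ∞}

theorem contDiff_lie {f g : E → Coord m} (hf : ContDiff ℝ n f) (hg : ContDiff ℝ n g) :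
    ContDiff ℝ n fun e => G.toLie.symm ⁅G.toLie (f e), G.toLie (g e)⁆ := by
  have h : ∀ ξ η : Coord m, G.toLie.symm ⁅G.toLie ξ, G.toLie η⁆ = ∑ i, ∑ j, (ξ i * η j) •
      G.toLie.symm ⁅G.toLie (Pi.single i 1), G.toLie (Pi.single j 1)⁆ := by
    intro ξ η
    have hs : ∀ ξ : Coord m, G.toLie ξ = ∑ j, ξ j • G.toLie (Pi.single j 1) := by
      intro ξ
      conv_lhs => rw [← Finset.univ_sum_single ξ, map_sum]
      refine Finset.sum_congr rfl fun j _ => ?_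
      rw [← map_smul, ← Pi.single_smul, smul_eq_mul, mul_one]
    rw [hs ξ, hs η, sum_lie_sum, map_sum]
    refine Finset.sum_congr rfl fun i _ => ?_
    rw [map_sum]
    refine Finset.sum_congr rfl fun j _ => ?_
    rw [smul_lie, lie_smul, smul_smul, map_smul]
  rw [contDiff_pi] at hf hg
  rw [funext fun e => h (f e) (g e)]
  exact ContDiff.sum fun i _ => ContDiff.sum fun j _ => ((hf i).mul (hg j)).smul contDiff_const

theorem contDiff_iteratedBracket (w : List (E → Coord m)) (hw : ∀ f ∈ w, ContDiff ℝ n f) :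
    ContDiff ℝ n fun e => G.toLie.symm (iteratedBracket (w.map fun f => G.toLie (f e))) := by
  induction w with
  | nil => simpa [iteratedBracket] using contDiff_const
  | cons f w ih =>
    by_cases h : w = []
    · subst h
      simpa [iteratedBracket] using hw f (by simp)
    · have := G.contDiff_lie (hw f (by simp)) (ih fun g hg => hw g (by simp [hg]))
      simp only [LinearEquiv.apply_symm_apply] at this
      simp only [List.map_cons]
      convert this using 2 with e
      rw [iteratedBracket_cons _ (by simpa using h)]

theorem contDiff_mul {f g : E → Coord m} (hf : ContDiff ℝ n f) (hg : ContDiff ℝ n g) :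
    ContDiff ℝ n fun e => G.mul (f e) (g e) := by
  simp only [mul, bchProduct_eq, map_sum, map_smul]
  refine ContDiff.sum fun n _ => ContDiff.const_smul _ <| ContDiff.sum fun p _ =>
    ContDiff.sum fun q _ => ?_
  split_ifs
  · simp only [map_smul]
    refine ContDiff.const_smul _ ?_
    have := G.contDiff_iteratedBracket (dynkinWord f g p q) (fun h hh => by
      rcases mem_dynkinWord hh with rfl | rfl <;> assumption)
    simpa only [dynkinWord_map] using this
  · simpa using contDiff_const

attribute [local irreducible] CarnotGroup.mul

theorem continuous_mul {X : Type*} [TopologicalSpace X] {f g : X → Coord m} (hf : Continuous f)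
    (hg : Continuous g) : Continuous fun x => G.mul (f x) (g x) := by
  have h : Continuous fun p : Coord m × Coord m => G.mul p.1 p.2 :=
    (G.contDiff_mul (n := 0) contDiff_fst contDiff_snd).continuous
  exact h.comp (hf.prodMk hg)

end Smooth

attribute [local irreducible] CarnotGroup.mul

/-- The dilation `(z₁, …, z_s) ↦ (r z₁, r² z₂, …, r^s z_s)`. -/
def dilation (_G : CarnotGroup 𝔤 s m) (r : ℝ) : Coord m →ₗ[ℝ] Coord m :=
  Matrix.toLin' (Matrix.diagonal fun j => r ^ ((j.1 : ℕ) + 1))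

theorem dilation_apply (r : ℝ) (ξ : Coord m) (j : Σ l : Fin s, Fin (m l)) :
    G.dilation r ξ j = r ^ ((j.1 : ℕ) + 1) * ξ j := by
  simp [dilation, Matrix.mulVec_diagonal]

theorem toLie_dilation (r : ℝ) (ξ : Coord m) :
    G.toLie (G.dilation r ξ) = G.dilationLie r (G.toLie ξ) := by
  apply G.toLie.symm.injective
  ext j
  rw [toLie_symm_dilationLie, LinearEquiv.symm_apply_apply, LinearEquiv.symm_apply_apply,
    dilation_apply]

theorem dilation_mul (r : ℝ) (ξ η : Coord m) :
    G.dilation r (G.mul ξ η) = G.mul (G.dilation r ξ) (G.dilation r η) := by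
  apply G.toLie.injective
  rw [toLie_dilation, toLie_mul, toLie_mul, map_bchProduct, toLie_dilation, toLie_dilation]

theorem dilation_expX (r : ℝ) (i : Fin G.rank) (t : ℝ) :
    G.dilation r (G.expX i t) = G.expX i (r * t) := by
  ext j
  rw [dilation_apply, expX, expX, Pi.single_apply, Pi.single_apply]
  split_ifs with h
  · subst h
    simp
  · simp

theorem dilation_dilation (r r' : ℝ) (ξ : Coord m) :
    G.dilation r (G.dilation r' ξ) = G.dilation (r * r') ξ := by
  ext j
  simp only [dilation_apply, mul_pow]
  ring

theorem dilation_one (ξ : Coord m) : G.dilation 1 ξ = ξ := by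
  ext j
  simp [dilation_apply]

theorem det_dilation (r : ℝ) : LinearMap.det (G.dilation r) = r ^ G.homDim := by
  rw [dilation, LinearMap.det_toLin', Matrix.det_diagonal, Finset.prod_pow_eq_pow_sum, homDim,
    Fintype.sum_sigma]
  simp [mul_comm]

theorem continuous_dilation_left (ξ : Coord m) : Continuous fun r => G.dilation r ξ := by
  refine continuous_pi fun j => ?_
  simp only [dilation_apply]
  fun_prop

theorem contDiff_dilation (r : ℝ) {n : WithTop ℕ∞} : ContDiff ℝ n (G.dilation r) :=
  (LinearMap.toContinuousLinearMap (G.dilation r)).contDiff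

/-- Dilations are linear automorphisms of the group, so the Jacobian at (δᵣξ, δᵣη) does not depend
on r > 0. As r → 0 it tends to the Jacobian of translation by 0, which is the identity. -/
theorem det_fderiv_mul (ξ η : Coord m) : (fderiv ℝ (G.mul ξ) η).det = 1 := by
  set Φ : Coord m × Coord m → Coord m := fun p => G.mul p.1 p.2 with hΦ
  have hΦs : ContDiff ℝ 1 Φ := G.contDiff_mul contDiff_fst contDiff_snd
  have hpart : ∀ ξ η, HasFDerivAt (G.mul ξ)
      ((fderiv ℝ Φ (ξ, η)).comp (ContinuousLinearMap.inr ℝ (Coord m) (Coord m))) η := fun ξ η =>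
    ((hΦs.differentiable one_ne_zero).differentiableAt.hasFDerivAt).comp η
      (hasFDerivAt_prodMk_right ξ η)
  set J : ℝ → ℝ := fun r => (fderiv ℝ (G.mul (G.dilation r ξ)) (G.dilation r η)).det with hJ
  have hJc : Continuous J := by
    have h1 : J = fun r => ((fderiv ℝ Φ (G.dilation r ξ, G.dilation r η)).comp
        (ContinuousLinearMap.inr ℝ (Coord m) (Coord m))).det := by
      ext r
      rw [hJ]
      dsimp only
      rw [(hpart _ _).fderiv]
    rw [h1]
    refine ContinuousLinearMap.continuous_det.comp ?_
    refine Continuous.clm_comp ?_ continuous_const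
    exact (hΦs.continuous_fderiv one_ne_zero).comp
      ((G.continuous_dilation_left ξ).prodMk (G.continuous_dilation_left η))
  have hJ0 : J 0 = 1 := by
    have hz : ∀ ξ : Coord m, G.dilation 0 ξ = 0 := by
      intro ξ
      ext j
      simp [dilation_apply]
    have hid : G.mul 0 = id := by
      ext1 η
      exact G.zero_mul' η
    simp only [hJ, hz, hid, fderiv_id]
    exact LinearMap.det_id
  have hJr : ∀ r, 0 < r → J r = J 1 := by
    intro r hr
    set D := LinearMap.toContinuousLinearMap (G.dilation r) with hD
    have hDdet : D.det ≠ 0 := by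
      change LinearMap.det (G.dilation r) ≠ 0
      rw [det_dilation]
      positivity
    have hfun : (fun η => G.mul (G.dilation r ξ) (D η)) = fun η => D (G.mul ξ η) := by
      ext1 η
      exact (G.dilation_mul r ξ η).symm
    have h1 : HasFDerivAt (fun η => G.mul (G.dilation r ξ) (D η))
        ((fderiv ℝ (G.mul (G.dilation r ξ)) (G.dilation r η)).comp D) η :=
      (hpart _ _).differentiableAt.hasFDerivAt.comp η D.hasFDerivAt
    have h2 : HasFDerivAt (fun η => D (G.mul ξ η)) (D.comp (fderiv ℝ (G.mul ξ) η)) η :=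
      D.hasFDerivAt.comp η (hpart _ _).differentiableAt.hasFDerivAt
    rw [hfun] at h1
    have h3 := congrArg ContinuousLinearMap.det (h1.unique h2)
    have hcomp : ∀ A B : Coord m →L[ℝ] Coord m, (A.comp B).det = A.det * B.det := fun A B =>
      LinearMap.det_comp _ _
    rw [hcomp, hcomp, mul_comm] at h3
    simp only [hJ, dilation_one]
    exact mul_left_cancel₀ hDdet h3
  have hlim : Filter.Tendsto J (nhdsWithin 0 (Set.Ioi 0)) (nhds (J 0)) :=
    hJc.continuousAt.continuousWithinAt
  have hlim' : Filter.Tendsto J (nhdsWithin 0 (Set.Ioi 0)) (nhds (J 1)) :=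
    tendsto_const_nhds.congr' (by
      filter_upwards [self_mem_nhdsWithin] with r hr
      exact (hJr r hr).symm)
  have := tendsto_nhds_unique hlim hlim'
  rw [hJ0] at this
  simp only [hJ, dilation_one] at this
  exact this.symm

theorem mul_left_injective (ξ : Coord m) : Function.Injective (G.mul ξ) := by
  intro η ζ h
  rw [← G.zero_mul' η, ← G.neg_mul_self ξ, mul_assoc', h, ← mul_assoc', neg_mul_self, zero_mul']

theorem measurePreserving_mul_left_volume (ξ : Coord m) :
    MeasurePreserving (G.mul ξ) volume volume := by
  have hc : ∀ ξ, Continuous (G.mul ξ) := fun ξ => G.continuous_mul continuous_const continuous_id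
  refine ⟨(hc ξ).measurable, ?_⟩
  ext S hS
  rw [Measure.map_apply (hc ξ).measurable hS]
  have hpre : G.mul ξ ⁻¹' S = G.mul (-ξ) '' S := by
    ext η
    simp only [Set.mem_preimage, Set.mem_image]
    constructor
    · intro h
      exact ⟨_, h, by rw [← mul_assoc', neg_mul_self, zero_mul']⟩
    · rintro ⟨ζ, hζ, rfl⟩
      rwa [← mul_assoc', mul_neg_self, zero_mul']
  rw [hpre, ← lintegral_abs_det_fderiv_eq_addHaar_image volume hS (f := G.mul (-ξ))
    (f' := fun η => fderiv ℝ (G.mul (-ξ)) η)]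
  · simp [det_fderiv_mul]
  · intro η _
    refine DifferentiableAt.hasFDerivAt ?_ |>.hasFDerivWithinAt
    exact (G.contDiff_mul (n := 1) contDiff_const contDiff_id).differentiable one_ne_zero _
  · exact (G.mul_left_injective _).injOn

/-- The coordinate space, as a type that carries the group structure. -/
def Point (_G : CarnotGroup 𝔤 s m) : Type := Coord m

instance : TopologicalSpace G.Point := inferInstanceAs (TopologicalSpace (Coord m))
instance : MeasurableSpace G.Point := inferInstanceAs (MeasurableSpace (Coord m))
instance : BorelSpace G.Point := inferInstanceAs (BorelSpace (Coord m))
instance : LocallyCompactSpace G.Point := inferInstanceAs (LocallyCompactSpace (Coord m))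
instance : SecondCountableTopology G.Point := inferInstanceAs (SecondCountableTopology (Coord m))

instance : Group G.Point :=
  @Group.ofLeftAxioms G.Point ⟨G.mul⟩ ⟨fun ξ : Coord m => -ξ⟩ ⟨(0 : Coord m)⟩
    G.mul_assoc' G.zero_mul' G.neg_mul_self

instance : IsTopologicalGroup G.Point where
  continuous_mul := G.continuous_mul (X := Coord m × Coord m) continuous_fst continuous_snd
  continuous_inv := continuous_neg (G := Coord m)

variable {G}

/-- Lebesgue measure is itself a Haar measure, its left invariance being
`measurePreserving_mul_left_volume`, so uniqueness of Haar measure applies. -/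
theorem IsHaar.eq_smul_volume {μ : Measure (Coord m)} (hμ : G.IsHaar μ) :
    ∃ c : ℝ≥0, c ≠ 0 ∧ μ = c • volume := by
  let μ' : Measure G.Point := μ
  let ν : Measure G.Point := (volume : Measure (Coord m))
  have : μ'.IsMulLeftInvariant := ⟨fun ξ => (hμ.left_invariant ξ).map_eq⟩
  have : ν.IsMulLeftInvariant := ⟨fun ξ => (G.measurePreserving_mul_left_volume ξ).map_eq⟩
  have : IsFiniteMeasureOnCompacts μ' := ⟨fun K hK => hμ.finite_of_isCompact K hK⟩
  have : IsFiniteMeasureOnCompacts ν :=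
    ⟨fun K hK => IsCompact.measure_lt_top (α := Coord m) (μ := volume) hK⟩
  have : ν.IsOpenPosMeasure :=
    ⟨fun U hU hne => IsOpen.measure_ne_zero (X := Coord m) volume hU hne⟩
  have : ν.IsHaarMeasure := {}
  have h := Measure.isMulLeftInvariant_eq_smul μ' ν
  refine ⟨Measure.haarScalarFactor μ' ν, ?_, h⟩
  intro h0
  rw [h0, zero_smul] at h
  exact hμ.ne_zero h

theorem IsHaar.measure_dilation_image {μ : Measure (Coord m)} (hμ : G.IsHaar μ) {r : ℝ}
    (hr : 0 ≤ r) (S : Set (Coord m)) :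
    μ (G.dilation r '' S) = ENNReal.ofReal (r ^ G.homDim) * μ S := by
  obtain ⟨c, _, rfl⟩ := hμ.eq_smul_volume
  rw [Measure.smul_apply, Measure.smul_apply, Measure.addHaar_image_linearMap, det_dilation,
    abs_of_nonneg (by positivity), ENNReal.smul_def, ENNReal.smul_def, smul_eq_mul, smul_eq_mul]
  ring

theorem IsHaar.isOpenPosMeasure {μ : Measure (Coord m)} (hμ : G.IsHaar μ) :
    μ.IsOpenPosMeasure := by
  obtain ⟨c, hc, rfl⟩ := hμ.eq_smul_volume
  refine ⟨fun U hU hne => ?_⟩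
  rw [Measure.smul_apply, ENNReal.smul_def, smul_eq_mul]
  exact mul_ne_zero (by simpa using hc) (hU.measure_ne_zero volume hne)

end CarnotGroup

end

noncomputable section

/-! ### Calculus with the left-invariant vector fields -/

namespace CarnotGroup

open Filter Topology

variable {𝔤 : Type*} [LieRing 𝔤] [LieAlgebra ℝ 𝔤] {s : ℕ} {m : Fin s → ℕ}
  (G : CarnotGroup 𝔤 s m)

attribute [local irreducible] CarnotGroup.mul

theorem contDiff_expX (i : Fin G.rank) {n : WithTop ℕ∞} : ContDiff ℝ n (G.expX i) := by
  rw [contDiff_pi]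
  intro j
  by_cases h : j = ⟨⟨0, G.one_le_step⟩, i⟩
  · subst h
    have : (fun t => G.expX i t ⟨⟨0, G.one_le_step⟩, i⟩) = id := by
      ext t
      simp [expX]
    rw [this]
    exact contDiff_id
  · have : (fun t => G.expX i t j) = fun _ => 0 := by
      ext t
      simp [expX, h]
    rw [this]
    exact contDiff_const

theorem contDiff_mul_expX (i : Fin G.rank) {n : WithTop ℕ∞} :
    ContDiff ℝ n fun p : Coord m × ℝ => G.mul p.1 (G.expX i p.2) :=
  G.contDiff_mul contDiff_fst ((G.contDiff_expX i).comp contDiff_snd)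

theorem continuous_mul_expX (i : Fin G.rank) :
    Continuous fun p : Coord m × ℝ => G.mul p.1 (G.expX i p.2) :=
  (G.contDiff_mul_expX i (n := 0)).continuous

/-- The coefficients of the vector field `Xᵢ`. -/
def field (i : Fin G.rank) (ξ : Coord m) : Coord m :=
  fderiv ℝ (fun p : Coord m × ℝ => G.mul p.1 (G.expX i p.2)) (ξ, 0) (0, 1)

theorem contDiff_field (i : Fin G.rank) : ContDiff ℝ 1 (G.field i) := by
  have h := (G.contDiff_mul_expX i (n := 2)).fderiv_right (m := 1) (by norm_num)
  exact (h.comp (contDiff_id.prodMk contDiff_const)).clm_apply contDiff_const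

theorem hasDerivAt_mul_expX (i : Fin G.rank) (ξ : Coord m) :
    HasDerivAt (fun t => G.mul ξ (G.expX i t)) (G.field i ξ) 0 := by
  have h := ((G.contDiff_mul_expX i (n := 1)).differentiable one_ne_zero (ξ, 0)).hasFDerivAt
  exact h.comp_hasDerivAt (0 : ℝ) ((hasDerivAt_const (0 : ℝ) ξ).prodMk (hasDerivAt_id 0))

variable {G}

theorem mul_expX_zero (ξ : Coord m) (i : Fin G.rank) : G.mul ξ (G.expX i 0) = ξ := by
  rw [expX_zero, mul_zero']

theorem tendsto_mul_expX (ξ : Coord m) (i : Fin G.rank) :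
    Tendsto (fun t => G.mul ξ (G.expX i t)) (𝓝 0) (𝓝 ξ) := by
  have h := (G.hasDerivAt_mul_expX i ξ).continuousAt.tendsto
  rwa [mul_expX_zero] at h

theorem X_eq_fderiv {u : Coord m → ℝ} {ξ : Coord m} (hu : DifferentiableAt ℝ u ξ)
    (i : Fin G.rank) : G.X i u ξ = fderiv ℝ u ξ (G.field i ξ) := by
  have hu' : HasFDerivAt u (fderiv ℝ u ξ) (G.mul ξ (G.expX i 0)) := by
    rw [mul_expX_zero]
    exact hu.hasFDerivAt
  exact (hu'.comp_hasDerivAt (0 : ℝ) (G.hasDerivAt_mul_expX i ξ)).deriv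

theorem hasDerivAt_X_zero {u : Coord m → ℝ} {ξ : Coord m} (hu : DifferentiableAt ℝ u ξ)
    (i : Fin G.rank) : HasDerivAt (fun t => u (G.mul ξ (G.expX i t))) (G.X i u ξ) 0 := by
  have hu' : HasFDerivAt u (fderiv ℝ u ξ) (G.mul ξ (G.expX i 0)) := by
    rw [mul_expX_zero]
    exact hu.hasFDerivAt
  rw [X_eq_fderiv hu]
  exact hu'.comp_hasDerivAt (0 : ℝ) (G.hasDerivAt_mul_expX i ξ)

theorem hasDerivAt_X {u : Coord m → ℝ} {ξ : Coord m} {i : Fin G.rank} {t : ℝ}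
    (hu : DifferentiableAt ℝ u (G.mul ξ (G.expX i t))) :
    HasDerivAt (fun τ => u (G.mul ξ (G.expX i τ))) (G.X i u (G.mul ξ (G.expX i t))) t := by
  have h := hasDerivAt_X_zero hu i
  have h2 : HasDerivAt (fun τ : ℝ => τ - t) 1 t := (hasDerivAt_id t).sub_const t
  rw [← sub_self t] at h
  have h3 := HasDerivAt.comp (h := fun τ : ℝ => τ - t) t h h2
  rw [mul_one] at h3
  refine h3.congr_of_eventuallyEq ?_
  filter_upwards with τ
  simp only [Function.comp]
  rw [← mul_expX_add, add_sub_cancel]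

theorem X_congr {u v : Coord m → ℝ} {ξ : Coord m} (h : u =ᶠ[𝓝 ξ] v) (i : Fin G.rank) :
    G.X i u ξ = G.X i v ξ := by
  refine Filter.EventuallyEq.deriv_eq ?_
  exact (tendsto_mul_expX ξ i).eventually h

theorem X_eventuallyEq {u v : Coord m → ℝ} {ξ : Coord m} (h : u =ᶠ[𝓝 ξ] v) (i : Fin G.rank) :
    G.X i u =ᶠ[𝓝 ξ] G.X i v :=
  h.eventuallyEq_nhds.mono fun _ hη => X_congr hη i

theorem subLaplacian_congr {u v : Coord m → ℝ} {ξ : Coord m} (h : u =ᶠ[𝓝 ξ] v) :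
    G.subLaplacian u ξ = G.subLaplacian v ξ :=
  Finset.sum_congr rfl fun i _ => X_congr (X_eventuallyEq h i) i

theorem X_const (c : ℝ) (i : Fin G.rank) : G.X i (fun _ => c) = fun _ => 0 := by
  ext ξ
  simp [X]

theorem X_neg (u : Coord m → ℝ) (i : Fin G.rank) : G.X i (fun ξ => -u ξ) = fun ξ => -G.X i u ξ := by
  ext ξ
  simp [X, deriv.fun_neg]

theorem subLaplacian_neg (u : Coord m → ℝ) (ξ : Coord m) :
    G.subLaplacian (fun ξ => -u ξ) ξ = -G.subLaplacian u ξ := by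
  simp only [subLaplacian, X_neg, Finset.sum_neg_distrib]

theorem X_mul {u v : Coord m → ℝ} {ξ : Coord m} (hu : DifferentiableAt ℝ u ξ)
    (hv : DifferentiableAt ℝ v ξ) (i : Fin G.rank) :
    G.X i (fun η => u η * v η) ξ = G.X i u ξ * v ξ + u ξ * G.X i v ξ := by
  have h := (hasDerivAt_X_zero hu i).mul (hasDerivAt_X_zero hv i)
  simp only [mul_expX_zero] at h
  exact h.deriv

theorem X_sub {u v : Coord m → ℝ} {ξ : Coord m} (hu : DifferentiableAt ℝ u ξ)
    (hv : DifferentiableAt ℝ v ξ) (i : Fin G.rank) :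
    G.X i (fun η => u η - v η) ξ = G.X i u ξ - G.X i v ξ :=
  ((hasDerivAt_X_zero hu i).sub (hasDerivAt_X_zero hv i)).deriv

theorem X_comp {u : Coord m → ℝ} {ξ : Coord m} (hu : DifferentiableAt ℝ u ξ) {θ : ℝ → ℝ}
    {θ' : ℝ} (hθ : HasDerivAt θ θ' (u ξ)) (i : Fin G.rank) :
    G.X i (fun η => θ (u η)) ξ = θ' * G.X i u ξ := by
  have hθ' : HasDerivAt θ θ' (u (G.mul ξ (G.expX i 0))) := by rwa [mul_expX_zero]
  exact (hθ'.comp (0 : ℝ) (hasDerivAt_X_zero hu i)).deriv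

theorem contDiffOn_X {u : Coord m → ℝ} {Ω : Set (Coord m)} (hΩ : IsOpen Ω)
    (hu : ContDiffOn ℝ 2 u Ω) (i : Fin G.rank) : ContDiffOn ℝ 1 (G.X i u) Ω := by
  have h1 : ContDiffOn ℝ 1 (fun ξ => fderiv ℝ u ξ (G.field i ξ)) Ω :=
    (hu.fderiv_of_isOpen hΩ (by norm_num)).clm_apply (G.contDiff_field i).contDiffOn
  refine h1.congr fun ξ hξ => ?_
  exact X_eq_fderiv ((hu.contDiffAt (hΩ.mem_nhds hξ)).differentiableAt (by norm_num)) i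

theorem contDiff_X {u : Coord m → ℝ} (hu : ContDiff ℝ 2 u) (i : Fin G.rank) :
    ContDiff ℝ 1 (G.X i u) := by
  rw [← contDiffOn_univ] at hu ⊢
  exact contDiffOn_X isOpen_univ hu i

theorem continuous_X {u : Coord m → ℝ} (hu : ContDiff ℝ 1 u) (i : Fin G.rank) :
    Continuous (G.X i u) := by
  have h : G.X i u = fun ξ => fderiv ℝ u ξ (G.field i ξ) := by
    ext ξ
    exact X_eq_fderiv (hu.differentiable one_ne_zero ξ) i
  rw [h]
  exact (hu.continuous_fderiv one_ne_zero).clm_apply (G.contDiff_field i).continuous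

theorem continuous_subLaplacian {u : Coord m → ℝ} (hu : ContDiff ℝ 2 u) :
    Continuous (G.subLaplacian u) :=
  continuous_finsetSum _ fun i _ => continuous_X (contDiff_X hu i) i

theorem hasCompactSupport_X {u : Coord m → ℝ} (hu : HasCompactSupport u) (i : Fin G.rank) :
    HasCompactSupport (G.X i u) := by
  refine HasCompactSupport.of_support_subset_isCompact hu ?_
  intro ξ hξ
  by_contra h
  refine hξ ?_
  have : u =ᶠ[𝓝 ξ] fun _ => 0 := notMem_tsupport_iff_eventuallyEq.1 h
  rw [X_congr this, X_const]

theorem X_comp_dilation (u : Coord m → ℝ) (a : ℝ) (i : Fin G.rank) :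
    G.X i (fun ξ => u (G.dilation a ξ)) = fun ξ => a * G.X i u (G.dilation a ξ) := by
  ext ξ
  simp only [X, dilation_mul, dilation_expX]
  have := deriv_comp_mul_left a (fun t => u (G.mul (G.dilation a ξ) (G.expX i t))) 0
  rw [mul_zero, smul_eq_mul] at this
  exact this

theorem X_const_mul (c : ℝ) (u : Coord m → ℝ) (i : Fin G.rank) :
    G.X i (fun ξ => c * u ξ) = fun ξ => c * G.X i u ξ := by
  ext ξ
  simp [X]

theorem subLaplacian_comp_dilation (u : Coord m → ℝ) (a : ℝ) (ξ : Coord m) :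
    G.subLaplacian (fun ξ => u (G.dilation a ξ)) ξ = a ^ 2 * G.subLaplacian u (G.dilation a ξ) := by
  simp only [subLaplacian, X_comp_dilation, X_const_mul, Finset.mul_sum]
  refine Finset.sum_congr rfl fun i _ => ?_
  ring

/-! ### Integration by parts -/

theorem IsHaar.isFiniteMeasureOnCompacts {μ : Measure (Coord m)} (hμ : G.IsHaar μ) :
    IsFiniteMeasureOnCompacts μ := ⟨fun K hK => hμ.finite_of_isCompact K hK⟩

theorem IsHaar.sigmaFinite {μ : Measure (Coord m)} (hμ : G.IsHaar μ) : SigmaFinite μ := by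
  obtain ⟨c, _, rfl⟩ := hμ.eq_smul_volume
  infer_instance

/-- By right invariance ∫ φ(ξ exp(tXᵢ)) dμ is constant in t; its derivative at 0, taken under the
integral, is ∫ Xᵢφ. -/
theorem IsHaar.integral_X_eq_zero {μ : Measure (Coord m)} (hμ : G.IsHaar μ) {φ : Coord m → ℝ}
    (hφ : ContDiff ℝ 1 φ) (hc : HasCompactSupport φ) (i : Fin G.rank) :
    ∫ ξ, G.X i φ ξ ∂μ = 0 := by
  have := hμ.isFiniteMeasureOnCompacts
  have hcont : ∀ t, Continuous fun ξ => G.mul ξ (G.expX i t) := fun t =>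
    (G.continuous_mul_expX i).comp (continuous_id.prodMk continuous_const)
  have hXc := continuous_X hφ i
  obtain ⟨B, hB⟩ := hXc.bounded_above_of_compact_support (hasCompactSupport_X hc i)
  -- This compact set contains every ξ such that ξ exp(tXᵢ) meets the support of φ for some |t| ≤ 1,
  -- so it carries the dominating function.
  set K : Set (Coord m) := (fun p : Coord m × ℝ => G.mul p.1 (G.expX i p.2)) ''
    (tsupport φ ×ˢ Set.Icc (-1) 1) with hK
  have hKc : IsCompact K := (IsCompact.prod hc isCompact_Icc).image (G.continuous_mul_expX i)
  have hd := (hasDerivAt_integral_of_dominated_loc_of_deriv_le (μ := μ) (𝕜 := ℝ)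
    (F := fun t ξ => φ (G.mul ξ (G.expX i t)))
    (F' := fun t ξ => G.X i φ (G.mul ξ (G.expX i t))) (x₀ := 0)
    (bound := K.indicator fun _ => B) (Metric.ball_mem_nhds 0 one_pos) ?_ ?_ ?_ ?_ ?_ ?_).2
  · have hconst : (fun t => ∫ ξ, φ (G.mul ξ (G.expX i t)) ∂μ) = fun _ => ∫ ξ, φ ξ ∂μ := by
      ext t
      have hmp := hμ.right_invariant (G.expX i t)
      rw [← integral_map hmp.measurable.aemeasurable, hmp.map_eq]
      rw [hmp.map_eq]
      exact hφ.continuous.aestronglyMeasurable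
    rw [hconst] at hd
    have := hd.unique (hasDerivAt_const (0 : ℝ) _)
    simpa only [mul_expX_zero] using this
  · exact Filter.Eventually.of_forall fun t =>
      (hφ.continuous.comp (hcont t)).aestronglyMeasurable
  · simp only [mul_expX_zero]
    exact hφ.continuous.integrable_of_hasCompactSupport hc
  · exact (hXc.comp (hcont 0)).aestronglyMeasurable
  · refine Filter.Eventually.of_forall fun ξ t ht => ?_
    by_cases hξ : ξ ∈ K
    · rw [Set.indicator_of_mem hξ]
      exact hB _
    · rw [Set.indicator_of_notMem hξ]
      have : G.mul ξ (G.expX i t) ∉ tsupport φ := by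
        intro h
        refine hξ ⟨(G.mul ξ (G.expX i t), -t), ⟨h, ?_⟩, ?_⟩
        · rw [Metric.mem_ball, dist_zero_right, Real.norm_eq_abs, abs_lt] at ht
          constructor <;> simp <;> linarith [ht.1, ht.2]
        · simp only
          rw [← mul_expX_add, add_neg_cancel, mul_expX_zero]
      have h0 : φ =ᶠ[𝓝 (G.mul ξ (G.expX i t))] fun _ => 0 := notMem_tsupport_iff_eventuallyEq.1 this
      rw [X_congr h0, X_const, norm_zero]
  · exact (integrable_indicator_iff hKc.measurableSet).2
      (integrableOn_const (hμ.finite_of_isCompact K hKc).ne)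
  · exact Filter.Eventually.of_forall fun ξ t _ =>
      hasDerivAt_X (hφ.differentiable one_ne_zero _)

/-- Green's identity: χ LP - P Lχ = ∑ Xᵢ(χ XᵢP - P Xᵢχ), where each bracket has compact support
because χ does. -/
theorem IsHaar.integral_mul_subLaplacian {μ : Measure (Coord m)} (hμ : G.IsHaar μ)
    {P χ : Coord m → ℝ} (hP : ContDiff ℝ 2 P) (hχ : ContDiff ℝ 2 χ) (hc : HasCompactSupport χ) :
    ∫ ξ, χ ξ * G.subLaplacian P ξ ∂μ = ∫ ξ, P ξ * G.subLaplacian χ ξ ∂μ := by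
  have := hμ.isFiniteMeasureOnCompacts
  have h12 : (1 : WithTop ℕ∞) ≤ 2 := by norm_num
  have hP1 := hP.of_le h12
  have hχ1 := hχ.of_le h12
  have hdP : Differentiable ℝ P := hP.differentiable (by norm_num)
  have hdχ : Differentiable ℝ χ := hχ.differentiable (by norm_num)
  have hi1 : ∀ i, Integrable (fun ξ => χ ξ * G.X i (G.X i P) ξ) μ := fun i =>
    (hχ.continuous.mul (continuous_X (contDiff_X hP i) i)).integrable_of_hasCompactSupport
      hc.mul_right
  have hi2 : ∀ i, Integrable (fun ξ => P ξ * G.X i (G.X i χ) ξ) μ := fun i =>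
    (hP.continuous.mul (continuous_X (contDiff_X hχ i) i)).integrable_of_hasCompactSupport
      (hasCompactSupport_X (hasCompactSupport_X hc i) i).mul_left
  simp only [subLaplacian, Finset.mul_sum]
  rw [integral_finsetSum _ fun i _ => hi1 i, integral_finsetSum _ fun i _ => hi2 i]
  refine Finset.sum_congr rfl fun i _ => ?_
  rw [← sub_eq_zero, ← integral_sub (hi1 i) (hi2 i),
    ← hμ.integral_X_eq_zero (φ := fun ξ => χ ξ * G.X i P ξ - P ξ * G.X i χ ξ)
    ((hχ1.mul (contDiff_X hP i)).sub (hP1.mul (contDiff_X hχ i)))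
    (hc.mul_right.sub (hasCompactSupport_X hc i).mul_left) i]
  refine integral_congr_ae (Filter.Eventually.of_forall fun ξ => ?_)
  have hdXP : DifferentiableAt ℝ (G.X i P) ξ := (contDiff_X hP i).differentiable one_ne_zero ξ
  have hdXχ : DifferentiableAt ℝ (G.X i χ) ξ := (contDiff_X hχ i).differentiable one_ne_zero ξ
  simp only
  rw [X_sub ((hdχ ξ).fun_mul hdXP) ((hdP ξ).fun_mul hdXχ), X_mul (hdχ ξ) hdXP, X_mul (hdP ξ) hdXχ]
  ring

end CarnotGroup

end

noncomputable section

/-! ### The Faber-Krahn inequality -/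

theorem sq_integral_le_integral_sq {h : ℝ → ℝ} (hh : Continuous h) :
    (∫ σ in (0 : ℝ)..1, h σ) ^ 2 ≤ ∫ σ in (0 : ℝ)..1, h σ ^ 2 := by
  set c := ∫ σ in (0 : ℝ)..1, h σ with hc
  have h1 : 0 ≤ ∫ σ in (0 : ℝ)..1, (h σ - c) ^ 2 :=
    intervalIntegral.integral_nonneg zero_le_one fun σ _ => sq_nonneg _
  have h2 : ∫ σ in (0 : ℝ)..1, (h σ - c) ^ 2 =
      (∫ σ in (0 : ℝ)..1, h σ ^ 2) - 2 * c * c + c ^ 2 := by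
    have e : ∀ σ, (h σ - c) ^ 2 = h σ ^ 2 - 2 * c * h σ + c ^ 2 := fun σ => by ring
    simp only [e]
    rw [intervalIntegral.integral_add, intervalIntegral.integral_sub,
      intervalIntegral.integral_const_mul, ← hc]
    · simp
    all_goals exact Continuous.intervalIntegrable (by fun_prop) _ _
  rw [h2] at h1
  nlinarith

namespace CarnotGroup

open Filter Topology

variable {𝔤 : Type*} [LieRing 𝔤] [LieAlgebra ℝ 𝔤] {s : ℕ} {m : Fin s → ℕ}
  {G : CarnotGroup 𝔤 s m}

attribute [local irreducible] CarnotGroup.mul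

/-- The fundamental theorem of calculus along the integral curve of Xᵢ, followed by Cauchy-Schwarz
on the unit interval. -/
theorem sq_sub_le_integral {v : Coord m → ℝ} (hv : ContDiff ℝ 1 v) (ξ : Coord m) (i : Fin G.rank)
    (t : ℝ) : (v (G.mul ξ (G.expX i t)) - v ξ) ^ 2 ≤
      ∫ σ in (0 : ℝ)..1, t ^ 2 * G.X i v (G.mul ξ (G.expX i (t * σ))) ^ 2 := by
  have hcont : Continuous fun σ : ℝ => t * G.X i v (G.mul ξ (G.expX i (t * σ))) :=
    continuous_const.mul ((continuous_X hv i).comp ((G.continuous_mul_expX i).comp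
      (continuous_const.prodMk (continuous_const.mul continuous_id))))
  have h := intervalIntegral.integral_eq_sub_of_hasDerivAt (a := 0) (b := 1)
    (f := fun σ : ℝ => v (G.mul ξ (G.expX i (t * σ))))
    (f' := fun σ : ℝ => t * G.X i v (G.mul ξ (G.expX i (t * σ)))) (fun σ _ => by
      have h1 := hasDerivAt_X (G := G) (i := i) (ξ := ξ) (t := t * σ)
        (hv.differentiable one_ne_zero _)
      have h2 : HasDerivAt (fun σ : ℝ => t * σ) t σ := by
        simpa using (hasDerivAt_id σ).const_mul t
      have h3 := HasDerivAt.comp (h := fun σ : ℝ => t * σ) σ h1 h2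
      rw [mul_comm] at h3
      exact h3) (hcont.intervalIntegrable _ _)
  simp only [mul_one, mul_zero, mul_expX_zero] at h
  rw [← h]
  refine (sq_integral_le_integral_sq hcont).trans_eq ?_
  simp only [mul_pow]

variable {μ : Measure (Coord m)}

theorem IsHaar.lintegral_mul_right (hμ : G.IsHaar μ) (η : Coord m) {f : Coord m → ℝ≥0∞}
    (hf : Measurable f) : ∫⁻ ξ, f (G.mul ξ η) ∂μ = ∫⁻ ξ, f ξ ∂μ :=
  (hμ.right_invariant η).lintegral_comp hf

theorem IsHaar.lintegral_mul_left (hμ : G.IsHaar μ) (η : Coord m) {f : Coord m → ℝ≥0∞}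
    (hf : Measurable f) : ∫⁻ ξ, f (G.mul η ξ) ∂μ = ∫⁻ ξ, f ξ ∂μ :=
  (hμ.left_invariant η).lintegral_comp hf

theorem IsHaar.lintegral_sq_sub_expX_le (hμ : G.IsHaar μ) {v : Coord m → ℝ} (hv : ContDiff ℝ 1 v)
    (i : Fin G.rank) (t : ℝ) :
    ∫⁻ ξ, ENNReal.ofReal ((v (G.mul ξ (G.expX i t)) - v ξ) ^ 2) ∂μ ≤
      ENNReal.ofReal (t ^ 2) * ∫⁻ ξ, ENNReal.ofReal (G.X i v ξ ^ 2) ∂μ := by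
  have := hμ.sigmaFinite
  have hXc := continuous_X hv i
  have hc2 : Continuous fun p : Coord m × ℝ =>
      t ^ 2 * G.X i v (G.mul p.1 (G.expX i (t * p.2))) ^ 2 :=
    continuous_const.mul ((hXc.comp ((G.continuous_mul_expX i).comp
      (continuous_fst.prodMk (continuous_const.mul continuous_snd)))).pow 2)
  calc ∫⁻ ξ, ENNReal.ofReal ((v (G.mul ξ (G.expX i t)) - v ξ) ^ 2) ∂μ
      ≤ ∫⁻ ξ, (∫⁻ σ in Set.Ioc (0 : ℝ) 1,
        ENNReal.ofReal (t ^ 2 * G.X i v (G.mul ξ (G.expX i (t * σ))) ^ 2) ∂volume) ∂μ := by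
        refine lintegral_mono fun ξ => ?_
        refine (ENNReal.ofReal_le_ofReal (sq_sub_le_integral hv ξ i t)).trans_eq ?_
        rw [intervalIntegral.integral_of_le zero_le_one, ofReal_integral_eq_lintegral_ofReal]
        · have : Continuous fun σ : ℝ => t ^ 2 * G.X i v (G.mul ξ (G.expX i (t * σ))) ^ 2 :=
            hc2.comp (continuous_const.prodMk continuous_id)
          exact (this.intervalIntegrable 0 1).1
        · exact Eventually.of_forall fun σ => by positivity
    _ = ∫⁻ σ in Set.Ioc (0 : ℝ) 1, ∫⁻ ξ,
        ENNReal.ofReal (t ^ 2 * G.X i v (G.mul ξ (G.expX i (t * σ))) ^ 2) ∂μ := by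
        rw [lintegral_lintegral_swap]
        exact hc2.measurable.ennreal_ofReal.aemeasurable
    _ = ∫⁻ _ in Set.Ioc (0 : ℝ) 1, ∫⁻ ξ, ENNReal.ofReal (t ^ 2 * G.X i v ξ ^ 2) ∂μ := by
        refine lintegral_congr fun σ => ?_
        exact hμ.lintegral_mul_right _
          (f := fun ξ => ENNReal.ofReal (t ^ 2 * G.X i v ξ ^ 2))
          (continuous_const.mul (hXc.pow 2)).measurable.ennreal_ofReal
    _ = _ := by
        simp only [lintegral_const, Measure.restrict_apply MeasurableSet.univ, Set.univ_inter,
          Real.volume_Ioc, sub_zero, ENNReal.ofReal_one, mul_one]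
        have hm : Measurable fun ξ => ENNReal.ofReal (G.X i v ξ ^ 2) :=
          (hXc.pow 2).measurable.ennreal_ofReal
        rw [← lintegral_const_mul _ hm]
        refine lintegral_congr fun ξ => ?_
        rw [ENNReal.ofReal_mul (by positivity)]

variable (G) in
/-- The square of the length of the horizontal gradient. -/
def gradSq (v : Coord m → ℝ) (ξ : Coord m) : ℝ := ∑ i : Fin G.rank, G.X i v ξ ^ 2

theorem gradSq_nonneg (v : Coord m → ℝ) (ξ : Coord m) : 0 ≤ G.gradSq v ξ :=
  Finset.sum_nonneg fun _ _ => sq_nonneg _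

theorem continuous_gradSq {v : Coord m → ℝ} (hv : ContDiff ℝ 1 v) : Continuous (G.gradSq v) :=
  continuous_finsetSum _ fun i _ => (continuous_X hv i).pow 2

theorem continuous_mul_right (η : Coord m) : Continuous fun ξ => G.mul ξ η :=
  G.continuous_mul continuous_id continuous_const

theorem continuous_mul_left (η : Coord m) : Continuous fun ξ => G.mul η ξ :=
  G.continuous_mul continuous_const continuous_id

/-- A translation by n horizontal factors is estimated one factor at a time, with (a + b)² ≤ 2a² +
2b² and right invariance. The constants satisfy 2r² + 2·4ⁿr² ≤ 4ⁿ⁺¹r². -/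
theorem IsHaar.lintegral_sq_sub_le (hμ : G.IsHaar μ) {v : Coord m → ℝ} (hv : ContDiff ℝ 1 v)
    {n : ℕ} {r : ℝ} {η : Coord m} (hη : η ∈ G.horizontalProducts n r) :
    ∫⁻ ξ, ENNReal.ofReal ((v (G.mul ξ η) - v ξ) ^ 2) ∂μ ≤
      ENNReal.ofReal (4 ^ n * r ^ 2) * ∫⁻ ξ, ENNReal.ofReal (G.gradSq v ξ) ∂μ := by
  induction n generalizing η with
  | zero =>
    rw [show η = 0 from hη]
    simp [mul_zero']
  | succ n ih =>
    obtain ⟨η, hη, i, t, ht, rfl⟩ := hη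
    set D := ∫⁻ ξ, ENNReal.ofReal (G.gradSq v ξ) ∂μ with hD
    have hvc := hv.continuous
    have hm1 : Measurable fun ξ => ENNReal.ofReal ((v (G.mul ξ (G.expX i t)) - v ξ) ^ 2) :=
      (((hvc.comp (continuous_mul_right _)).sub hvc).pow 2).measurable.ennreal_ofReal
    have hm2 : Measurable fun ξ => ENNReal.ofReal ((v (G.mul ξ η) - v ξ) ^ 2) :=
      (((hvc.comp (continuous_mul_right _)).sub hvc).pow 2).measurable.ennreal_ofReal
    have hm3 : Measurable fun ξ => ENNReal.ofReal
        ((v (G.mul (G.mul ξ η) (G.expX i t)) - v (G.mul ξ η)) ^ 2) :=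
      hm1.comp (continuous_mul_right η).measurable
    have hX : ∫⁻ ξ, ENNReal.ofReal (G.X i v ξ ^ 2) ∂μ ≤ D := by
      refine lintegral_mono fun ξ => ENNReal.ofReal_le_ofReal ?_
      exact Finset.single_le_sum (f := fun i => G.X i v ξ ^ 2) (fun _ _ => sq_nonneg _)
        (Finset.mem_univ i)
    have ht2 : t ^ 2 ≤ r ^ 2 := by
      rw [← sq_abs t]
      exact pow_le_pow_left₀ (abs_nonneg t) ht 2
    calc ∫⁻ ξ, ENNReal.ofReal ((v (G.mul ξ (G.mul η (G.expX i t))) - v ξ) ^ 2) ∂μ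
        ≤ ∫⁻ ξ, (2 * ENNReal.ofReal ((v (G.mul (G.mul ξ η) (G.expX i t)) - v (G.mul ξ η)) ^ 2) +
            2 * ENNReal.ofReal ((v (G.mul ξ η) - v ξ) ^ 2)) ∂μ := by
          refine lintegral_mono fun ξ => ?_
          rw [← mul_assoc']
          have h2 : (2 : ℝ≥0∞) = ENNReal.ofReal 2 := by simp
          rw [h2, ← ENNReal.ofReal_mul (by norm_num), ← ENNReal.ofReal_mul (by norm_num),
            ← ENNReal.ofReal_add (by positivity) (by positivity)]
          refine ENNReal.ofReal_le_ofReal ?_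
          nlinarith [sq_nonneg (v (G.mul (G.mul ξ η) (G.expX i t)) - v (G.mul ξ η) -
            (v (G.mul ξ η) - v ξ))]
      _ = 2 * ∫⁻ ξ, ENNReal.ofReal ((v (G.mul ξ (G.expX i t)) - v ξ) ^ 2) ∂μ +
            2 * ∫⁻ ξ, ENNReal.ofReal ((v (G.mul ξ η) - v ξ) ^ 2) ∂μ := by
          rw [lintegral_add_left (hm3.const_mul 2), lintegral_const_mul _ hm3,
            lintegral_const_mul _ hm2]
          congr 2
          exact hμ.lintegral_mul_right η hm1
      _ ≤ 2 * (ENNReal.ofReal (r ^ 2) * D) + 2 * (ENNReal.ofReal (4 ^ n * r ^ 2) * D) := by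
          gcongr
          · exact (hμ.lintegral_sq_sub_expX_le hv i t).trans
              (mul_le_mul' (ENNReal.ofReal_le_ofReal ht2) hX)
          · exact ih hη
      _ = ENNReal.ofReal (2 * r ^ 2 + 2 * (4 ^ n * r ^ 2)) * D := by
          rw [ENNReal.ofReal_add (by positivity) (by positivity), ENNReal.ofReal_mul (p := 2) (q := r ^ 2)
            (by norm_num), ENNReal.ofReal_mul (p := 2) (q := 4 ^ n * r ^ 2) (by norm_num)]
          simp only [ENNReal.ofReal_ofNat]
          ring
      _ ≤ _ := by
          gcongr
          have : (1 : ℝ) ≤ 4 ^ n := one_le_pow₀ (by norm_num)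
          rw [pow_succ (4 : ℝ) n]
          nlinarith [sq_nonneg r]

theorem isCompact_horizontalProducts (n : ℕ) (r : ℝ) : IsCompact (G.horizontalProducts n r) := by
  induction n with
  | zero => exact isCompact_singleton
  | succ n ih =>
    have : G.horizontalProducts (n + 1) r = ⋃ i : Fin G.rank,
        (fun p : Coord m × ℝ => G.mul p.1 (G.expX i p.2)) ''
          (G.horizontalProducts n r ×ˢ Set.Icc (-r) r) := by
      ext ζ
      simp only [horizontalProducts, Set.mem_ofPred_eq, Set.mem_iUnion, Set.mem_image,
        Set.mem_prod, Set.mem_Icc, Prod.exists, ← abs_le]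
      constructor
      · rintro ⟨ξ, hξ, i, t, ht, rfl⟩
        exact ⟨i, ξ, t, ⟨hξ, ht⟩, rfl⟩
      · rintro ⟨i, ξ, t, ⟨hξ, ht⟩, rfl⟩
        exact ⟨ξ, hξ, i, t, ht, rfl⟩
    rw [this]
    exact isCompact_iUnion fun i => (ih.prod isCompact_Icc).image (G.continuous_mul_expX i)

theorem dilation_mem_horizontalProducts {a : ℝ} (ha : 0 ≤ a) {n : ℕ} {r : ℝ} {ξ : Coord m}
    (hξ : ξ ∈ G.horizontalProducts n r) : G.dilation a ξ ∈ G.horizontalProducts n (a * r) := by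
  induction n generalizing ξ with
  | zero =>
    rw [show ξ = 0 from hξ, map_zero]
    rfl
  | succ n ih =>
    obtain ⟨ξ, hξ, i, t, ht, rfl⟩ := hξ
    refine ⟨_, ih hξ, i, a * t, ?_, ?_⟩
    · rw [abs_mul, abs_of_nonneg ha]
      exact mul_le_mul_of_nonneg_left ht ha
    · rw [dilation_mul, dilation_expX]

theorem IsHaar.exists_horizontalProducts_measure_pos (hμ : G.IsHaar μ) :
    ∃ n r, 0 < μ (G.horizontalProducts n r) := by
  by_contra! h
  refine hμ.ne_zero ?_
  rw [← Measure.measure_univ_eq_zero, ← G.iUnion_horizontalProducts, measure_iUnion_null_iff]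
  intro p
  exact le_antisymm (h _ _) bot_le

/-- A Nash-type inequality. -/
theorem IsHaar.measure_mul_lintegral_sq_le (hμ : G.IsHaar μ) {v : Coord m → ℝ}
    (hv : ContDiff ℝ 1 v) (hv0 : ∀ ξ, 0 ≤ v ξ) {n : ℕ} {r : ℝ} {A : Set (Coord m)}
    (hA : MeasurableSet A) (hAr : A ⊆ G.horizontalProducts n r) :
    μ A * ∫⁻ ξ, ENNReal.ofReal (v ξ ^ 2) ∂μ ≤
      μ A * (ENNReal.ofReal (4 ^ n * r ^ 2) * ∫⁻ ξ, ENNReal.ofReal (G.gradSq v ξ) ∂μ) +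
        2 * (∫⁻ ξ, ENNReal.ofReal (v ξ) ∂μ) ^ 2 := by
  have := hμ.sigmaFinite
  have hvc := hv.continuous
  have hvm := hvc.measurable.ennreal_ofReal
  set D := ENNReal.ofReal (4 ^ n * r ^ 2) * ∫⁻ ξ, ENNReal.ofReal (G.gradSq v ξ) ∂μ with hD
  have hmul : Continuous fun p : Coord m × Coord m => G.mul p.1 p.2 :=
    G.continuous_mul continuous_fst continuous_snd
  -- Pointwise, v(ξ)² ≤ (v(ξη) - v(ξ))² + 2 v(ξ) v(ξη); the two sides differ by v(ξη)².
  have hpt : ∀ η ∈ A, ∫⁻ ξ, ENNReal.ofReal (v ξ ^ 2) ∂μ ≤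
      D + 2 * ∫⁻ ξ, ENNReal.ofReal (v ξ) * ENNReal.ofReal (v (G.mul ξ η)) ∂μ := by
    intro η hη
    have hm1 : Measurable fun ξ => ENNReal.ofReal ((v (G.mul ξ η) - v ξ) ^ 2) :=
      (((hvc.comp (continuous_mul_right _)).sub hvc).pow 2).measurable.ennreal_ofReal
    have hm2 : Measurable fun ξ => ENNReal.ofReal (v ξ) * ENNReal.ofReal (v (G.mul ξ η)) :=
      hvm.mul (hvm.comp (continuous_mul_right η).measurable)
    calc ∫⁻ ξ, ENNReal.ofReal (v ξ ^ 2) ∂μ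
        ≤ ∫⁻ ξ, (ENNReal.ofReal ((v (G.mul ξ η) - v ξ) ^ 2) +
          2 * (ENNReal.ofReal (v ξ) * ENNReal.ofReal (v (G.mul ξ η)))) ∂μ := by
          refine lintegral_mono fun ξ => ?_
          have h2 : (2 : ℝ≥0∞) = ENNReal.ofReal 2 := by simp
          have := mul_nonneg (hv0 ξ) (hv0 (G.mul ξ η))
          rw [h2, ← ENNReal.ofReal_mul (hv0 ξ), ← ENNReal.ofReal_mul (by norm_num),
            ← ENNReal.ofReal_add (by positivity) (by positivity)]
          refine ENNReal.ofReal_le_ofReal ?_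
          nlinarith [sq_nonneg (v (G.mul ξ η))]
      _ = ∫⁻ ξ, ENNReal.ofReal ((v (G.mul ξ η) - v ξ) ^ 2) ∂μ +
          2 * ∫⁻ ξ, ENNReal.ofReal (v ξ) * ENNReal.ofReal (v (G.mul ξ η)) ∂μ := by
          rw [lintegral_add_left hm1, lintegral_const_mul _ hm2]
      _ ≤ _ := by
          gcongr
          exact hμ.lintegral_sq_sub_le hv (hAr hη)
  -- Enlarging A to the whole group and integrating first in η, left invariance produces the square
  -- of the L¹ norm.
  have hcross : ∫⁻ η in A, ∫⁻ ξ, ENNReal.ofReal (v ξ) * ENNReal.ofReal (v (G.mul ξ η)) ∂μ ∂μ ≤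
      (∫⁻ ξ, ENNReal.ofReal (v ξ) ∂μ) ^ 2 := by
    calc ∫⁻ η in A, ∫⁻ ξ, ENNReal.ofReal (v ξ) * ENNReal.ofReal (v (G.mul ξ η)) ∂μ ∂μ
        ≤ ∫⁻ η, ∫⁻ ξ, ENNReal.ofReal (v ξ) * ENNReal.ofReal (v (G.mul ξ η)) ∂μ ∂μ :=
          setLIntegral_le_lintegral _ _
      _ = ∫⁻ ξ, ∫⁻ η, ENNReal.ofReal (v ξ) * ENNReal.ofReal (v (G.mul ξ η)) ∂μ ∂μ := by
          rw [lintegral_lintegral_swap]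
          exact ((hvm.comp measurable_snd).mul (hvm.comp
            (hmul.comp (continuous_snd.prodMk continuous_fst)).measurable)).aemeasurable
      _ = ∫⁻ ξ, ENNReal.ofReal (v ξ) * ∫⁻ η, ENNReal.ofReal (v η) ∂μ ∂μ := by
          refine lintegral_congr fun ξ => ?_
          have hm : Measurable fun η => ENNReal.ofReal (v (G.mul ξ η)) :=
            hvm.comp (continuous_mul_left ξ).measurable
          rw [lintegral_const_mul _ hm]
          congr 1
          exact hμ.lintegral_mul_left ξ hvm
      _ = _ := by
          rw [lintegral_mul_const _ hvm, sq]
  calc μ A * ∫⁻ ξ, ENNReal.ofReal (v ξ ^ 2) ∂μ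
      = ∫⁻ _ in A, ∫⁻ ξ, ENNReal.ofReal (v ξ ^ 2) ∂μ ∂μ := by
        rw [setLIntegral_const, mul_comm]
    _ ≤ ∫⁻ η in A, (D + 2 * ∫⁻ ξ, ENNReal.ofReal (v ξ) * ENNReal.ofReal (v (G.mul ξ η)) ∂μ) ∂μ :=
        setLIntegral_mono' hA hpt
    _ = μ A * D +
        2 * ∫⁻ η in A, ∫⁻ ξ, ENNReal.ofReal (v ξ) * ENNReal.ofReal (v (G.mul ξ η)) ∂μ ∂μ := by
        rw [lintegral_add_left measurable_const, setLIntegral_const, mul_comm D,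
          lintegral_const_mul' _ _ (by norm_num)]
    _ ≤ _ := by gcongr

theorem sq_lintegral_le_measure_mul {v : Coord m → ℝ} (hv : Continuous v) (hv0 : ∀ ξ, 0 ≤ v ξ)
    {S : ℝ≥0∞} (hS : μ {ξ | v ξ ≠ 0} ≤ S) :
    (∫⁻ ξ, ENNReal.ofReal (v ξ) ∂μ) ^ 2 ≤ S * ∫⁻ ξ, ENNReal.ofReal (v ξ ^ 2) ∂μ := by
  have hvm := hv.measurable.ennreal_ofReal
  have hset : MeasurableSet {ξ | v ξ ≠ 0} := (isOpen_ne_fun hv continuous_const).measurableSet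
  have h := ENNReal.lintegral_mul_le_Lp_mul_Lq μ Real.HolderConjugate.two_two
    (f := {ξ | v ξ ≠ 0}.indicator fun _ => 1) (g := fun ξ => ENNReal.ofReal (v ξ))
    (measurable_const.indicator hset).aemeasurable hvm.aemeasurable
  have e1 : ∫⁻ ξ, (({ξ | v ξ ≠ 0}.indicator fun _ => (1 : ℝ≥0∞)) *
      fun ξ => ENNReal.ofReal (v ξ)) ξ ∂μ = ∫⁻ ξ, ENNReal.ofReal (v ξ) ∂μ := by
    refine lintegral_congr fun ξ => ?_
    by_cases hξ : v ξ = 0 <;> simp [hξ]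
  have e2 : ∫⁻ ξ, ({ξ | v ξ ≠ 0}.indicator (fun _ => (1 : ℝ≥0∞)) ξ) ^ (2 : ℝ) ∂μ =
      μ {ξ | v ξ ≠ 0} := by
    rw [← lintegral_indicator_one hset]
    refine lintegral_congr fun ξ => ?_
    by_cases hξ : v ξ = 0 <;> simp [hξ]
  have e3 : ∫⁻ ξ, ENNReal.ofReal (v ξ) ^ (2 : ℝ) ∂μ = ∫⁻ ξ, ENNReal.ofReal (v ξ ^ 2) ∂μ := by
    refine lintegral_congr fun ξ => ?_
    rw [ENNReal.ofReal_pow (hv0 ξ)]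
    norm_cast
  rw [e1, e2, e3] at h
  calc (∫⁻ ξ, ENNReal.ofReal (v ξ) ∂μ) ^ 2
      ≤ (μ {ξ | v ξ ≠ 0} ^ (1 / 2 : ℝ) *
        (∫⁻ ξ, ENNReal.ofReal (v ξ ^ 2) ∂μ) ^ (1 / 2 : ℝ)) ^ 2 := by gcongr
    _ = μ {ξ | v ξ ≠ 0} * ∫⁻ ξ, ENNReal.ofReal (v ξ ^ 2) ∂μ := by
        rw [mul_pow, ← ENNReal.rpow_natCast, ← ENNReal.rpow_natCast, ← ENNReal.rpow_mul,
          ← ENNReal.rpow_mul]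
        norm_num
    _ ≤ _ := by gcongr

theorem homDim_pos (G : CarnotGroup 𝔤 s m) : 0 < G.homDim := by
  by_contra h
  have h0 : ∑ l : Fin s, ((l : ℕ) + 1) * m l = 0 := by
    have : G.homDim = 0 := by omega
    exact this
  rw [Finset.sum_eq_zero_iff] at h0
  have h1s := G.one_le_step
  have hm : m ⟨s - 1, by omega⟩ = 0 := by
    have := h0 ⟨s - 1, by omega⟩ (Finset.mem_univ _)
    simpa using this
  refine G.top_ne_bot ?_
  rw [eq_bot_iff]
  intro z hz
  rw [← G.homogeneous_eq_layer h1s le_rfl] at hz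
  rw [Submodule.mem_bot, ← G.toLie.symm.map_eq_zero_iff]
  ext j
  by_cases hj : (j.1 : ℕ) + 1 = s
  · have hj' : j.1 = ⟨s - 1, by omega⟩ := Fin.ext (by simp; omega)
    have := j.2
    rw [hj', hm] at this
    exact this.elim0
  · exact hz j hj

/-- **Faber-Krahn inequality.** -/
theorem IsHaar.exists_faberKrahn (hμ : G.IsHaar μ) : ∃ C : ℝ, 0 < C ∧ ∀ (v : Coord m → ℝ) (S : ℝ),
    ContDiff ℝ 1 v → (∀ ξ, 0 ≤ v ξ) → 0 < S → μ {ξ | v ξ ≠ 0} ≤ ENNReal.ofReal S →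
    ∫⁻ ξ, ENNReal.ofReal (v ξ ^ 2) ∂μ ≠ ∞ →
    ∫⁻ ξ, ENNReal.ofReal (v ξ ^ 2) ∂μ ≤
      ENNReal.ofReal (C * S ^ (2 / (G.homDim : ℝ))) * ∫⁻ ξ, ENNReal.ofReal (G.gradSq v ξ) ∂μ := by
  obtain ⟨n, r₀, hpos⟩ := hμ.exists_horizontalProducts_measure_pos
  set A := G.horizontalProducts n r₀ with hA
  have hAc : IsCompact A := isCompact_horizontalProducts n r₀
  have hAfin : μ A ≠ ∞ := (hμ.finite_of_isCompact A hAc).ne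
  set a := (μ A).toReal with ha
  have ha0 : 0 < a := ENNReal.toReal_pos hpos.ne' hAfin
  have hAa : μ A = ENNReal.ofReal a := (ENNReal.ofReal_toReal hAfin).symm
  have hQ : 0 < G.homDim := homDim_pos G
  have hQr : (0 : ℝ) < G.homDim := by exact_mod_cast hQ
  -- Adding 1 to r₀² makes the constant positive whatever r₀ is.
  refine ⟨2 * (4 ^ n * (r₀ ^ 2 + 1)) * (4 / a) ^ (2 / (G.homDim : ℝ)), by positivity, ?_⟩
  intro v S hv hv0 hS hvS hfin
  set I := ∫⁻ ξ, ENNReal.ofReal (v ξ ^ 2) ∂μ with hI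
  set D := ∫⁻ ξ, ENNReal.ofReal (G.gradSq v ξ) ∂μ with hD
  -- The dilate of A by this r has measure 4S. The Nash-type inequality then reads 4S‖v‖₂² ≤ 4S·E +
  -- 2‖v‖₁² with ‖v‖₁² ≤ S‖v‖₂², so the last term is absorbed on the left. This cancellation is
  -- where finiteness of ‖v‖₂ is needed.
  set r : ℝ := (4 * S / a) ^ (1 / (G.homDim : ℝ)) with hr
  have hr0 : 0 < r := by positivity
  have hrQ : r ^ G.homDim = 4 * S / a := by
    rw [hr, ← Real.rpow_natCast, ← Real.rpow_mul (by positivity), one_div,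
      inv_mul_cancel₀ hQr.ne', Real.rpow_one]
  have hr2 : r ^ 2 = (4 / a) ^ (2 / (G.homDim : ℝ)) * S ^ (2 / (G.homDim : ℝ)) := by
    rw [← Real.mul_rpow (by positivity) hS.le, hr, ← Real.rpow_natCast, ← Real.rpow_mul
      (by positivity)]
    congr 1
    · ring
    · push_cast
      ring
  have hB : μ (G.dilation r '' A) = ENNReal.ofReal (4 * S) := by
    rw [hμ.measure_dilation_image hr0.le, hrQ, hAa, ← ENNReal.ofReal_mul (by positivity),
      div_mul_cancel₀ _ ha0.ne']
  have hBm : MeasurableSet (G.dilation r '' A) :=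
    (hAc.image (G.contDiff_dilation r (n := 0)).continuous).measurableSet
  have hsub : G.dilation r '' A ⊆ G.horizontalProducts n (r * r₀) := by
    rintro _ ⟨ξ, hξ, rfl⟩
    exact dilation_mem_horizontalProducts hr0.le hξ
  have hnash := hμ.measure_mul_lintegral_sq_le hv hv0 hBm hsub
  have hcs := sq_lintegral_le_measure_mul hv.continuous hv0 hvS
  rw [hB, ← hI, ← hD] at hnash
  rw [← hI] at hcs
  have h4S : ENNReal.ofReal (4 * S) = 2 * (2 * ENNReal.ofReal S) := by
    rw [← mul_assoc, show (2 * 2 : ℝ≥0∞) = ENNReal.ofReal 4 by norm_num, ENNReal.ofReal_mul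
      (by norm_num)]
  have hc0 : 2 * ENNReal.ofReal S ≠ 0 := by simp [hS]
  have hct : 2 * ENNReal.ofReal S ≠ ∞ := by finiteness
  set E := ENNReal.ofReal (4 ^ n * (r * r₀) ^ 2) * D with hE
  have h1 : (2 * ENNReal.ofReal S) * (2 * I) ≤ (2 * ENNReal.ofReal S) * (2 * E + I) := by
    calc (2 * ENNReal.ofReal S) * (2 * I) = ENNReal.ofReal (4 * S) * I := by rw [h4S]; ring
      _ ≤ _ := hnash
      _ ≤ ENNReal.ofReal (4 * S) * E + 2 * (ENNReal.ofReal S * I) := by gcongr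
      _ = _ := by rw [h4S]; ring
  have h2 : 2 * I ≤ 2 * E + I := (ENNReal.mul_le_mul_iff_right hc0 hct).1 h1
  have h3 : I ≤ 2 * E := by
    rw [two_mul I] at h2
    exact (ENNReal.add_le_add_iff_right hfin).1 h2
  refine h3.trans ?_
  rw [hE, ← mul_assoc]
  gcongr
  rw [show (2 : ℝ≥0∞) = ENNReal.ofReal 2 by simp, ← ENNReal.ofReal_mul (by norm_num)]
  refine ENNReal.ofReal_le_ofReal ?_
  rw [mul_pow, hr2]
  have hpow : 0 ≤ (4 / a) ^ (2 / (G.homDim : ℝ)) * S ^ (2 / (G.homDim : ℝ)) := by positivity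
  have h4n : (0 : ℝ) < 4 ^ n := by positivity
  nlinarith [mul_nonneg hpow h4n.le]

end CarnotGroup

end

noncomputable section

/-! ### Powers of the positive part -/

theorem hasDerivAt_max_zero_pow (n : ℕ) (τ : ℝ) :
    HasDerivAt (fun τ : ℝ => max τ 0 ^ (n + 2)) ((n + 2) * max τ 0 ^ (n + 1)) τ := by
  rcases lt_trichotomy τ 0 with h | rfl | h
  · rw [max_eq_right h.le, zero_pow (by omega), mul_zero]
    refine (hasDerivAt_const τ (0 : ℝ)).congr_of_eventuallyEq ?_
    filter_upwards [gt_mem_nhds h] with σ hσ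
    rw [max_eq_right hσ.le, zero_pow (by omega)]
  · rw [max_self, zero_pow (by omega), mul_zero, hasDerivAt_iff_tendsto_slope]
    have hc : Continuous fun σ : ℝ => max σ 0 ^ (n + 1) := by fun_prop
    have h := hc.tendsto 0
    simp only [max_self] at h
    rw [zero_pow (by omega)] at h
    refine (h.mono_left nhdsWithin_le_nhds).congr' ?_
    filter_upwards [self_mem_nhdsWithin] with σ hσ
    have hσ' : σ ≠ 0 := hσ
    simp only [slope, vsub_eq_sub, sub_zero, smul_eq_mul, max_self]
    rw [zero_pow (by omega), sub_zero]
    rcases le_total σ 0 with h0 | h0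
    · rw [max_eq_right h0, zero_pow (by omega), zero_pow (by omega), mul_zero]
    · rw [max_eq_left h0, pow_succ _ (n + 1)]
      field_simp
  · rw [max_eq_left h.le]
    have h1 := hasDerivAt_pow (n + 2) τ
    push_cast at h1
    refine h1.congr_of_eventuallyEq ?_
    filter_upwards [lt_mem_nhds h] with σ hσ
    rw [max_eq_left hσ.le]

/-- Each derivative lowers the exponent by one, down to the continuous function τ⁺. Powers of
truncations are thus classical test functions. -/
theorem contDiff_max_zero_pow (n : ℕ) : ContDiff ℝ n fun τ : ℝ => max τ 0 ^ (n + 1) := by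
  induction n with
  | zero =>
    rw [Nat.cast_zero, contDiff_zero]
    fun_prop
  | succ n ih =>
    push_cast
    rw [contDiff_succ_iff_deriv]
    refine ⟨fun τ => (hasDerivAt_max_zero_pow n τ).differentiableAt, ?_, ?_⟩
    · intro h
      exact absurd h (by simp)
    · rw [show deriv (fun τ : ℝ => max τ 0 ^ (n + 1 + 1)) =
        fun τ => ((n : ℝ) + 2) * max τ 0 ^ (n + 1) from
          funext fun τ => (hasDerivAt_max_zero_pow n τ).deriv]
      exact contDiff_const.mul ih

namespace CarnotGroup

open Filter Topology

variable {𝔤 : Type*} [LieRing 𝔤] [LieAlgebra ℝ 𝔤] {s : ℕ} {m : Fin s → ℕ}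
  {G : CarnotGroup 𝔤 s m}

attribute [local irreducible] CarnotGroup.mul

/-! ### Truncations -/

/-- The function `(u - k)⁺`, extended by zero outside `Ω`. -/
def excess (Ω : Set (Coord m)) (u : Coord m → ℝ) (k : ℝ) : Coord m → ℝ :=
  Ω.indicator fun ξ => max (u ξ - k) 0

section

variable {Ω : Set (Coord m)} {u : Coord m → ℝ} {k : ℝ}

theorem excess_of_mem {ξ : Coord m} (h : ξ ∈ Ω) : excess Ω u k ξ = max (u ξ - k) 0 :=
  Set.indicator_of_mem h _

theorem excess_of_notMem {ξ : Coord m} (h : ξ ∉ Ω) : excess Ω u k ξ = 0 :=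
  Set.indicator_of_notMem h _

theorem excess_nonneg (ξ : Coord m) : 0 ≤ excess Ω u k ξ :=
  Set.indicator_nonneg (fun _ _ => le_max_right _ _) ξ

theorem excess_eventuallyEq (hΩ : IsOpen Ω) {ξ : Coord m} (h : ξ ∈ Ω) :
    excess Ω u k =ᶠ[𝓝 ξ] fun η => max (u η - k) 0 := by
  filter_upwards [hΩ.mem_nhds h] with η hη
  exact excess_of_mem hη

/-- The strict inequality u < k on the boundary persists nearby, so the truncation vanishes in a
full neighbourhood of each point outside Ω and its extension by zero stays smooth. -/
theorem excess_eventuallyEq_zero (hΩ : IsOpen Ω) (hu : ContinuousOn u (closure Ω))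
    (hk : ∀ ξ ∈ frontier Ω, u ξ < k) {ξ : Coord m} (h : ξ ∉ Ω) :
    excess Ω u k =ᶠ[𝓝 ξ] fun _ => 0 := by
  by_cases hc : ξ ∈ closure Ω
  · have hf : ξ ∈ frontier Ω := ⟨hc, by rwa [hΩ.interior_eq]⟩
    have h1 := (hu ξ hc).eventually_lt_const (hk ξ hf)
    rw [eventually_nhdsWithin_iff] at h1
    filter_upwards [h1] with η hη
    by_cases hηΩ : η ∈ Ω
    · rw [excess_of_mem hηΩ, max_eq_right]
      linarith [hη (subset_closure hηΩ)]
    · exact excess_of_notMem hηΩ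
  · filter_upwards [isClosed_closure.isOpen_compl.mem_nhds hc] with η hη
    exact excess_of_notMem fun h => hη (subset_closure h)

theorem contDiff_excess_pow (hΩ : IsOpen Ω) (hu2 : ContDiffOn ℝ 2 u Ω)
    (hu : ContinuousOn u (closure Ω)) (hk : ∀ ξ ∈ frontier Ω, u ξ < k) {n p : ℕ} (hn : n ≤ 2)
    (hp : n < p) : ContDiff ℝ n fun ξ => excess Ω u k ξ ^ p := by
  rw [contDiff_iff_contDiffAt]
  intro ξ
  by_cases h : ξ ∈ Ω
  · have h1 : ContDiffAt ℝ n u ξ :=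
      (hu2.contDiffAt (hΩ.mem_nhds h)).of_le (by exact_mod_cast hn)
    obtain ⟨p, rfl⟩ : ∃ p', p = p' + 1 := ⟨p - 1, by omega⟩
    have h3 : ContDiff ℝ n fun τ : ℝ => max τ 0 ^ (p + 1) :=
      (contDiff_max_zero_pow p).of_le (by exact_mod_cast Nat.le_of_lt_succ hp)
    have h2 : ContDiffAt ℝ n (fun η => max (u η - k) 0 ^ (p + 1)) ξ :=
      h3.contDiffAt.comp ξ (h1.sub contDiffAt_const)
    refine h2.congr_of_eventuallyEq ?_
    filter_upwards [excess_eventuallyEq hΩ h] with η hη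
    rw [hη]
  · have h2 : ContDiffAt ℝ n (fun _ : Coord m => (0 : ℝ)) ξ := contDiffAt_const
    refine h2.congr_of_eventuallyEq ?_
    filter_upwards [excess_eventuallyEq_zero hΩ hu hk h] with η hη
    rw [hη, zero_pow (by omega)]

theorem X_excess_pow (hΩ : IsOpen Ω) (hu2 : ContDiffOn ℝ 2 u Ω) (n : ℕ) {ξ : Coord m}
    (h : ξ ∈ Ω) (i : Fin G.rank) : G.X i (fun ξ => excess Ω u k ξ ^ (n + 2)) ξ =
      (n + 2) * max (u ξ - k) 0 ^ (n + 1) * G.X i u ξ := by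
  have h1 : (fun ξ => excess Ω u k ξ ^ (n + 2)) =ᶠ[𝓝 ξ] fun η => max (u η - k) 0 ^ (n + 2) := by
    filter_upwards [excess_eventuallyEq hΩ h] with η hη
    rw [hη]
  have hd : DifferentiableAt ℝ u ξ :=
    (hu2.contDiffAt (hΩ.mem_nhds h)).differentiableAt two_ne_zero
  rw [X_congr h1]
  exact X_comp hd (θ := fun τ => max (τ - k) 0 ^ (n + 2))
    ((hasDerivAt_max_zero_pow n (u ξ - k)).comp_sub_const (u ξ) k) i

/-- For w = (u - k)⁺, the chain rule gives L(w⁴) = 12w²|∇u|² + 4w³Lu, and |∇(w²)|² = 4w²|∇u|². -/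
theorem subLaplacian_excess_pow (hΩ : IsOpen Ω) (hu2 : ContDiffOn ℝ 2 u Ω)
    (hu : ContinuousOn u (closure Ω)) (hk : ∀ ξ ∈ frontier Ω, u ξ < k) (ξ : Coord m) :
    G.subLaplacian (fun ξ => excess Ω u k ξ ^ 4) ξ =
      3 * G.gradSq (fun ξ => excess Ω u k ξ ^ 2) ξ +
        4 * excess Ω u k ξ ^ 3 * G.subLaplacian u ξ := by
  by_cases h : ξ ∈ Ω
  · rw [subLaplacian, gradSq, subLaplacian, Finset.mul_sum, Finset.mul_sum,
      ← Finset.sum_add_distrib]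
    refine Finset.sum_congr rfl fun i _ => ?_
    have hev : G.X i (fun ξ => excess Ω u k ξ ^ 4) =ᶠ[𝓝 ξ]
        fun η => 4 * max (u η - k) 0 ^ 3 * G.X i u η := by
      filter_upwards [hΩ.mem_nhds h] with η hη
      rw [X_excess_pow hΩ hu2 2 hη i]
      norm_num
    have hd : DifferentiableAt ℝ u ξ :=
      (hu2.contDiffAt (hΩ.mem_nhds h)).differentiableAt two_ne_zero
    have hdX : DifferentiableAt ℝ (G.X i u) ξ :=
      ((contDiffOn_X hΩ hu2 i).contDiffAt (hΩ.mem_nhds h)).differentiableAt one_ne_zero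
    have hθ : HasDerivAt (fun τ : ℝ => 4 * max (τ - k) 0 ^ 3)
        (4 * (((1 : ℕ) + 2 : ℝ) * max (u ξ - k) 0 ^ 2)) (u ξ) :=
      ((hasDerivAt_max_zero_pow 1 (u ξ - k)).comp_sub_const (u ξ) k).const_mul 4
    have hd3 : DifferentiableAt ℝ (fun η => 4 * max (u η - k) 0 ^ 3) ξ :=
      DifferentiableAt.comp (g := fun τ : ℝ => 4 * max (τ - k) 0 ^ 3) ξ hθ.differentiableAt hd
    rw [X_congr hev, X_mul hd3 hdX,
      X_comp hd (θ := fun τ : ℝ => 4 * max (τ - k) 0 ^ 3) hθ, X_excess_pow hΩ hu2 0 h i,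
      excess_of_mem h]
    push_cast
    ring
  · have h0 := excess_eventuallyEq_zero hΩ hu hk h
    have h4 : (fun ξ => excess Ω u k ξ ^ 4) =ᶠ[𝓝 ξ] fun _ => 0 := by
      filter_upwards [h0] with η hη
      rw [hη, zero_pow four_ne_zero]
    have h2 : (fun ξ => excess Ω u k ξ ^ 2) =ᶠ[𝓝 ξ] fun _ => 0 := by
      filter_upwards [h0] with η hη
      rw [hη, zero_pow two_ne_zero]
    rw [subLaplacian_congr h4, excess_of_notMem h]
    simp only [subLaplacian, gradSq, X_congr h2, X_const]
    simp

end

/-! ### Cutoff functions -/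

variable (G) in
theorem exists_cutoff : ∃ (χ : Coord m → ℝ) (B : ℝ), ContDiff ℝ 2 χ ∧ HasCompactSupport χ ∧
    (∀ ξ, 0 ≤ χ ξ) ∧ (∀ ξ, χ ξ ≤ 1) ∧ χ 0 = 1 ∧ ∀ ξ, |G.subLaplacian χ ξ| ≤ B := by
  let b : ContDiffBump (0 : Coord m) := ⟨1, 2, one_pos, one_lt_two⟩
  have hb : ContDiff ℝ 2 b := b.contDiff
  have hc : HasCompactSupport b := b.hasCompactSupport
  have hL : HasCompactSupport (G.subLaplacian b) := by
    refine HasCompactSupport.of_support_subset_isCompact hc ?_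
    intro ξ hξ
    by_contra h
    refine hξ ?_
    have h0 : (b : Coord m → ℝ) =ᶠ[𝓝 ξ] fun _ => 0 := notMem_tsupport_iff_eventuallyEq.1 h
    rw [subLaplacian_congr h0]
    simp only [subLaplacian, X_const]
    simp
  obtain ⟨B, hB⟩ := hL.exists_bound_of_continuous (continuous_subLaplacian hb)
  refine ⟨b, B, hb, hc, fun ξ => b.nonneg, fun ξ => b.le_one, ?_, hB⟩
  exact b.one_of_mem_closedBall (by simp [b])

theorem tendsto_dilation_zero (ξ : Coord m) : Tendsto (fun a => G.dilation a ξ) (𝓝 0) (𝓝 0) := by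
  rw [tendsto_pi_nhds]
  intro j
  simp only [dilation_apply]
  have hc : Continuous fun a : ℝ => a ^ ((j.1 : ℕ) + 1) * ξ j := by fun_prop
  have := hc.tendsto 0
  simpa using this

theorem hasCompactSupport_comp_dilation {χ : Coord m → ℝ} (hχ : HasCompactSupport χ) {a : ℝ}
    (ha : 0 < a) : HasCompactSupport fun ξ => χ (G.dilation a ξ) := by
  refine HasCompactSupport.of_support_subset_isCompact
    (K := G.dilation a⁻¹ '' tsupport χ)
    (IsCompact.image hχ (G.contDiff_dilation a⁻¹ (n := 0)).continuous) ?_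
  intro ξ hξ
  refine ⟨G.dilation a ξ, subset_tsupport _ hξ, ?_⟩
  rw [dilation_dilation, inv_mul_cancel₀ ha.ne', dilation_one]

/-! ### The energy estimate -/

variable {μ : Measure (Coord m)}

/-- The formula for L(w⁴) is multiplied by χ and integrated, and Green's identity moves L onto χ.
The error ∫ w⁴ Lχ is at most M⁴B μ(Ω), while 0 ≤ χ ≤ 1 gives χ Lu ≥ -F almost everywhere in Ω. -/
theorem IsHaar.integral_cutoff_mul_gradSq_le (hμ : G.IsHaar μ) {Ω : Set (Coord m)}
    {u : Coord m → ℝ} {k : ℝ} (hΩ : IsOpen Ω) (hΩμ : μ Ω < ∞) (hu2 : ContDiffOn ℝ 2 u Ω)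
    (hu : ContinuousOn u (closure Ω)) (hk : ∀ ξ ∈ frontier Ω, u ξ < k) {M F : ℝ}
    (hM : ∀ ξ, excess Ω u k ξ ≤ M) (hF0 : 0 ≤ F)
    (hF : ∀ᵐ ξ ∂(μ.restrict Ω), |G.subLaplacian u ξ| ≤ F)
    {χ : Coord m → ℝ} {B : ℝ} (hχ : ContDiff ℝ 2 χ) (hχc : HasCompactSupport χ)
    (hχ0 : ∀ ξ, 0 ≤ χ ξ) (hχ1 : ∀ ξ, χ ξ ≤ 1) (hB : ∀ ξ, |G.subLaplacian χ ξ| ≤ B) :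
    ∫ ξ, χ ξ * (3 * G.gradSq (fun ξ => excess Ω u k ξ ^ 2) ξ) ∂μ ≤
      M ^ 4 * B * μ.real Ω + ∫ ξ, 4 * F * excess Ω u k ξ ^ 3 ∂μ := by
  have := hμ.isFiniteMeasureOnCompacts
  have hP : ContDiff ℝ 2 fun ξ => excess Ω u k ξ ^ 4 :=
    contDiff_excess_pow hΩ hu2 hu hk (n := 2) le_rfl (by norm_num)
  have hv : ContDiff ℝ 1 fun ξ => excess Ω u k ξ ^ 2 := by
    simpa using contDiff_excess_pow hΩ hu2 hu hk (n := 1) (p := 2) one_le_two one_lt_two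
  have hw : Continuous (excess Ω u k) := by
    have := (contDiff_excess_pow hΩ hu2 hu hk (n := 0) (p := 1) zero_le_two
      one_pos).continuous
    simpa using this
  have hint1 : Integrable (fun ξ => χ ξ * G.subLaplacian (fun ξ => excess Ω u k ξ ^ 4) ξ) μ :=
    (hχ.continuous.mul (continuous_subLaplacian hP)).integrable_of_hasCompactSupport
      hχc.mul_right
  have hint2 : Integrable (fun ξ => χ ξ * (3 * G.gradSq (fun ξ => excess Ω u k ξ ^ 2) ξ)) μ :=
    (hχ.continuous.mul (continuous_const.mul
      (continuous_gradSq hv))).integrable_of_hasCompactSupport hχc.mul_right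
  have hind : ∀ c : ℝ, Integrable (Ω.indicator fun _ => c) μ := fun c =>
    (integrable_indicator_iff hΩ.measurableSet).2 (integrableOn_const hΩμ.ne)
  have hint3 : Integrable (fun ξ => 4 * F * excess Ω u k ξ ^ 3) μ := by
    refine Integrable.const_mul ?_ _
    refine (hind (M ^ 3)).mono' (hw.pow 3).aestronglyMeasurable (Eventually.of_forall fun ξ => ?_)
    rw [Real.norm_of_nonneg (pow_nonneg (excess_nonneg ξ) 3)]
    by_cases h : ξ ∈ Ω
    · rw [Set.indicator_of_mem h]
      exact pow_le_pow_left₀ (excess_nonneg ξ) (hM ξ) 3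
    · rw [Set.indicator_of_notMem h, excess_of_notMem h, zero_pow three_ne_zero]
  have hPle : ∀ ξ, ‖excess Ω u k ξ ^ 4 * G.subLaplacian χ ξ‖ ≤
      Ω.indicator (fun _ => M ^ 4 * B) ξ := by
    intro ξ
    by_cases h : ξ ∈ Ω
    · rw [Set.indicator_of_mem h, norm_mul, Real.norm_of_nonneg (pow_nonneg (excess_nonneg ξ) 4)]
      exact mul_le_mul (pow_le_pow_left₀ (excess_nonneg ξ) (hM ξ) 4) (hB ξ) (norm_nonneg _)
        (pow_nonneg ((excess_nonneg ξ).trans (hM ξ)) 4)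
    · rw [Set.indicator_of_notMem h, excess_of_notMem h]
      simp
  have hint4 : Integrable (fun ξ => excess Ω u k ξ ^ 4 * G.subLaplacian χ ξ) μ :=
    (hind (M ^ 4 * B)).mono' ((hw.pow 4).mul (continuous_subLaplacian hχ)).aestronglyMeasurable
      (Eventually.of_forall hPle)
  have hle : ∀ᵐ ξ ∂μ, χ ξ * (3 * G.gradSq (fun ξ => excess Ω u k ξ ^ 2) ξ) ≤
      χ ξ * G.subLaplacian (fun ξ => excess Ω u k ξ ^ 4) ξ + 4 * F * excess Ω u k ξ ^ 3 := by
    rw [ae_restrict_iff' hΩ.measurableSet] at hF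
    filter_upwards [hF] with ξ hξ
    rw [subLaplacian_excess_pow hΩ hu2 hu hk]
    have hw0 := pow_nonneg (excess_nonneg (Ω := Ω) (u := u) (k := k) ξ) 3
    by_cases h : ξ ∈ Ω
    · have h1 := (abs_le.1 (hξ h)).1
      have h2 : -F ≤ χ ξ * G.subLaplacian u ξ := by
        nlinarith [mul_nonneg (hχ0 ξ) (by linarith : 0 ≤ F + G.subLaplacian u ξ),
          mul_nonneg hF0 (sub_nonneg.2 (hχ1 ξ))]
      nlinarith [mul_nonneg hw0 (by linarith : 0 ≤ F + χ ξ * G.subLaplacian u ξ)]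
    · rw [excess_of_notMem h]
      simp
  calc ∫ ξ, χ ξ * (3 * G.gradSq (fun ξ => excess Ω u k ξ ^ 2) ξ) ∂μ
      ≤ ∫ ξ, (χ ξ * G.subLaplacian (fun ξ => excess Ω u k ξ ^ 4) ξ +
          4 * F * excess Ω u k ξ ^ 3) ∂μ := integral_mono_ae hint2 (hint1.add hint3) hle
    _ = ∫ ξ, excess Ω u k ξ ^ 4 * G.subLaplacian χ ξ ∂μ +
        ∫ ξ, 4 * F * excess Ω u k ξ ^ 3 ∂μ := by
        rw [integral_add hint1 hint3, hμ.integral_mul_subLaplacian hP hχ hχc]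
    _ ≤ ∫ ξ, Ω.indicator (fun _ => M ^ 4 * B) ξ ∂μ + ∫ ξ, 4 * F * excess Ω u k ξ ^ 3 ∂μ := by
        refine add_le_add ?_ le_rfl
        exact integral_mono hint4 (hind _) fun ξ => (le_abs_self _).trans (hPle ξ)
    _ = _ := by
        rw [integral_indicator_const _ hΩ.measurableSet, smul_eq_mul, mul_comm]

/-- The cutoff is spread out as χ ∘ δₐ with a → 0. Its sub-Laplacian is O(a²), so the error term
disappears, and Fatou's lemma gives the energy bound without cutoff. -/
theorem IsHaar.lintegral_gradSq_le (hμ : G.IsHaar μ) {Ω : Set (Coord m)}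
    {u : Coord m → ℝ} {k : ℝ} (hΩ : IsOpen Ω) (hΩμ : μ Ω < ∞) (hu2 : ContDiffOn ℝ 2 u Ω)
    (hu : ContinuousOn u (closure Ω)) (hk : ∀ ξ ∈ frontier Ω, u ξ < k) {M F : ℝ}
    (hM : ∀ ξ, excess Ω u k ξ ≤ M) (hF0 : 0 ≤ F)
    (hF : ∀ᵐ ξ ∂(μ.restrict Ω), |G.subLaplacian u ξ| ≤ F) :
    ∫⁻ ξ, ENNReal.ofReal (3 * G.gradSq (fun ξ => excess Ω u k ξ ^ 2) ξ) ∂μ ≤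
      ENNReal.ofReal (∫ ξ, 4 * F * excess Ω u k ξ ^ 3 ∂μ) := by
  have := hμ.isFiniteMeasureOnCompacts
  obtain ⟨χ, B, hχ, hχc, hχ0, hχ1, hχz, hB⟩ := exists_cutoff G
  have hv : ContDiff ℝ 1 fun ξ => excess Ω u k ξ ^ 2 := by
    simpa using contDiff_excess_pow hΩ hu2 hu hk (n := 1) (p := 2) one_le_two one_lt_two
  set D := fun ξ => 3 * G.gradSq (fun ξ => excess Ω u k ξ ^ 2) ξ with hD
  have hDc : Continuous D := continuous_const.mul (continuous_gradSq hv)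
  have hD0 : ∀ ξ, 0 ≤ D ξ := fun ξ => mul_nonneg (by norm_num) (gradSq_nonneg _ ξ)
  set a : ℕ → ℝ := fun n => 1 / ((n : ℝ) + 1) with ha
  have ha0 : ∀ n, 0 < a n := fun n => by positivity
  have hat : Tendsto a atTop (𝓝 0) := tendsto_one_div_add_atTop_nhds_zero_nat
  have hcont : ∀ n, ContDiff ℝ 2 fun ξ => χ (G.dilation (a n) ξ) := fun n =>
    hχ.comp (G.contDiff_dilation (a n))
  have hlim : ∀ ξ, Tendsto (fun n => ENNReal.ofReal (χ (G.dilation (a n) ξ) * D ξ)) atTop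
      (𝓝 (ENNReal.ofReal (D ξ))) := by
    intro ξ
    refine (ENNReal.continuous_ofReal.tendsto _).comp ?_
    have h1 := (hχ.continuous.tendsto 0).comp ((tendsto_dilation_zero (G := G) ξ).comp hat)
    rw [hχz] at h1
    simpa using h1.mul_const (D ξ)
  set I := ∫ ξ, 4 * F * excess Ω u k ξ ^ 3 ∂μ with hI
  have hbound : ∀ n, ∫⁻ ξ, ENNReal.ofReal (χ (G.dilation (a n) ξ) * D ξ) ∂μ ≤
      ENNReal.ofReal (M ^ 4 * (a n ^ 2 * B) * μ.real Ω + I) := by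
    intro n
    have hc := hasCompactSupport_comp_dilation (G := G) hχc (ha0 n)
    have hi : Integrable (fun ξ => χ (G.dilation (a n) ξ) * D ξ) μ :=
      ((hcont n).continuous.mul hDc).integrable_of_hasCompactSupport hc.mul_right
    rw [← ofReal_integral_eq_lintegral_ofReal hi
      (Eventually.of_forall fun ξ => mul_nonneg (hχ0 _) (hD0 ξ))]
    refine ENNReal.ofReal_le_ofReal ?_
    refine hμ.integral_cutoff_mul_gradSq_le hΩ hΩμ hu2 hu hk hM hF0 hF (hcont n) hc
      (fun _ => hχ0 _) (fun _ => hχ1 _) fun ξ => ?_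
    rw [subLaplacian_comp_dilation, abs_mul, abs_of_nonneg (sq_nonneg _)]
    exact mul_le_mul_of_nonneg_left (hB _) (sq_nonneg _)
  have hlim2 : Tendsto (fun n => ENNReal.ofReal (M ^ 4 * (a n ^ 2 * B) * μ.real Ω + I)) atTop
      (𝓝 (ENNReal.ofReal I)) := by
    refine (ENNReal.continuous_ofReal.tendsto _).comp ?_
    have := ((((hat.pow 2).mul_const B).const_mul (M ^ 4)).mul_const (μ.real Ω)).add_const I
    simpa using this
  calc ∫⁻ ξ, ENNReal.ofReal (D ξ) ∂μ
      = ∫⁻ ξ, liminf (fun n => ENNReal.ofReal (χ (G.dilation (a n) ξ) * D ξ)) atTop ∂μ :=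
        lintegral_congr fun ξ => ((hlim ξ).liminf_eq).symm
    _ ≤ liminf (fun n => ∫⁻ ξ, ENNReal.ofReal (χ (G.dilation (a n) ξ) * D ξ) ∂μ) atTop :=
        lintegral_liminf_le fun n => ((hcont n).continuous.mul hDc).measurable.ennreal_ofReal
    _ ≤ liminf (fun n => ENNReal.ofReal (M ^ 4 * (a n ^ 2 * B) * μ.real Ω + I)) atTop :=
        liminf_le_liminf (Eventually.of_forall hbound)
    _ = ENNReal.ofReal I := hlim2.liminf_eq

end CarnotGroup

end

noncomputable section

namespace CarnotGroup

open Filter Topology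

variable {𝔤 : Type*} [LieRing 𝔤] [LieAlgebra ℝ 𝔤] {s : ℕ} {m : Fin s → ℕ}
  {G : CarnotGroup 𝔤 s m}

attribute [local irreducible] CarnotGroup.mul

variable {μ : Measure (Coord m)}

/-! ### Decay of the measure of the superlevel sets -/

theorem four_mul_mul_pow_three_le {D w : ℝ} (hD : 0 ≤ D) (hw : 0 ≤ w) :
    4 * (D * w ^ 3) ≤ 3 * w ^ 4 + D ^ 4 := by
  have h : 0 ≤ (D - w) ^ 2 * (D ^ 2 + 2 * D * w + 3 * w ^ 2) := by positivity
  nlinarith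

/-- Faber-Krahn for w² and the energy bound give ∫w⁴ ≤ D∫w³ with D = (4/3)C₀ F S^(2/Q). Young's
inequality 4Dw³ ≤ 3w⁴ + D⁴ on {u > k} turns this into ∫w⁴ ≤ D⁴ μ{u > k}, and w ≥ h - k on {u > h}
yields the claim by Chebyshev. -/
theorem IsHaar.exists_superlevel_decay (hμ : G.IsHaar μ) : ∃ C : ℝ, 0 < C ∧
    ∀ (Ω : Set (Coord m)) (u : Coord m → ℝ) (k h S F M : ℝ), IsOpen Ω → μ Ω < ∞ →
      ContDiffOn ℝ 2 u Ω → ContinuousOn u (closure Ω) → (∀ ξ ∈ frontier Ω, u ξ < k) →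
      (∀ ξ ∈ Ω, |u ξ| ≤ M) → 0 ≤ F → (∀ᵐ ξ ∂(μ.restrict Ω), |G.subLaplacian u ξ| ≤ F) →
      k ≤ h → 0 < S → μ.real (Ω ∩ u ⁻¹' Set.Ioi k) ≤ S →
      (h - k) ^ 4 * μ.real (Ω ∩ u ⁻¹' Set.Ioi h) ≤ (C * F * S ^ (2 / (G.homDim : ℝ))) ^ 4 * S := by
  obtain ⟨C₀, hC₀, hFK⟩ := hμ.exists_faberKrahn
  refine ⟨4 / 3 * C₀, by positivity, ?_⟩
  intro Ω u k h S F M hΩ hΩμ hu2 hu hk hM hF0 hF hkh hS hkS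
  set T := S ^ (2 / (G.homDim : ℝ)) with hT
  have hT0 : 0 ≤ T := by positivity
  set D := 4 / 3 * C₀ * F * T with hD
  have hD0 : 0 ≤ D := by positivity
  set w := excess Ω u k with hw
  have hw0 : ∀ ξ, 0 ≤ w ξ := excess_nonneg
  have hwc : Continuous w := by
    have := (contDiff_excess_pow hΩ hu2 hu hk (n := 0) (p := 1) zero_le_two one_pos).continuous
    simpa using this
  have hv : ContDiff ℝ 1 fun ξ => w ξ ^ 2 := by
    simpa using contDiff_excess_pow hΩ hu2 hu hk (n := 1) (p := 2) one_le_two one_lt_two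
  have hwM : ∀ ξ, w ξ ≤ |M| + |k| := by
    intro ξ
    by_cases hξ : ξ ∈ Ω
    · rw [hw, excess_of_mem hξ]
      refine max_le ?_ (by positivity)
      have h1 := hM ξ hξ
      linarith [le_abs_self (u ξ), neg_abs_le k, le_abs_self M]
    · rw [hw, excess_of_notMem hξ]
      positivity
  have hopen : ∀ l, IsOpen (Ω ∩ u ⁻¹' Set.Ioi l) := fun l =>
    hu2.continuousOn.isOpen_inter_preimage hΩ isOpen_Ioi
  have hlt : ∀ l, μ (Ω ∩ u ⁻¹' Set.Ioi l) < ∞ := fun l =>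
    (measure_mono Set.inter_subset_left).trans_lt hΩμ
  have hind : ∀ l c : ℝ, Integrable ((Ω ∩ u ⁻¹' Set.Ioi l).indicator fun _ => c) μ := fun l c =>
    (integrable_indicator_iff (hopen l).measurableSet).2 (integrableOn_const (hlt l).ne)
  have hzero : ∀ ξ, ξ ∉ Ω ∩ u ⁻¹' Set.Ioi k → w ξ = 0 := by
    intro ξ hξ
    by_cases hξΩ : ξ ∈ Ω
    · rw [hw, excess_of_mem hξΩ, max_eq_right]
      have : ¬ k < u ξ := fun h => hξ ⟨hξΩ, h⟩
      linarith [not_lt.1 this]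
    · rw [hw, excess_of_notMem hξΩ]
  have hwint : ∀ p : ℕ, p ≠ 0 → Integrable (fun ξ => w ξ ^ p) μ := by
    intro p hp
    refine (hind k ((|M| + |k|) ^ p)).mono' (hwc.pow p).aestronglyMeasurable
      (Eventually.of_forall fun ξ => ?_)
    rw [Real.norm_of_nonneg (pow_nonneg (hw0 ξ) p)]
    by_cases h : ξ ∈ Ω ∩ u ⁻¹' Set.Ioi k
    · rw [Set.indicator_of_mem h]
      exact pow_le_pow_left₀ (hw0 ξ) (hwM ξ) p
    · rw [Set.indicator_of_notMem h, hzero ξ h, zero_pow hp]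
  have hJ : ∫⁻ ξ, ENNReal.ofReal ((w ξ ^ 2) ^ 2) ∂μ = ENNReal.ofReal (∫ ξ, w ξ ^ 4 ∂μ) := by
    rw [ofReal_integral_eq_lintegral_ofReal (hwint 4 four_ne_zero)
      (Eventually.of_forall fun ξ => pow_nonneg (hw0 ξ) 4)]
    simp only [← pow_mul]
  have hsupp : μ {ξ | w ξ ^ 2 ≠ 0} ≤ ENNReal.ofReal S := by
    refine (measure_mono (t := Ω ∩ u ⁻¹' Set.Ioi k) fun ξ hξ => ?_).trans ?_
    · by_contra hc
      exact hξ (by rw [hzero ξ hc, zero_pow two_ne_zero])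
    · rw [← ofReal_measureReal (hlt k).ne]
      exact ENNReal.ofReal_le_ofReal hkS
  have h1 := hFK (fun ξ => w ξ ^ 2) S hv (fun ξ => sq_nonneg _) hS hsupp
    (by rw [hJ]; exact ENNReal.ofReal_ne_top)
  have h2 := hμ.lintegral_gradSq_le hΩ hΩμ hu2 hu hk hwM hF0 hF
  rw [hJ, ← hT] at h1
  have hgm : Measurable fun ξ => ENNReal.ofReal (G.gradSq (fun ξ => w ξ ^ 2) ξ) :=
    (continuous_gradSq hv).measurable.ennreal_ofReal
  have h3 : ∫⁻ ξ, ENNReal.ofReal (3 * G.gradSq (fun ξ => w ξ ^ 2) ξ) ∂μ =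
      ENNReal.ofReal 3 * ∫⁻ ξ, ENNReal.ofReal (G.gradSq (fun ξ => w ξ ^ 2) ξ) ∂μ := by
    rw [← lintegral_const_mul _ hgm]
    refine lintegral_congr fun ξ => ?_
    rw [ENNReal.ofReal_mul (by norm_num)]
  rw [h3] at h2
  have hI0 : 0 ≤ ∫ ξ, 4 * F * w ξ ^ 3 ∂μ :=
    integral_nonneg fun ξ => mul_nonneg (by positivity) (pow_nonneg (hw0 ξ) 3)
  have h4 : 3 * ∫ ξ, w ξ ^ 4 ∂μ ≤ C₀ * T * ∫ ξ, 4 * F * w ξ ^ 3 ∂μ := by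
    rw [← ENNReal.ofReal_le_ofReal_iff (mul_nonneg (by positivity) hI0),
      ENNReal.ofReal_mul (by norm_num), ENNReal.ofReal_mul (p := C₀ * T) (by positivity)]
    calc ENNReal.ofReal 3 * ENNReal.ofReal (∫ ξ, w ξ ^ 4 ∂μ)
        ≤ ENNReal.ofReal 3 * (ENNReal.ofReal (C₀ * T) *
          ∫⁻ ξ, ENNReal.ofReal (G.gradSq (fun ξ => w ξ ^ 2) ξ) ∂μ) := by gcongr
      _ = ENNReal.ofReal (C₀ * T) * (ENNReal.ofReal 3 *
          ∫⁻ ξ, ENNReal.ofReal (G.gradSq (fun ξ => w ξ ^ 2) ξ) ∂μ) := by ring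
      _ ≤ _ := by gcongr
  have h5 : ∫ ξ, 4 * (D * w ξ ^ 3) ∂μ ≤
      ∫ ξ, (3 * w ξ ^ 4 + (Ω ∩ u ⁻¹' Set.Ioi k).indicator (fun _ => D ^ 4) ξ) ∂μ := by
    refine integral_mono (((hwint 3 three_ne_zero).const_mul D).const_mul 4)
      (((hwint 4 four_ne_zero).const_mul 3).add (hind k _)) fun ξ => ?_
    by_cases h : ξ ∈ Ω ∩ u ⁻¹' Set.Ioi k
    · simp only [Set.indicator_of_mem h]
      exact four_mul_mul_pow_three_le hD0 (hw0 ξ)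
    · simp only [Set.indicator_of_notMem h, hzero ξ h]
      simp
  rw [integral_add ((hwint 4 four_ne_zero).const_mul 3) (hind k _), integral_const_mul,
    integral_const_mul, integral_const_mul, integral_indicator_const _ (hopen k).measurableSet,
    smul_eq_mul] at h5
  rw [integral_const_mul] at h4
  have h6 : ∫ ξ, w ξ ^ 4 ∂μ ≤ D ^ 4 * μ.real (Ω ∩ u ⁻¹' Set.Ioi k) := by
    have e : C₀ * T * (4 * F * ∫ ξ, w ξ ^ 3 ∂μ) = 3 * (D * ∫ ξ, w ξ ^ 3 ∂μ) := by
      rw [hD]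
      ring
    rw [e] at h4
    linarith
  have h7 : (h - k) ^ 4 * μ.real (Ω ∩ u ⁻¹' Set.Ioi h) ≤ ∫ ξ, w ξ ^ 4 ∂μ := by
    rw [mul_comm, ← smul_eq_mul, ← integral_indicator_const _ (hopen h).measurableSet]
    refine integral_mono (hind h _) (hwint 4 four_ne_zero) fun ξ => ?_
    by_cases hξ : ξ ∈ Ω ∩ u ⁻¹' Set.Ioi h
    · rw [Set.indicator_of_mem hξ]
      refine pow_le_pow_left₀ (sub_nonneg.2 hkh) ?_ 4
      rw [hw, excess_of_mem hξ.1]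
      have : h < u ξ := hξ.2
      exact le_max_of_le_left (by linarith)
    · rw [Set.indicator_of_notMem hξ]
      exact pow_nonneg (hw0 ξ) 4
  exact h7.trans (h6.trans (mul_le_mul_of_nonneg_left hkS (by positivity)))

/-! ### The maximum principle -/

/-- The decay estimate is iterated on the levels k + K(1 - 2⁻ʲ), whose superlevel sets have measure
at most μ(Ω)qʲ. In the limit {u > k + K} is null; it is also open, and Haar measure charges nonempty
open sets. -/
theorem IsHaar.exists_le_of_lt (hμ : G.IsHaar μ) : ∃ C : ℝ, 0 < C ∧
    ∀ (Ω : Set (Coord m)) (u : Coord m → ℝ) (k F M : ℝ), IsOpen Ω → μ Ω < ∞ →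
      ContDiffOn ℝ 2 u Ω → ContinuousOn u (closure Ω) → (∀ ξ ∈ frontier Ω, u ξ < k) →
      (∀ ξ ∈ Ω, |u ξ| ≤ M) → 0 < F → (∀ᵐ ξ ∂(μ.restrict Ω), |G.subLaplacian u ξ| ≤ F) →
      ∀ ξ ∈ Ω, u ξ ≤ k + C * F * μ.real Ω ^ (2 / (G.homDim : ℝ)) := by
  obtain ⟨C, hC, hdecay⟩ := hμ.exists_superlevel_decay
  have := hμ.isOpenPosMeasure
  refine ⟨2 ^ (G.homDim + 1) * C, by positivity, ?_⟩
  intro Ω u k F M hΩ hΩμ hu2 hu hk hM hF0 hF ξ₀ hξ₀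
  set Q := G.homDim with hQ
  have hQ0 : 0 < Q := homDim_pos G
  have hQr : (0 : ℝ) < Q := by exact_mod_cast hQ0
  have hpos : 0 < μ.real Ω :=
    ENNReal.toReal_pos (hΩ.measure_ne_zero μ ⟨ξ₀, hξ₀⟩) hΩμ.ne
  set T := μ.real Ω ^ (2 / (Q : ℝ)) with hT
  have hT0 : 0 < T := by positivity
  -- At step j the decay factor is (C F T 2⁻ʲ)⁴ divided by the fourth power of the gap K 2⁻⁽ʲ⁺¹⁾.
  -- This K makes it 2^(-4Q), which is at most q.
  set K := 2 ^ (Q + 1) * C * F * T with hK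
  have hK0 : 0 < K := by positivity
  -- Chosen so that q^(2/Q) = 1/2: the factor S^(2/Q) then halves at each step, exactly as the gap
  -- between levels does.
  set q : ℝ := (1 / 2) ^ ((Q : ℝ) / 2) with hq
  have hq0 : 0 < q := by positivity
  have hq1 : q < 1 := Real.rpow_lt_one (by norm_num) (by norm_num) (by positivity)
  have hqT : ∀ j : ℕ, (μ.real Ω * q ^ j) ^ (2 / (Q : ℝ)) = T * (1 / 2) ^ j := by
    intro j
    rw [Real.mul_rpow hpos.le (by positivity), ← hT, hq, ← Real.rpow_natCast, ← Real.rpow_mul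
      (by positivity), ← Real.rpow_mul (by norm_num), ← Real.rpow_natCast]
    congr 2
    field_simp
  have hqle : ((1 / 2 : ℝ) ^ Q) ^ 4 ≤ q := by
    rw [← pow_mul, hq, ← Real.rpow_natCast]
    refine Real.rpow_le_rpow_of_exponent_ge (by norm_num) (by norm_num) ?_
    push_cast
    linarith
  have hstep : ∀ j : ℕ, μ.real (Ω ∩ u ⁻¹' Set.Ioi (k + K * (1 - (1 / 2) ^ j))) ≤
      μ.real Ω * q ^ j := by
    intro j
    induction j with
    | zero =>
      rw [pow_zero, pow_zero, mul_one]
      exact measureReal_mono Set.inter_subset_left hΩμ.ne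
    | succ j ih =>
      have hpj : (0 : ℝ) < (1 / 2) ^ j := by positivity
      have hfr : ∀ ξ ∈ frontier Ω, u ξ < k + K * (1 - (1 / 2) ^ j) := fun ξ hξ => by
        have h1 : (1 / 2 : ℝ) ^ j ≤ 1 := pow_le_one₀ (by norm_num) (by norm_num)
        have := mul_nonneg hK0.le (sub_nonneg.2 h1)
        linarith [hk ξ hξ]
      have hdiff : k + K * (1 - (1 / 2) ^ (j + 1)) - (k + K * (1 - (1 / 2) ^ j)) =
          K * (1 / 2) ^ (j + 1) := by ring
      have hd := hdecay Ω u (k + K * (1 - (1 / 2) ^ j)) (k + K * (1 - (1 / 2) ^ (j + 1)))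
        (μ.real Ω * q ^ j) F M hΩ hΩμ hu2 hu hfr hM hF0.le hF
        (by rw [← sub_nonneg, hdiff]; positivity) (by positivity) ih
      rw [hdiff, hqT j] at hd
      have e : C * F * (T * (1 / 2) ^ j) = K * (1 / 2) ^ (j + 1) * (1 / 2) ^ Q := by
        rw [hK, pow_succ (2 : ℝ) Q, pow_succ (1 / 2 : ℝ) j]
        have : (2 : ℝ) ^ Q * (1 / 2) ^ Q = 1 := by rw [← mul_pow]; norm_num
        linear_combination (-(C * F * T * (1 / 2) ^ j)) * this
      rw [e, mul_pow _ ((1 / 2 : ℝ) ^ Q), mul_assoc ((K * (1 / 2) ^ (j + 1)) ^ 4)] at hd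
      refine (le_of_mul_le_mul_left hd (by positivity)).trans ?_
      refine (mul_le_mul_of_nonneg_right hqle (by positivity)).trans_eq ?_
      ring
  have hzero : μ.real (Ω ∩ u ⁻¹' Set.Ioi (k + K)) ≤ 0 := by
    have hlim : Tendsto (fun j : ℕ => μ.real Ω * q ^ j) atTop (𝓝 0) := by
      simpa using (tendsto_pow_atTop_nhds_zero_of_lt_one hq0.le hq1).const_mul (μ.real Ω)
    refine ge_of_tendsto' hlim fun j => le_trans ?_ (hstep j)
    refine measureReal_mono (Set.inter_subset_inter_right _ fun ξ hξ => ?_)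
      ((measure_mono Set.inter_subset_left).trans_lt hΩμ).ne
    have h1 : k + K < u ξ := hξ
    have h2 : (0 : ℝ) < K * (1 / 2) ^ j := by positivity
    change k + K * (1 - (1 / 2) ^ j) < u ξ
    linarith
  by_contra hcon
  have hopen : IsOpen (Ω ∩ u ⁻¹' Set.Ioi (k + K)) :=
    hu2.continuousOn.isOpen_inter_preimage hΩ isOpen_Ioi
  have hne : (Ω ∩ u ⁻¹' Set.Ioi (k + K)).Nonempty := ⟨ξ₀, hξ₀, not_le.1 hcon⟩
  have := ENNReal.toReal_pos (hopen.measure_ne_zero μ hne)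
    ((measure_mono Set.inter_subset_left).trans_lt hΩμ).ne
  exact absurd hzero (not_le.2 this)

/-- The one-sided bound needs strict inequality on the boundary and F > 0. It is applied to u and -u
with k + ε and F + ε, and then ε → 0. -/
theorem IsHaar.exists_abs_le (hμ : G.IsHaar μ) : ∃ C : ℝ, 0 < C ∧
    ∀ (Ω : Set (Coord m)) (u : Coord m → ℝ) (k F M : ℝ), IsOpen Ω → μ Ω < ∞ →
      ContDiffOn ℝ 2 u Ω → ContinuousOn u (closure Ω) → (∀ ξ ∈ frontier Ω, |u ξ| ≤ k) →
      (∀ ξ ∈ Ω, |u ξ| ≤ M) → 0 ≤ F → (∀ᵐ ξ ∂(μ.restrict Ω), |G.subLaplacian u ξ| ≤ F) →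
      ∀ ξ ∈ Ω, |u ξ| ≤ k + C * F * μ.real Ω ^ (2 / (G.homDim : ℝ)) := by
  obtain ⟨C, hC, h⟩ := hμ.exists_le_of_lt
  refine ⟨C, hC, ?_⟩
  intro Ω u k F M hΩ hΩμ hu2 hu hk hM hF0 hF ξ hξ
  set T := μ.real Ω ^ (2 / (G.homDim : ℝ)) with hT
  have hT0 : 0 ≤ T := by positivity
  have hε : ∀ ε : ℝ, 0 < ε → |u ξ| ≤ (k + ε) + C * (F + ε) * T := by
    intro ε hε
    have hF' : ∀ᵐ ξ ∂(μ.restrict Ω), |G.subLaplacian u ξ| ≤ F + ε := by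
      filter_upwards [hF] with ξ hξ
      linarith
    refine abs_le'.2 ⟨?_, ?_⟩
    · refine h Ω u (k + ε) (F + ε) M hΩ hΩμ hu2 hu (fun η hη => ?_) hM (by positivity) hF' ξ hξ
      linarith [hk η hη, le_abs_self (u η)]
    · refine h Ω (fun ξ => -u ξ) (k + ε) (F + ε) M hΩ hΩμ hu2.neg hu.neg (fun η hη => ?_)
        (fun η hη => ?_) (by positivity) ?_ ξ hξ
      · linarith [hk η hη, neg_le_abs (u η)]
      · rw [abs_neg]
        exact hM η hη
      · filter_upwards [hF'] with η hη
        rwa [subLaplacian_neg, abs_neg]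
  have hlim : Tendsto (fun ε : ℝ => (k + ε) + C * (F + ε) * T) (𝓝[>] 0)
      (𝓝 ((k + 0) + C * (F + 0) * T)) := by
    have hc : Continuous fun ε : ℝ => (k + ε) + C * (F + ε) * T := by fun_prop
    exact (hc.tendsto 0).mono_left nhdsWithin_le_nhds
  rw [add_zero, add_zero] at hlim
  exact ge_of_tendsto hlim (eventually_mem_nhdsWithin.mono fun ε hε' => hε ε hε')

end CarnotGroup

end

theorem lemma2p5 {𝔤 : Type*} [LieRing 𝔤] [LieAlgebra ℝ 𝔤] {s : ℕ} {m : Fin s → ℕ}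
    (G : CarnotGroup 𝔤 s m) (μ : Measure (CarnotGroup.Coord m)) (hμ : G.IsHaar μ) :
    ∃ C : ℝ≥0, 0 < C ∧
      ∀ (Ω : Set (CarnotGroup.Coord m)) (u f g : CarnotGroup.Coord m → ℝ),
        IsOpen Ω → μ Ω < ∞ →
        MemLp f ∞ (μ.restrict Ω) →
        ContDiffOn ℝ 2 u Ω → ContinuousOn u (closure Ω) →
        BddAbove ((fun ξ => |u ξ|) '' Ω) →
        (∀ᵐ ξ ∂(μ.restrict Ω), G.subLaplacian u ξ = f ξ) →
        (∀ ξ ∈ frontier Ω, u ξ = g ξ) →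
        (⨆ ξ ∈ Ω, ENNReal.ofReal |u ξ|) ≤
          (⨆ ξ ∈ frontier Ω, ENNReal.ofReal |g ξ|) +
            (C : ℝ≥0∞) * eLpNorm f ∞ (μ.restrict Ω) * μ Ω ^ (2 / (G.homDim : ℝ)) *
              (2 : ℝ≥0∞) ^ (((G.homDim : ℝ) + 2) / 4) := by
  obtain ⟨C, hC, h⟩ := hμ.exists_abs_le
  refine ⟨C.toNNReal, Real.toNNReal_pos.2 hC, ?_⟩
  intro Ω u f g hΩ hΩμ hf hu2 hu hbdd hLu hg
  obtain ⟨M, hM⟩ := hbdd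
  set k := ⨆ ξ ∈ frontier Ω, ENNReal.ofReal |g ξ| with hk
  -- Both suprema are taken in [0, ∞], so an unbounded g makes the bound trivial; otherwise k is a
  -- real boundary bound.
  by_cases hk_top : k = ∞
  · rw [hk_top, top_add]
    exact le_top
  have hf_top : eLpNorm f ∞ (μ.restrict Ω) ≠ ∞ := hf.eLpNorm_ne_top
  -- The estimate is proved without this last factor, which is at least 1 and can be inserted
  -- freely.
  have hone : (1 : ℝ≥0∞) ≤ (2 : ℝ≥0∞) ^ (((G.homDim : ℝ) + 2) / 4) :=
    ENNReal.one_le_rpow one_le_two (by positivity)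
  refine iSup₂_le fun ξ hξ => ?_
  have hmain := h Ω u k.toReal (eLpNorm f ∞ (μ.restrict Ω)).toReal M hΩ hΩμ hu2 hu ?_
    (fun η hη => hM ⟨η, hη, rfl⟩) ENNReal.toReal_nonneg ?_ ξ hξ
  · have hT : ENNReal.ofReal (μ.real Ω ^ (2 / (G.homDim : ℝ))) = μ Ω ^ (2 / (G.homDim : ℝ)) := by
      rw [← ENNReal.ofReal_rpow_of_nonneg measureReal_nonneg (by positivity),
        ofReal_measureReal hΩμ.ne]
    calc ENNReal.ofReal |u ξ|
        ≤ ENNReal.ofReal (k.toReal + C * (eLpNorm f ∞ (μ.restrict Ω)).toReal *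
          μ.real Ω ^ (2 / (G.homDim : ℝ))) := ENNReal.ofReal_le_ofReal hmain
      _ = k + C.toNNReal * eLpNorm f ∞ (μ.restrict Ω) * μ Ω ^ (2 / (G.homDim : ℝ)) := by
        rw [ENNReal.ofReal_add ENNReal.toReal_nonneg (by positivity), ENNReal.ofReal_toReal hk_top,
          ENNReal.ofReal_mul (by positivity), ENNReal.ofReal_mul hC.le,
          ENNReal.ofReal_toReal hf_top, hT]
        rfl
      _ ≤ _ := by
        exact add_le_add le_rfl (le_mul_of_one_le_right' hone)
  · intro η hη
    rw [hg η hη, ← ENNReal.ofReal_le_iff_le_toReal hk_top]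
    exact le_iSup₂ (f := fun ξ (_ : ξ ∈ frontier Ω) => ENNReal.ofReal |g ξ|) η hη
  · filter_upwards [hLu, ae_le_eLpNormEssSup (f := f) (μ := μ.restrict Ω)] with η h1 h2
    rw [h1, ← Real.norm_eq_abs, ← toReal_enorm]
    rw [← eLpNorm_exponent_top] at h2
    exact ENNReal.toReal_mono hf_top h2
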